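/- **Lemma 1.5.** Let $\Omega\subset\mathbb R^3$ be a nonempty open bounded convex domain with $C^2$ boundary of positive Gaussian curvature and outward unit normal $n$. Let $0\le\alpha<1/2$, $B_0>0$, $0\le\gamma\le1$. For $(x,\zeta)\in\Omega\times(\mathbb R^3\setminus\{0\})$ put $\tau_-(x,\zeta)=\inf\{s>0: x-s\zeta\notin\Omega\}$, $q(x,\zeta)=x-\tau_-(x,\zeta)\zeta$, $$N(x,\zeta)=\frac{|n(q(x,\zeta))\cdot\zeta|}{|\zeta|},\qquad w(x,\zeta)=\frac{|\zeta|}{1+|\zeta|}\,N(x,\zeta),\qquad d_x=\operatorname{dist}(x,\partial\Omega).$$ For measurable $h:\Omega\times\mathbb R^3\to\mathbb R$ put $\|h\|_{L^\infty_\alpha}=\operatorname{ess\,sup}|h(x,\zeta)|e^{\alpha|\zeta|^2}$ and $$\|h\|_{\tilde{\mathcal W}_\alpha}=\|h\|_{L^\infty_\alpha}+\operatorname{ess\,sup}|\nabla_xh(x,\zeta)|\,w(x,\zeta)e^{\alpha|\zeta|^2}+\operatorname{ess\,sup}|\nabla_\zeta h(x,\zeta)|\,w(x,\zeta)e^{\alpha|\zeta|^2},$$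 where the essential suprema are over $\Omega\times\mathbb R^3$ and the gradients are weak (distributional, locally integrable) gradients on $\Omega\times\mathbb R^3$. Then $h\in\tilde{\mathcal W}_\alpha$ means that both weak gradients exist and $\|h\|_{\tilde{\mathcal W}_\alpha}<\infty$. Let $M(\zeta)=\pi^{-3/2}e^{-|\zeta|^2}$ and $\Gamma(h_1,h_2)=M^{-1/2}Q(M^{1/2}h_1,M^{1/2}h_2)$, where $Q$ acts in $\zeta$ for fixed $x$ by $$Q(F,G)(\zeta)=\int_{\mathbb R^3}\int_0^{2\pi}\int_0^{\pi/2}\big[F(\zeta')G(\zeta_*')-F(\zeta)G(\zeta_*)\big]\,B_0|\zeta-\zeta_*|^\gamma\sin\theta\cos\theta\,d\theta\,d\phi\,d\zeta_*,$$ with $\zeta'=\zeta+((\zeta_*-\zeta)\cdot\omega)\omega$, $\zeta_*'=\zeta_*-((\zeta_*-\zeta)\cdot\omega)\omega$ and $\omega=\cos\theta\,\frac{\zeta_*-\zeta}{|\zeta_*-\zeta|}+\sin\theta\cos\phi\,e_2+\sin\theta\sin\phi\,e_3$. Here $e_2,e_3$ are any unit vectors, depending measurably on $(\zeta,\zeta_*)$,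 such that $\big\{\frac{\zeta_*-\zeta}{|\zeta_*-\zeta|},e_2,e_3\big\}$ is an orthonormal basis of $\mathbb R^3$. Then there is a constant $C>0$, independent of $h_1,h_2$ and of the choice of $e_2,e_3$, such that for all $h_1,h_2\in\tilde{\mathcal W}_\alpha$ the integral defining $\Gamma(h_1,h_2)(x,\zeta)$ converges absolutely for a.e. $(x,\zeta)\in\Omega\times\mathbb R^3$, $\Gamma(h_1,h_2)$ has weak gradients in $x$ and in $\zeta$ on $\Omega\times\mathbb R^3$, and for a.e. $(x,\zeta)\in\Omega\times\mathbb R^3$ $$|\Gamma(h_1,h_2)(x,\zeta)|\le C\,\|h_1\|_{L^\infty_\alpha}\|h_2\|_{L^\infty_\alpha}\,e^{-\alpha|\zeta|^2}(1+|\zeta|)^\gamma,$$ $$|\nabla_x\Gamma(h_1,h_2)(x,\zeta)|\le C\big(d_x^{-1/2}+w(x,\zeta)^{-1}\big)\|h_1\|_{\tilde{\mathcal W}_\alpha}\|h_2\|_{\tilde{\mathcal W}_\alpha}\,e^{-\alpha|\zeta|^2}(1+|\zeta|)^\gamma,$$ $$|\nabla_\zeta\Gamma(h_1,h_2)(x,\zeta)|\le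 C\big(d_x^{-1/2}+w(x,\zeta)^{-1}\big)\|h_1\|_{\tilde{\mathcal W}_\alpha}\|h_2\|_{\tilde{\mathcal W}_\alpha}\,e^{-\alpha|\zeta|^2}(1+|\zeta|)^\gamma.$$ -/

import Mathlib

open Set MeasureTheory
open scoped ContDiff

noncomputable section

namespace Boltzmann

/-- Position space and velocity space: `ℝ³` with its Euclidean norm. -/
abbrev V : Type := EuclideanSpace ℝ (Fin 3)

/-! ### Geometry of the domain -/

/-- `ρ` is a `C²` defining function, on the open neighbourhood `U` of `p`, of the set `Ω`:
`Ω ∩ U = {ρ < 0} ∩ U`, with nowhere vanishing derivative on `U`. -/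
structure IsC2DefiningFunction (Ω : Set V) (p : V) (U : Set V) (ρ : V → ℝ) : Prop where
  isOpen : IsOpen U
  mem : p ∈ U
  contDiffOn : ContDiffOn ℝ 2 ρ U
  gradient_ne_zero : ∀ y ∈ U, gradient ρ y ≠ 0
  mem_iff : ∀ y ∈ U, y ∈ Ω ↔ ρ y < 0

/-- The boundary of `Ω` is of class `C²` (with `Ω` locally on one side of it). -/
def HasC2Boundary (Ω : Set V) : Prop :=
  ∀ p ∈ frontier Ω, ∃ U ρ, IsC2DefiningFunction Ω p U ρ

/-- The second fundamental form of the level surface of `ρ` through `p`, with respect to the unit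
normal `∇ρ/|∇ρ|`, evaluated at two tangent vectors. -/
def secondFundamentalForm (ρ : V → ℝ) (p u v : V) : ℝ :=
  fderiv ℝ (fderiv ℝ ρ) p u v / ‖gradient ρ p‖

/-- `K` is the Gaussian curvature of `∂Ω` at `p`: the determinant of the second fundamental form
in an orthonormal basis `u, v` of the tangent plane. -/
def HasGaussianCurvature (Ω : Set V) (p : V) (K : ℝ) : Prop :=
  ∃ (U : Set V) (ρ : V → ℝ) (u v : V),
    IsC2DefiningFunction Ω p U ρ ∧ Orthonormal ℝ ![u, v] ∧
    inner ℝ (gradient ρ p) u = 0 ∧ inner ℝ (gradient ρ p) v = 0 ∧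
    K = secondFundamentalForm ρ p u u * secondFundamentalForm ρ p v v
      - secondFundamentalForm ρ p u v ^ 2

/-- An open bounded convex domain of `ℝ³` with `C²` boundary of positive Gaussian curvature. -/
structure IsAdmissibleDomain (Ω : Set V) : Prop where
  isOpen : IsOpen Ω
  nonempty : Ω.Nonempty
  bounded : Bornology.IsBounded Ω
  convex : Convex ℝ Ω
  c2Boundary : HasC2Boundary Ω
  curvature_pos : ∀ p ∈ frontier Ω, ∃ K, HasGaussianCurvature Ω p K ∧ 0 < K

/-- `n` is the outward unit normal of `Ω` at the boundary point `p`. -/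
def IsOutwardNormal (Ω : Set V) (p n : V) : Prop :=
  ∃ U ρ, IsC2DefiningFunction Ω p U ρ ∧ n = ‖gradient ρ p‖⁻¹ • gradient ρ p

open Classical in
/-- The outward unit normal `n(p)` at `p ∈ ∂Ω` (and `0` where there is none). -/
def outwardNormal (Ω : Set V) (p : V) : V :=
  if H : p ∈ frontier Ω ∧ ∃ n, IsOutwardNormal Ω p n then H.2.choose else 0

/-- `τ₋(x, ζ)`: the backward exit time. -/
def tauMinus (Ω : Set V) (x ζ : V) : ℝ := sInf {s : ℝ | 0 < s ∧ x - s • ζ ∉ Ω}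

/-- `q(x, ζ)`: the backward exit point. -/
def exitPoint (Ω : Set V) (x ζ : V) : V := x - tauMinus Ω x ζ • ζ

/-- `N(x, ζ) = |n(q(x, ζ)) · ζ| / |ζ|`. -/
def normalCos (Ω : Set V) (x ζ : V) : ℝ :=
  |inner ℝ (outwardNormal Ω (exitPoint Ω x ζ)) ζ| / ‖ζ‖

/-- The weight `w(x, ζ) = |ζ| / (1 + |ζ|) * N(x, ζ)`. -/
def weight (Ω : Set V) (x ζ : V) : ℝ := ‖ζ‖ / (1 + ‖ζ‖) * normalCos Ω x ζ

/-- `d_x`: the distance from `x` to `∂Ω`. -/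
def bdryDist (Ω : Set V) (x : V) : ℝ := Metric.infDist x (frontier Ω)

/-! ### Weak gradients and function spaces on `Ω × ℝ³` -/

/-- The phase space `Ω × ℝ³`. -/
def phase (Ω : Set V) : Set (V × V) := Ω ×ˢ univ

/-- Lebesgue measure on the phase space. -/
def phaseMeasure (Ω : Set V) : Measure (V × V) := volume.restrict (phase Ω)

/-- Test functions: smooth with compact support contained in `Ω × ℝ³`. -/
structure IsTestFunction (Ω : Set V) (φ : V × V → ℝ) : Prop where
  contDiff : ContDiff ℝ ∞ φ
  hasCompactSupport : HasCompactSupport φ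
  tsupport_subset : tsupport φ ⊆ phase Ω

/-- `g` is the weak gradient of `h` with respect to the position variable on `Ω × ℝ³`. -/
structure IsWeakGradX (Ω : Set V) (h : V × V → ℝ) (g : V × V → V) : Prop where
  locallyIntegrable : LocallyIntegrableOn h (phase Ω)
  locallyIntegrable_grad : LocallyIntegrableOn g (phase Ω)
  integral_eq : ∀ φ, IsTestFunction Ω φ → ∀ v : V,
    ∫ z, h z * fderiv ℝ φ z (v, 0) ∂phaseMeasure Ω
      = - ∫ z, inner ℝ (g z) v * φ z ∂phaseMeasure Ω

/-- `g` is the weak gradient of `h` with respect to the velocity variable on `Ω × ℝ³`. -/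
structure IsWeakGradZeta (Ω : Set V) (h : V × V → ℝ) (g : V × V → V) : Prop where
  locallyIntegrable : LocallyIntegrableOn h (phase Ω)
  locallyIntegrable_grad : LocallyIntegrableOn g (phase Ω)
  integral_eq : ∀ φ, IsTestFunction Ω φ → ∀ v : V,
    ∫ z, h z * fderiv ℝ φ z (0, v) ∂phaseMeasure Ω
      = - ∫ z, inner ℝ (g z) v * φ z ∂phaseMeasure Ω

open Classical in
/-- A representative of the weak `x`-gradient (unique up to null sets), `0` if there is none. -/
def weakGradX (Ω : Set V) (h : V × V → ℝ) : V × V → V :=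
  if H : ∃ g, IsWeakGradX Ω h g then H.choose else 0

open Classical in
/-- A representative of the weak `ζ`-gradient (unique up to null sets), `0` if there is none. -/
def weakGradZeta (Ω : Set V) (h : V × V → ℝ) : V × V → V :=
  if H : ∃ g, IsWeakGradZeta Ω h g then H.choose else 0

/-- The norm of `L^∞_α(Ω × ℝ³)`. -/
def normLinf (Ω : Set V) (α : ℝ) (h : V × V → ℝ) : ENNReal :=
  essSup (fun z => ENNReal.ofReal (|h z| * Real.exp (α * ‖z.2‖ ^ 2))) (phaseMeasure Ω)

/-- The norm of `W_α`. -/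
def normW (Ω : Set V) (α : ℝ) (h : V × V → ℝ) : ENNReal :=
  normLinf Ω α h +
    essSup (fun z => ENNReal.ofReal
      (‖weakGradX Ω h z‖ * weight Ω z.1 z.2 * Real.exp (α * ‖z.2‖ ^ 2))) (phaseMeasure Ω)

/-- The norm of `W̃_α`. -/
def normWTilde (Ω : Set V) (α : ℝ) (h : V × V → ℝ) : ENNReal :=
  normW Ω α h +
    essSup (fun z => ENNReal.ofReal
      (‖weakGradZeta Ω h z‖ * weight Ω z.1 z.2 * Real.exp (α * ‖z.2‖ ^ 2))) (phaseMeasure Ω)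

/-- Membership in `W̃_α`. -/
structure MemWTilde (Ω : Set V) (α : ℝ) (h : V × V → ℝ) : Prop where
  aestronglyMeasurable : AEStronglyMeasurable h (phaseMeasure Ω)
  exists_gradX : ∃ g, IsWeakGradX Ω h g
  exists_gradZeta : ∃ g, IsWeakGradZeta Ω h g
  norm_lt_top : normWTilde Ω α h < ⊤

/-! ### The collision operator -/

/-- A (measurable) choice of unit vectors `e₂, e₃` such that
`(ζ_* - ζ)/|ζ_* - ζ|, e₂, e₃` is an orthonormal basis of `ℝ³` for all `ζ ≠ ζ_*`. -/
structure CollisionFrame where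
  e₂ : V → V → V
  e₃ : V → V → V
  measurable_e₂ : Measurable (Function.uncurry e₂)
  measurable_e₃ : Measurable (Function.uncurry e₃)
  orthonormal : ∀ ζ ζs : V, ζ ≠ ζs →
    Orthonormal ℝ ![‖ζs - ζ‖⁻¹ • (ζs - ζ), e₂ ζ ζs, e₃ ζ ζs]

/-- The unit vector `ω`. -/
def CollisionFrame.omega (e : CollisionFrame) (ζ ζs : V) (φ θ : ℝ) : V :=
  Real.cos θ • (‖ζs - ζ‖⁻¹ • (ζs - ζ)) + (Real.sin θ * Real.cos φ) • e.e₂ ζ ζs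
    + (Real.sin θ * Real.sin φ) • e.e₃ ζ ζs

/-- Post-collisional velocity `ζ'`. -/
def CollisionFrame.zetaPrime (e : CollisionFrame) (ζ ζs : V) (φ θ : ℝ) : V :=
  ζ + inner ℝ (ζs - ζ) (e.omega ζ ζs φ θ) • e.omega ζ ζs φ θ

/-- Post-collisional velocity `ζ_*'`. -/
def CollisionFrame.zetaStarPrime (e : CollisionFrame) (ζ ζs : V) (φ θ : ℝ) : V :=
  ζs - inner ℝ (ζs - ζ) (e.omega ζ ζs φ θ) • e.omega ζ ζs φ θ

/-- The cross section `B(r, θ) = B₀ r^γ sin θ cos θ`. -/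
def crossSection (B₀ γ r θ : ℝ) : ℝ := B₀ * r ^ γ * Real.sin θ * Real.cos θ

/-- The integrand of the collision operator. -/
def collisionIntegrand (e : CollisionFrame) (B₀ γ : ℝ) (F G : V → ℝ) (ζ ζs : V) (φ θ : ℝ) : ℝ :=
  (F (e.zetaPrime ζ ζs φ θ) * G (e.zetaStarPrime ζ ζs φ θ) - F ζ * G ζs)
    * crossSection B₀ γ ‖ζ - ζs‖ θ

/-- The collision integral defining `Q(F, G)(ζ)` converges absolutely. -/
def CollisionConverges (e : CollisionFrame) (B₀ γ : ℝ) (F G : V → ℝ) (ζ : V) : Prop :=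
  Integrable (fun p : V × ℝ × ℝ => collisionIntegrand e B₀ γ F G ζ p.1 p.2.1 p.2.2)
    ((volume : Measure V).prod
      (((volume : Measure ℝ).restrict (Ioc 0 (2 * Real.pi))).prod
        ((volume : Measure ℝ).restrict (Ioc 0 (Real.pi / 2)))))

/-- The collision operator `Q(F, G)`. -/
def collisionQ (e : CollisionFrame) (B₀ γ : ℝ) (F G : V → ℝ) (ζ : V) : ℝ :=
  ∫ ζs : V, ∫ φ in (0 : ℝ)..(2 * Real.pi), ∫ θ in (0 : ℝ)..(Real.pi / 2),
    collisionIntegrand e B₀ γ F G ζ ζs φ θ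

/-- The global Maxwellian `M(ζ) = π^{-3/2} e^{-|ζ|²}`. -/
def maxwellian (ζ : V) : ℝ := Real.pi ^ (-(3 / 2) : ℝ) * Real.exp (-‖ζ‖ ^ 2)

/-- The velocity profile `M^{1/2} h(x, ·)`. -/
def sqrtMaxwellianMul (h : V × V → ℝ) (x ζ : V) : ℝ := Real.sqrt (maxwellian ζ) * h (x, ζ)

/-- The nonlinear term `Γ(h₁, h₂) = M^{-1/2} Q(M^{1/2} h₁, M^{1/2} h₂)`. -/
def nonlinearTerm (e : CollisionFrame) (B₀ γ : ℝ) (h₁ h₂ : V × V → ℝ) (z : V × V) : ℝ :=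
  (Real.sqrt (maxwellian z.2))⁻¹ *
    collisionQ e B₀ γ (sqrtMaxwellianMul h₁ z.1) (sqrtMaxwellianMul h₂ z.1) z.2

end Boltzmann

end

/-!
In the relative velocity `u = ζ_* - ζ`, and after `M^{-1/2}` has been absorbed by conservation of
energy, the nonlinear term is the integral over `(u, φ, θ)` of

`B(|u|, θ) M(ζ + u)^{1/2} [h₁(x, ζ + a) h₂(x, ζ + u - a) - h₁(x, ζ) h₂(x, ζ + u)]`,

where the jump `a = a(u, φ, θ)` does not depend on `(x, ζ)`. This needs the frame `e₂, e₃` to depend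
on `ζ_* - ζ` only, which is no restriction: two frames differ by a rotation or reflection of the
angle `φ`, so the angular integral does not see the choice (`nonlinearTerm_eq`,
`lintegral_collision_eq`). For fixed `(u, φ, θ)` the profiles are only translated in `ζ`. Hence both
gradients of the integrand are given by the product rule, and position and velocity can be treated
at once, as directions `ι v` with `ι = inl` or `ι = inr`.

* *Geometry* (`IsAdmissibleDomain.exists_weight_inv_le`). Positive curvature and compactness of the
  boundary put `Ω` below a paraboloid of fixed opening at each boundary point `q`. For the backward
  exit point `q` of `x` this gives `N ≥ c |x - q|`, while the distance of `x` to the tangent plane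
  at `q` is `|x - q| N`; so `d_x ≤ C N²`, that is `w⁻¹ ≤ C d_x^{-1/2} (1 + |ζ|⁻¹)`. A profile of
  finite norm therefore has a gradient of size `d_x^{-1/2} (1 + |ζ|⁻¹) e^{-α|ζ|²}`.
* *Singular integral* (`exists_lintegral_collisionWeight_le`). In the product rule, gradients are
  evaluated at `ζ'`, `ζ_*'`, `ζ_*` and `ζ`. Energy conservation bounds the product of the
  exponential weights by `e^{-α|ζ|²}`, so the first three cost `d_x^{-1/2}` times the collision average of
  `1/|ζ'|`, `1/|ζ_*'|`, `1/|ζ_*|`. The angular average of `1/|ζ'|` is at most `C/|u|`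
  (`exists_angular_bound`), and the Gaussian `M(ζ_*)^{1/2}` makes `1/|u|` integrable. In the fourth
  the gradient stays outside the integral, and this is the only source of the term `w⁻¹`.
* *Weak derivatives* (`HasWeakDeriv.mul`, `HasWeakDeriv.integral_param`). The product rule holds for
  bounded functions with locally integrable weak derivatives, and weak derivatives pass through
  integrals over a parameter by Fubini's theorem.
* *Null sets* (`ae_collision_notMem`, `exists_isProfile`). The pre- and post-collisional velocities
  avoid a given null set for almost every `(x, ζ)`, so the profiles and their gradients may be
  replaced by measurable representatives for which all bounds hold everywhere.
-/

noncomputable section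

namespace Boltzmann

/-! ### Strict convexity of the domain and grazing trajectories -/

section Geometry

open Filter Topology Metric

variable {Ω : Set V} {p : V} {U : Set V} {ρ : V → ℝ}

lemma inner_gradient_eq_fderiv (ρ : V → ℝ) (x v : V) :
    inner ℝ (gradient ρ x) v = fderiv ℝ ρ x v := by
  simp [gradient]

lemma IsC2DefiningFunction.contDiffAt (h : IsC2DefiningFunction Ω p U ρ) {y : V} (hy : y ∈ U) :
    ContDiffAt ℝ 2 ρ y :=
  h.contDiffOn.contDiffAt (h.isOpen.mem_nhds hy)

lemma IsC2DefiningFunction.differentiableAt (h : IsC2DefiningFunction Ω p U ρ) {y : V}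
    (hy : y ∈ U) : DifferentiableAt ℝ ρ y :=
  (h.contDiffAt hy).differentiableAt (by norm_num)

lemma IsC2DefiningFunction.eq_zero (h : IsC2DefiningFunction Ω p U ρ) (hΩ : IsOpen Ω)
    {y : V} (hy : y ∈ U) (hyf : y ∈ frontier Ω) : ρ y = 0 := by
  have hynot : y ∉ Ω := by
    rw [frontier, hΩ.interior_eq] at hyf
    exact hyf.2
  refine le_antisymm ?_ ?_
  · by_contra hpos
    push Not at hpos
    have hev : ∀ᶠ z in 𝓝 y, 0 < ρ z :=
      (h.differentiableAt hy).continuousAt.eventually (lt_mem_nhds hpos)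
    have hfr : ∃ᶠ z in 𝓝 y, z ∈ Ω := mem_closure_iff_frequently.1 (frontier_subset_closure hyf)
    obtain ⟨z, hzΩ, hz, hzU⟩ := (hfr.and_eventually (hev.and (h.isOpen.mem_nhds hy))).exists
    exact absurd ((h.mem_iff z hzU).1 hzΩ) (not_lt.2 hz.le)
  · by_contra hneg
    push Not at hneg
    exact hynot ((h.mem_iff y hy).2 hneg)

/-- Moving a defining function to a nearby boundary point. -/
lemma IsC2DefiningFunction.of_mem (h : IsC2DefiningFunction Ω p U ρ) {y : V} (hy : y ∈ U) :
    IsC2DefiningFunction Ω y U ρ :=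
  ⟨h.isOpen, hy, h.contDiffOn, h.gradient_ne_zero, h.mem_iff⟩

lemma hasDerivAt_comp_segment {f : V → ℝ} {y s : V} {t : ℝ}
    (h : DifferentiableAt ℝ f (y + t • s)) :
    HasDerivAt (fun t : ℝ => f (y + t • s)) (fderiv ℝ f (y + t • s) s) t := by
  have h1 : HasDerivAt (fun t : ℝ => y + t • s) s t := by
    simpa using ((hasDerivAt_id t).smul_const s).const_add y
  exact h.hasFDerivAt.comp_hasDerivAt t h1

/-- The tangent plane at a boundary point is a supporting plane of a convex domain. -/
lemma IsC2DefiningFunction.fderiv_nonpos (h : IsC2DefiningFunction Ω p U ρ) (hΩ : IsOpen Ω)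
    (hc : Convex ℝ Ω) (hp : p ∈ frontier Ω) {y : V} (hy : y ∈ Ω) : fderiv ℝ ρ p (y - p) ≤ 0 := by
  have hd : HasDerivAt (fun t : ℝ => ρ (p + t • (y - p))) (fderiv ℝ ρ p (y - p)) 0 := by
    have := hasDerivAt_comp_segment (f := ρ) (y := p) (s := y - p) (t := 0)
      (by simpa using h.differentiableAt h.mem)
    simpa using this
  have hmem : ∀ᶠ t in 𝓝[>] (0 : ℝ), ρ (p + t • (y - p)) < 0 := by
    have hcont : ContinuousAt (fun t : ℝ => p + t • (y - p)) 0 := by fun_prop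
    have h1 : ∀ᶠ t in 𝓝[>] (0 : ℝ), p + t • (y - p) ∈ U :=
      (hcont.tendsto.eventually (by simpa using h.isOpen.mem_nhds h.mem)).filter_mono
        nhdsWithin_le_nhds
    filter_upwards [h1, Ioc_mem_nhdsGT (zero_lt_one' ℝ)] with t ht1 ht2
    refine (h.mem_iff _ ht1).1 ?_
    have := hc.add_smul_mem_interior' (frontier_subset_closure hp)
      (y := y - p) (by rw [hΩ.interior_eq]; simpa using hy) ht2
    rwa [hΩ.interior_eq] at this
  have h0 : ρ p = 0 := h.eq_zero hΩ h.mem hp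
  have hslope := (hasDerivAt_iff_tendsto_slope.1 hd).mono_left (nhdsGT_le_nhdsNE (0 : ℝ))
  refine le_of_tendsto hslope ?_
  filter_upwards [hmem, self_mem_nhdsWithin] with t ht ht0
  simp only [slope, vsub_eq_sub, sub_zero, zero_smul, add_zero, h0, smul_eq_mul]
  exact mul_nonpos_of_nonneg_of_nonpos (inv_nonneg.2 (le_of_lt ht0)) ht.le

lemma IsC2DefiningFunction.eventually_mem (h : IsC2DefiningFunction Ω p U ρ) (hΩ : IsOpen Ω)
    (hp : p ∈ frontier Ω) {s : V} (hs : fderiv ℝ ρ p s < 0) :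
    ∀ᶠ t in 𝓝[>] (0 : ℝ), p + t • s ∈ Ω := by
  have hd : HasDerivAt (fun t : ℝ => ρ (p + t • s)) (fderiv ℝ ρ p s) 0 := by
    have := hasDerivAt_comp_segment (f := ρ) (y := p) (s := s) (t := 0)
      (by simpa using h.differentiableAt h.mem)
    simpa using this
  have hcont : ContinuousAt (fun t : ℝ => p + t • s) 0 := by fun_prop
  have h1 : ∀ᶠ t in 𝓝[>] (0 : ℝ), p + t • s ∈ U :=
    (hcont.tendsto.eventually (by simpa using h.isOpen.mem_nhds h.mem)).filter_mono
      nhdsWithin_le_nhds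
  have h0 : ρ p = 0 := h.eq_zero hΩ h.mem hp
  have hslope := (hasDerivAt_iff_tendsto_slope.1 hd).mono_left (nhdsGT_le_nhdsNE (0 : ℝ))
  filter_upwards [hslope.eventually (gt_mem_nhds hs), h1, self_mem_nhdsWithin] with t ht ht1 ht0
  refine (h.mem_iff _ ht1).2 ?_
  simp only [slope, vsub_eq_sub, sub_zero, zero_smul, add_zero, h0, smul_eq_mul] at ht
  have ht0 : 0 < t := ht0
  rw [inv_mul_eq_div, div_lt_iff₀ ht0] at ht
  simpa using ht

/-- At a `C²` boundary point there is at most one unit vector supporting `Ω`. -/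
lemma IsC2DefiningFunction.eq_of_supporting (h : IsC2DefiningFunction Ω p U ρ) (hΩ : IsOpen Ω)
    (hp : p ∈ frontier Ω) {m : V} (hm : ‖m‖ = 1) (hsupp : ∀ y ∈ Ω, inner ℝ m (y - p) ≤ 0) :
    m = ‖gradient ρ p‖⁻¹ • gradient ρ p := by
  set N : V := ‖gradient ρ p‖⁻¹ • gradient ρ p with hN
  have hg : 0 < ‖gradient ρ p‖ := norm_pos_iff.2 (h.gradient_ne_zero p h.mem)
  have hN1 : ‖N‖ = 1 := by rw [hN, norm_smul, norm_inv, norm_norm, inv_mul_cancel₀ hg.ne']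
  have hNN : inner ℝ N N = 1 := by rw [real_inner_self_eq_norm_sq, hN1]; norm_num
  have hmm : inner ℝ m m = 1 := by rw [real_inner_self_eq_norm_sq, hm]; norm_num
  have hgr : ∀ s, fderiv ℝ ρ p s = ‖gradient ρ p‖ * inner ℝ N s := fun s => by
    rw [hN, inner_smul_left, inner_gradient_eq_fderiv]
    simp only [conj_trivial]
    field_simp
  clear_value N
  have key : ∀ s, inner ℝ N s < 0 → inner ℝ m s ≤ 0 := by
    intro s hs
    have hs' : fderiv ℝ ρ p s < 0 := by rw [hgr]; exact mul_neg_of_pos_of_neg hg hs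
    obtain ⟨t, ht, ht0⟩ := ((h.eventually_mem hΩ hp hs').and self_mem_nhdsWithin).exists
    have ht0 : 0 < t := ht0
    have := hsupp _ ht
    rw [add_sub_cancel_left, inner_smul_right] at this
    exact nonpos_of_mul_nonpos_right this ht0
  set a : ℝ := inner ℝ N m with ha
  have hna : inner ℝ m N = a := by rw [ha, real_inner_comm]
  have ha0 : 0 ≤ a := by
    have := key (-N) (by rw [inner_neg_right, hNN]; norm_num)
    rw [inner_neg_right, hna] at this; linarith
  have ha1 : a = 1 := by
    have hle : a ≤ 1 := by
      have := real_inner_le_norm N m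
      rw [hN1, hm] at this; simpa [ha] using this
    by_contra hne
    have hlt : a < 1 := lt_of_le_of_ne hle hne
    have hε : 0 < (1 - a ^ 2) / 2 := by nlinarith
    have := key (m - a • N - ((1 - a ^ 2) / 2) • N) (by
      rw [inner_sub_right, inner_sub_right, inner_smul_right, inner_smul_right, hNN, ← ha]
      nlinarith)
    rw [inner_sub_right, inner_sub_right, inner_smul_right, inner_smul_right, hmm, hna] at this
    nlinarith
  exact ((inner_eq_one_iff_of_norm_eq_one (𝕜 := ℝ) hN1 hm).1 ha1).symm

lemma IsC2DefiningFunction.normal_supporting (h : IsC2DefiningFunction Ω p U ρ) (hΩ : IsOpen Ω)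
    (hc : Convex ℝ Ω) (hp : p ∈ frontier Ω) {y : V} (hy : y ∈ Ω) :
    inner ℝ (‖gradient ρ p‖⁻¹ • gradient ρ p) (y - p) ≤ 0 := by
  rw [inner_smul_left, inner_gradient_eq_fderiv]
  exact mul_nonpos_of_nonneg_of_nonpos (by simp) (h.fderiv_nonpos hΩ hc hp hy)

lemma IsC2DefiningFunction.outwardNormal_eq (h : IsC2DefiningFunction Ω p U ρ) (hΩ : IsOpen Ω)
    (hc : Convex ℝ Ω) (hp : p ∈ frontier Ω) :
    outwardNormal Ω p = ‖gradient ρ p‖⁻¹ • gradient ρ p := by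
  have H : p ∈ frontier Ω ∧ ∃ n, IsOutwardNormal Ω p n := ⟨hp, _, U, ρ, h, rfl⟩
  rw [outwardNormal, dif_pos H]
  obtain ⟨U', ρ', h', hn⟩ := H.2.choose_spec
  rw [hn]
  refine h.eq_of_supporting hΩ hp ?_ fun y hy => h'.normal_supporting hΩ hc hp hy
  rw [norm_smul, norm_inv, norm_norm,
    inv_mul_cancel₀ (norm_pos_iff.2 (h'.gradient_ne_zero p h'.mem)).ne']

/-- A second order Taylor lower bound on `[0, 1]`. -/
lemma taylor_lower_bound {f f' f'' : ℝ → ℝ} {m : ℝ}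
    (hf : ∀ t ∈ Icc (0 : ℝ) 1, HasDerivAt f (f' t) t)
    (hf' : ∀ t ∈ Icc (0 : ℝ) 1, HasDerivAt f' (f'' t) t)
    (hm : ∀ t ∈ Icc (0 : ℝ) 1, m ≤ f'' t) : f 0 + f' 0 + m / 2 ≤ f 1 := by
  have h1 : MonotoneOn (fun t => f' t - m * t) (Icc 0 1) := by
    refine monotoneOn_of_hasDerivWithinAt_nonneg (f' := fun t => f'' t - m * 1) (convex_Icc 0 1)
      (fun t ht => ?_) (fun t ht => ?_) (fun t ht => ?_)
    · exact ((hf' t ht).sub ((hasDerivAt_id t).const_mul m)).continuousAt.continuousWithinAt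
    · exact ((hf' t (interior_subset ht)).sub
        ((hasDerivAt_id t).const_mul m)).hasDerivWithinAt
    · have := hm t (interior_subset ht); linarith
  have h2 : MonotoneOn (fun t => f t - f' 0 * t - m / 2 * t ^ 2) (Icc 0 1) := by
    have hd : ∀ t ∈ Icc (0 : ℝ) 1, HasDerivAt (fun t => f t - f' 0 * t - m / 2 * t ^ 2)
        (f' t - f' 0 - m * t) t := fun t ht => by
      have := ((hf t ht).sub ((hasDerivAt_id t).const_mul (f' 0))).sub
        ((hasDerivAt_pow 2 t).const_mul (m / 2))
      refine this.congr_deriv ?_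
      norm_num
      ring
    refine monotoneOn_of_hasDerivWithinAt_nonneg (convex_Icc 0 1)
      (fun t ht => (hd t ht).continuousAt.continuousWithinAt)
      (fun t ht => (hd t (interior_subset ht)).hasDerivWithinAt) (fun t ht => ?_)
    have ht' := interior_subset ht
    have := h1 (left_mem_Icc.2 zero_le_one) ht' ht'.1
    simp only [mul_zero, sub_zero] at this
    linarith
  have := h2 (left_mem_Icc.2 zero_le_one) (right_mem_Icc.2 zero_le_one) zero_le_one
  norm_num at this
  linarith

/-- Along tangent directions the Hessian of a defining function of a convex domain is
nonnegative: otherwise `p` would be the midpoint of two points of `Ω`. -/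
lemma IsC2DefiningFunction.hessian_nonneg (h : IsC2DefiningFunction Ω p U ρ) (hΩ : IsOpen Ω)
    (hc : Convex ℝ Ω) (hp : p ∈ frontier Ω) {s : V} (hs : fderiv ℝ ρ p s = 0) :
    0 ≤ fderiv ℝ (fderiv ℝ ρ) p s s := by
  by_contra hneg
  push Not at hneg
  have h2 : ContDiffOn ℝ 1 (fderiv ℝ ρ) U := h.contDiffOn.fderiv_of_isOpen h.isOpen (by norm_num)
  have hcont : ContinuousOn (fderiv ℝ (fderiv ℝ ρ)) U :=
    h2.continuousOn_fderiv_of_isOpen h.isOpen (by norm_num)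
  have hev : ∀ᶠ y in 𝓝 p, y ∈ U ∧ fderiv ℝ (fderiv ℝ ρ) y s s < 0 := by
    refine Filter.Eventually.and (h.isOpen.mem_nhds h.mem) ?_
    have hca : ContinuousAt (fun y => fderiv ℝ (fderiv ℝ ρ) y s s) p :=
      ((hcont.continuousAt (h.isOpen.mem_nhds h.mem)).clm_apply continuousAt_const).clm_apply
        continuousAt_const
    exact hca.eventually (gt_mem_nhds hneg)
  obtain ⟨r, hr, hball⟩ := Metric.eventually_nhds_iff_ball.1 hev
  have key : ∀ s', fderiv ℝ ρ p s' = 0 → fderiv ℝ (fderiv ℝ ρ) p s' s' < 0 →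
      (∀ t ∈ Icc (0 : ℝ) 1, p + t • s' ∈ U ∧ fderiv ℝ (fderiv ℝ ρ) (p + t • s') s' s' < 0) →
      p + s' ∈ Ω := by
    intro s' hs' hneg' hseg
    have hf : ∀ t ∈ Icc (0 : ℝ) 1, HasDerivAt (fun t : ℝ => ρ (p + t • s'))
        (fderiv ℝ ρ (p + t • s') s') t := fun t ht =>
      hasDerivAt_comp_segment (h.differentiableAt (hseg t ht).1)
    have hf' : ∀ t ∈ Icc (0 : ℝ) 1, HasDerivAt (fun t : ℝ => fderiv ℝ ρ (p + t • s') s')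
        (fderiv ℝ (fderiv ℝ ρ) (p + t • s') s' s') t := fun t ht => by
      have hd : DifferentiableAt ℝ (fderiv ℝ ρ) (p + t • s') :=
        (h2.contDiffAt (h.isOpen.mem_nhds (hseg t ht).1)).differentiableAt (by norm_num)
      have := hasDerivAt_comp_segment (f := fun y => fderiv ℝ ρ y s') (y := p) (s := s') (t := t)
        (hd.clm_apply (differentiableAt_const _))
      convert this using 1
      rw [fderiv_clm_apply hd (differentiableAt_const _)]
      simp
    have hanti : StrictAntiOn (fun t : ℝ => fderiv ℝ ρ (p + t • s') s') (Icc 0 1) := by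
      refine strictAntiOn_of_hasDerivWithinAt_neg (convex_Icc 0 1)
        (fun t ht => (hf' t ht).continuousAt.continuousWithinAt)
        (fun t ht => (hf' t (interior_subset ht)).hasDerivWithinAt)
        (fun t ht => (hseg t (interior_subset ht)).2)
    have hanti2 : StrictAntiOn (fun t : ℝ => ρ (p + t • s')) (Icc 0 1) := by
      refine strictAntiOn_of_hasDerivWithinAt_neg (convex_Icc 0 1)
        (fun t ht => (hf t ht).continuousAt.continuousWithinAt)
        (fun t ht => (hf t (interior_subset ht)).hasDerivWithinAt)
        (fun t ht => ?_)
      have ht1 : 0 < t := by rw [interior_Icc] at ht; exact ht.1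
      have := hanti (left_mem_Icc.2 zero_le_one) (interior_subset ht) ht1
      simpa [hs'] using this
    have h0 : ρ p = 0 := h.eq_zero hΩ h.mem hp
    have := hanti2 (left_mem_Icc.2 zero_le_one) (right_mem_Icc.2 zero_le_one) zero_lt_one
    simp only [one_smul, zero_smul, add_zero, h0] at this
    have hU : p + s' ∈ U := by simpa using (hseg 1 (right_mem_Icc.2 zero_le_one)).1
    exact (h.mem_iff _ hU).2 this
  -- a multiple of `s` short enough to stay in the ball
  set ε : ℝ := r / (2 * (‖s‖ + 1)) with hε
  have hεpos : 0 < ε := by positivity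
  have hεs : ε * ‖s‖ < r := by
    rw [hε, div_mul_eq_mul_div, div_lt_iff₀ (by positivity)]
    nlinarith [norm_nonneg s]
  have hin : ∀ σ : ℝ, |σ| = ε → p + σ • s ∈ Ω := by
    intro σ hσ
    have hσ2 : 0 < σ ^ 2 := by rw [← sq_abs, hσ]; positivity
    refine key (σ • s) (by simp [hs]) ?_ fun t ht => ?_
    · simp only [map_smul, smul_apply, smul_eq_mul]
      nlinarith
    · have hb : p + t • σ • s ∈ ball p r := by
        rw [mem_ball_iff_norm, add_sub_cancel_left, norm_smul, norm_smul, Real.norm_eq_abs,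
          Real.norm_eq_abs, hσ, abs_of_nonneg ht.1]
        calc t * (ε * ‖s‖) ≤ 1 * (ε * ‖s‖) := by gcongr; exact ht.2
          _ < r := by linarith
      refine ⟨(hball _ hb).1, ?_⟩
      simp only [map_smul, smul_apply, smul_eq_mul]
      have := (hball _ hb).2
      nlinarith
  have hmid := hc (hin ε (abs_of_pos hεpos)) (hin (-ε) (by rw [abs_neg, abs_of_pos hεpos]))
    (a := 1 / 2) (b := 1 / 2) (by norm_num) (by norm_num) (by norm_num)
  have : (1 / 2 : ℝ) • (p + ε • s) + (1 / 2 : ℝ) • (p + -ε • s) = p := by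
    module
  rw [this] at hmid
  rw [frontier, hΩ.interior_eq] at hp
  exact hp.2 hmid

lemma eq_sum_of_orthonormal {a b c : V} (h : Orthonormal ℝ ![a, b, c]) (s : V) :
    s = (inner ℝ a s : ℝ) • a + (inner ℝ b s : ℝ) • b + (inner ℝ c s : ℝ) • c := by
  have hspan : ⊤ ≤ Submodule.span ℝ (range ![a, b, c]) := by
    have := h.linearIndependent.span_eq_top_of_card_eq_finrank' (by simp)
    exact this.ge
  have := (OrthonormalBasis.mk h hspan).sum_repr' s
  rw [Fin.sum_univ_three] at this
  simpa using this.symm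

lemma fderiv_fderiv_symm (h : ContDiffAt ℝ 2 ρ p) (u v : V) :
    fderiv ℝ (fderiv ℝ ρ) p u v = fderiv ℝ (fderiv ℝ ρ) p v u :=
  (h.isSymmSndFDerivAt (by simp)).eq u v

/-- Positive Gaussian curvature makes the second fundamental form of a convex domain positive
definite. -/
lemma HasGaussianCurvature.exists_hessian_pos (hΩ : IsOpen Ω) (hc : Convex ℝ Ω)
    (hp : p ∈ frontier Ω) {K : ℝ} (hK : HasGaussianCurvature Ω p K) (hK0 : 0 < K) :
    ∃ U ρ, IsC2DefiningFunction Ω p U ρ ∧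
      ∀ s, s ≠ 0 → fderiv ℝ ρ p s = 0 → 0 < fderiv ℝ (fderiv ℝ ρ) p s s := by
  obtain ⟨U, ρ, u, v, h, huv, hu, hv, hKe⟩ := hK
  refine ⟨U, ρ, h, fun s hs0 hs => ?_⟩
  have hg : 0 < ‖gradient ρ p‖ := norm_pos_iff.2 (h.gradient_ne_zero p h.mem)
  rw [inner_gradient_eq_fderiv] at hu hv
  have huv' := huv
  rw [orthonormal_iff_ite] at huv
  have huv0 : inner ℝ u v = (0 : ℝ) := by simpa using huv 0 1
  set N : V := ‖gradient ρ p‖⁻¹ • gradient ρ p with hN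
  have hNs : ∀ s, inner ℝ N s = ‖gradient ρ p‖⁻¹ * fderiv ℝ ρ p s := fun s => by
    rw [hN, inner_smul_left, inner_gradient_eq_fderiv]; simp
  have hN1 : ‖N‖ = 1 := by rw [hN, norm_smul, norm_inv, norm_norm, inv_mul_cancel₀ hg.ne']
  have hNu : inner ℝ N u = (0 : ℝ) := by rw [hNs, hu, mul_zero]
  have hNv : inner ℝ N v = (0 : ℝ) := by rw [hNs, hv, mul_zero]
  have hvu0 : inner ℝ v u = (0 : ℝ) := by rw [real_inner_comm, huv0]
  have huN : inner ℝ u N = (0 : ℝ) := by rw [real_inner_comm, hNu]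
  have hvN : inner ℝ v N = (0 : ℝ) := by rw [real_inner_comm, hNv]
  have hu1 : ‖u‖ = 1 := by simpa using huv'.1 0
  have hv1 : ‖v‖ = 1 := by simpa using huv'.1 1
  have hon : Orthonormal ℝ ![N, u, v] := by
    rw [orthonormal_iff_ite]
    intro i j
    fin_cases i <;> fin_cases j <;> simp [hN1, hu1, hv1, hNu, hNv, huv0, hvu0, huN, hvN]
  clear_value N
  have hexp := eq_sum_of_orthonormal hon s
  rw [hNs, hs, mul_zero, zero_smul, zero_add] at hexp
  set a : ℝ := inner ℝ u s
  set b : ℝ := inner ℝ v s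
  set A := fderiv ℝ (fderiv ℝ ρ) p u u with hA
  set B := fderiv ℝ (fderiv ℝ ρ) p u v with hB
  set D := fderiv ℝ (fderiv ℝ ρ) p v v with hD
  have hsym : fderiv ℝ (fderiv ℝ ρ) p v u = B := fderiv_fderiv_symm (h.contDiffAt h.mem) v u
  have hAnn : 0 ≤ A := h.hessian_nonneg hΩ hc hp hu
  have hdet : 0 < A * D - B ^ 2 := by
    have : K = (A * D - B ^ 2) / ‖gradient ρ p‖ ^ 2 := by
      rw [hKe, hA, hB, hD]; simp only [secondFundamentalForm]; field_simp
    rw [this] at hK0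
    have := mul_pos hK0 (pow_pos hg 2)
    rwa [div_mul_cancel₀ _ (pow_pos hg 2).ne'] at this
  have hApos : 0 < A := by
    rcases hAnn.eq_or_lt with h0 | h0
    · rw [← h0] at hdet; nlinarith [sq_nonneg B]
    · exact h0
  have hval : fderiv ℝ (fderiv ℝ ρ) p s s = a ^ 2 * A + 2 * a * b * B + b ^ 2 * D := by
    rw [hexp]
    simp only [map_add, map_smul, add_apply, smul_apply, smul_eq_mul, hsym, ← hA, ← hB, ← hD]
    ring
  rw [hval]
  refine pos_of_mul_pos_right (a := A) ?_ hAnn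
  have e : A * (a ^ 2 * A + 2 * a * b * B + b ^ 2 * D)
      = (a * A + b * B) ^ 2 + b ^ 2 * (A * D - B ^ 2) := by ring
  rw [e]
  by_cases hb : b = 0
  · have ha : a ≠ 0 := by
      rintro ha
      apply hs0
      rw [hexp, ha, hb]; simp
    rw [hb]
    have : a * A ≠ 0 := mul_ne_zero ha hApos.ne'
    simp only [zero_mul, add_zero]
    positivity
  · have := mul_pos (pow_pos (abs_pos.2 hb) 2) hdet
    rw [sq_abs] at this
    positivity

/-- Near a boundary point, the domain lies inside a paraboloid with uniform opening below each
tangent plane. -/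
lemma exists_local_paraboloid (hΩ : IsAdmissibleDomain Ω) {p₀ : V} (hp₀ : p₀ ∈ frontier Ω) :
    ∃ r > 0, ∃ c > 0, ∀ p ∈ frontier Ω, dist p p₀ < r → ∀ y ∈ Ω, dist y p₀ < r →
      inner ℝ (outwardNormal Ω p) (y - p) ≤ -(c * ‖y - p‖ ^ 2) := by
  obtain ⟨K, hK, hK0⟩ := hΩ.curvature_pos p₀ hp₀
  obtain ⟨U, ρ, h, hpos⟩ := hK.exists_hessian_pos hΩ.isOpen hΩ.convex hp₀ hK0
  have h2 : ContDiffOn ℝ 1 (fderiv ℝ ρ) U := h.contDiffOn.fderiv_of_isOpen h.isOpen (by norm_num)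
  have hcont1 : ContinuousOn (fderiv ℝ ρ) U := h2.continuousOn
  have hcont2 : ContinuousOn (fderiv ℝ (fderiv ℝ ρ)) U :=
    h2.continuousOn_fderiv_of_isOpen h.isOpen (by norm_num)
  -- on unit vectors, either the gradient or the Hessian is bounded away from `0`
  let m : (V × V) × V → ℝ := fun z =>
    max |fderiv ℝ ρ z.1.1 z.2| (fderiv ℝ (fderiv ℝ ρ) z.1.2 z.2 z.2)
  have hm : ContinuousOn m ((U ×ˢ U) ×ˢ univ) := by
    have e1 : ContinuousOn (fun z : (V × V) × V => fderiv ℝ ρ z.1.1 z.2) ((U ×ˢ U) ×ˢ univ) :=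
      (hcont1.comp (t := U) (by fun_prop) (fun z hz => hz.1.1)).clm_apply (by fun_prop)
    have e2 : ContinuousOn (fun z : (V × V) × V => fderiv ℝ (fderiv ℝ ρ) z.1.2 z.2 z.2)
        ((U ×ˢ U) ×ˢ univ) :=
      ((hcont2.comp (t := U) (by fun_prop) (fun z hz => hz.1.2)).clm_apply (by fun_prop)).clm_apply
        (by fun_prop)
    exact e1.abs.sup e2
  have hsph : IsCompact (sphere (0 : V) 1) := isCompact_sphere 0 1
  have hK' : IsCompact ({(p₀, p₀)} ×ˢ sphere (0 : V) 1) := isCompact_singleton.prod hsph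
  have hmpos : ∀ z ∈ ({(p₀, p₀)} ×ˢ sphere (0 : V) 1 : Set ((V × V) × V)), 0 < m z := by
    rintro ⟨q, s⟩ ⟨hq, hs⟩
    obtain rfl : q = (p₀, p₀) := hq
    by_cases h0 : fderiv ℝ ρ p₀ s = 0
    · exact lt_max_of_lt_right (hpos s (by rintro rfl; simp at hs) h0)
    · exact lt_max_of_lt_left (abs_pos.2 h0)
  have hsub : ({(p₀, p₀)} ×ˢ sphere (0 : V) 1 : Set ((V × V) × V)) ⊆ (U ×ˢ U) ×ˢ univ := by
    rintro ⟨q, s⟩ ⟨hq, hs⟩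
    obtain rfl : q = (p₀, p₀) := hq
    exact ⟨⟨h.mem, h.mem⟩, mem_univ _⟩
  obtain ⟨ε, hε, hεm⟩ := hK'.exists_forall_le' (hm.mono hsub) hmpos
  have hopen : IsOpen (((U ×ˢ U) ×ˢ univ) ∩ m ⁻¹' Ioi (ε / 2)) :=
    hm.isOpen_inter_preimage ((h.isOpen.prod h.isOpen).prod isOpen_univ) isOpen_Ioi
  obtain ⟨W, S, hW, hS, hpW, hsS, hWS⟩ := generalized_tube_lemma isCompact_singleton hsph hopen
    (fun z hz => ⟨hsub hz, (half_lt_self hε).trans_le (hεm z hz)⟩)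
  have hWn : W ∈ 𝓝 (p₀, p₀) := hW.mem_nhds (hpW rfl)
  obtain ⟨r₁, hr₁, hrW⟩ := Metric.mem_nhds_iff.1 hWn
  -- the derivative is bounded near `p₀`
  obtain ⟨r₂, hr₂, hr₂G⟩ : ∃ r₂ > 0, ∀ y ∈ ball p₀ r₂, ‖fderiv ℝ ρ y‖ < ‖fderiv ℝ ρ p₀‖ + 1 :=
    Metric.eventually_nhds_iff_ball.1
      ((hcont1.continuousAt (h.isOpen.mem_nhds h.mem)).norm.eventually (gt_mem_nhds (by simp)))
  set G := ‖fderiv ℝ ρ p₀‖ + 1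
  have hGpos : 0 < G := by positivity
  set r := min r₁ r₂
  have hrpos : 0 < r := lt_min hr₁ hr₂
  refine ⟨r, hrpos, min (ε / 2 / (2 * r)) (ε / 4) / G, by positivity, fun p hp hpr y hy hyr => ?_⟩
  have hmem : ∀ q ∈ ball p₀ r, ∀ q' ∈ ball p₀ r, (q, q') ∈ W := fun q hq q' hq' =>
    hrW (by
      rw [← ball_prod_same]
      exact ⟨ball_subset_ball (min_le_left _ _) hq, ball_subset_ball (min_le_left _ _) hq'⟩)
  have hmain : ∀ q ∈ ball p₀ r, ∀ q' ∈ ball p₀ r, q ∈ U ∧ q' ∈ U ∧ ∀ s : V, s ≠ 0 →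
      ε / 2 * ‖s‖ ≤ |fderiv ℝ ρ q s| ∨ ε / 2 * ‖s‖ ^ 2 ≤ fderiv ℝ (fderiv ℝ ρ) q' s s := by
    intro q hq q' hq'
    have hUU : ∀ s ∈ sphere (0 : V) 1, ((q, q'), s) ∈ ((U ×ˢ U) ×ˢ univ) ∩ m ⁻¹' Ioi (ε / 2) :=
      fun s hs => hWS ⟨hmem q hq q' hq', hsS hs⟩
    obtain ⟨s₀, hs₀⟩ : (sphere (0 : V) 1).Nonempty := by
      refine NormedSpace.sphere_nonempty.2 zero_le_one
    refine ⟨(hUU s₀ hs₀).1.1.1, (hUU s₀ hs₀).1.1.2, fun s hs => ?_⟩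
    have hn : 0 < ‖s‖ := norm_pos_iff.2 hs
    have hs1 : ‖s‖⁻¹ • s ∈ sphere (0 : V) 1 := by
      rw [mem_sphere_zero_iff_norm, norm_smul, norm_inv, norm_norm, inv_mul_cancel₀ hn.ne']
    have := (hUU _ hs1).2
    simp only [m, mem_preimage, mem_Ioi, lt_max_iff, map_smul, smul_apply, smul_eq_mul, abs_mul,
      abs_inv, abs_norm] at this
    rcases this with h1 | h1
    · left
      rw [inv_mul_eq_div, lt_div_iff₀ hn] at h1
      exact h1.le
    · right
      rw [inv_mul_eq_div, inv_mul_eq_div, div_div, lt_div_iff₀ (by positivity)] at h1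
      rw [sq]; exact h1.le
  have hpb : p ∈ ball p₀ r := hpr
  have hyb : y ∈ ball p₀ r := hyr
  have hpU : p ∈ U := (hmain p hpb p hpb).1
  have hp' := h.of_mem hpU
  have hsne : y - p ≠ 0 := by
    rintro h0
    rw [sub_eq_zero] at h0
    rw [frontier, hΩ.isOpen.interior_eq] at hp
    exact hp.2 (h0 ▸ hy)
  set s := y - p with hs
  have hsn : 0 < ‖s‖ := norm_pos_iff.2 hsne
  have hsr : ‖s‖ ≤ 2 * r := by
    rw [hs, ← dist_eq_norm]
    have := dist_triangle_right y p p₀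
    linarith
  have hder : fderiv ℝ ρ p s ≤ 0 := hp'.fderiv_nonpos hΩ.isOpen hΩ.convex hp hy
  -- it suffices to bound the derivative
  have hsuff : fderiv ℝ ρ p s ≤ -(min (ε / 2 / (2 * r)) (ε / 4) * ‖s‖ ^ 2) := by
    by_cases hcase : ε / 2 * ‖s‖ ≤ |fderiv ℝ ρ p s|
    · rw [abs_of_nonpos hder] at hcase
      have : min (ε / 2 / (2 * r)) (ε / 4) * ‖s‖ ^ 2 ≤ ε / 2 * ‖s‖ := by
        calc min (ε / 2 / (2 * r)) (ε / 4) * ‖s‖ ^ 2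
            ≤ (ε / 2 / (2 * r)) * (‖s‖ * (2 * r)) := by
              rw [sq]
              gcongr
              exact min_le_left _ _
          _ = ε / 2 * ‖s‖ := by field_simp
      linarith
    · have hseg : ∀ t ∈ Icc (0 : ℝ) 1, p + t • s ∈ ball p₀ r := by
        intro t ht
        have := (convex_ball p₀ r).add_smul_sub_mem hpb hyb ht
        simpa [hs] using this
      have hHess : ∀ t ∈ Icc (0 : ℝ) 1, ε / 2 * ‖s‖ ^ 2 ≤ fderiv ℝ (fderiv ℝ ρ) (p + t • s) s s :=
        fun t ht => ((hmain p hpb _ (hseg t ht)).2.2 s hsne).resolve_left hcase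
      have hsegU : ∀ t ∈ Icc (0 : ℝ) 1, p + t • s ∈ U := fun t ht =>
        (hmain p hpb _ (hseg t ht)).2.1
      have hT := taylor_lower_bound (f := fun t => ρ (p + t • s))
        (f' := fun t => fderiv ℝ ρ (p + t • s) s)
        (fun t ht => hasDerivAt_comp_segment (h.differentiableAt (hsegU t ht)))
        (fun t ht => by
          have hd : DifferentiableAt ℝ (fderiv ℝ ρ) (p + t • s) :=
            (h2.contDiffAt (h.isOpen.mem_nhds (hsegU t ht))).differentiableAt (by norm_num)
          have := hasDerivAt_comp_segment (f := fun y => fderiv ℝ ρ y s) (y := p) (s := s) (t := t)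
            (hd.clm_apply (differentiableAt_const _))
          refine this.congr_deriv
            (g' := fderiv ℝ (fderiv ℝ ρ) (p + t • s) s s) ?_
          rw [fderiv_clm_apply hd (differentiableAt_const _)]
          simp) hHess
      simp only [zero_smul, add_zero, one_smul] at hT
      rw [hp'.eq_zero hΩ.isOpen hpU hp] at hT
      have hy0 : ρ (p + s) < 0 := by
        have : p + s = y := by simp [hs]
        rw [this]
        exact (h.mem_iff y (hmain y hyb y hyb).1).1 hy
      have : min (ε / 2 / (2 * r)) (ε / 4) * ‖s‖ ^ 2 ≤ ε / 4 * ‖s‖ ^ 2 := by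
        gcongr
        exact min_le_right _ _
      linarith
  rw [hp'.outwardNormal_eq hΩ.isOpen hΩ.convex hp, inner_smul_left, inner_gradient_eq_fderiv]
  have hg : 0 < ‖gradient ρ p‖ := norm_pos_iff.2 (h.gradient_ne_zero p hpU)
  have hgG : ‖gradient ρ p‖ ≤ G := by
    rw [gradient, LinearIsometryEquiv.norm_map]
    exact (hr₂G p (ball_subset_ball (min_le_right _ _) hpb)).le
  simp only [conj_trivial]
  rw [inv_mul_le_iff₀ hg]
  refine hsuff.trans ?_
  rw [mul_neg, neg_le_neg_iff, div_mul_eq_mul_div, ← mul_div_assoc, div_le_iff₀ hGpos, mul_comm]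
  gcongr

/-- **Uniform strict convexity**: the domain lies inside a paraboloid of fixed opening below each
of its tangent planes. -/
lemma IsAdmissibleDomain.exists_paraboloid (hΩ : IsAdmissibleDomain Ω) :
    ∃ c > 0, ∀ p ∈ frontier Ω, ∀ y ∈ Ω,
      inner ℝ (outwardNormal Ω p) (y - p) ≤ -(c * ‖y - p‖ ^ 2) := by
  have hcpt : IsCompact (frontier Ω) := hΩ.bounded.isCompact_closure.of_isClosed_subset
    isClosed_frontier frontier_subset_closure
  -- uniformity over the base point, for nearby points of the domain
  have hloc : ∃ δ > 0, ∃ c > 0, ∀ p ∈ frontier Ω, ∀ y ∈ Ω, dist y p < δ →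
      inner ℝ (outwardNormal Ω p) (y - p) ≤ -(c * ‖y - p‖ ^ 2) := by
    refine hcpt.induction_on (p := fun S => ∃ δ > 0, ∃ c > 0, ∀ p ∈ S, ∀ y ∈ Ω, dist y p < δ →
      inner ℝ (outwardNormal Ω p) (y - p) ≤ -(c * ‖y - p‖ ^ 2)) ?_ ?_ ?_ ?_
    · exact ⟨1, one_pos, 1, one_pos, by simp⟩
    · rintro S T hST ⟨δ, hδ, c, hc, H⟩
      exact ⟨δ, hδ, c, hc, fun p hp => H p (hST hp)⟩
    · rintro S T ⟨δ, hδ, c, hc, H⟩ ⟨δ', hδ', c', hc', H'⟩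
      refine ⟨min δ δ', lt_min hδ hδ', min c c', lt_min hc hc', fun p hp y hy hd => ?_⟩
      rcases hp with hp | hp
      · refine (H p hp y hy (hd.trans_le (min_le_left _ _))).trans ?_
        gcongr
        exact min_le_left _ _
      · refine (H' p hp y hy (hd.trans_le (min_le_right _ _))).trans ?_
        gcongr
        exact min_le_right _ _
    · intro p₀ hp₀
      obtain ⟨r, hr, c, hc, H⟩ := exists_local_paraboloid hΩ hp₀
      refine ⟨frontier Ω ∩ ball p₀ (r / 2),
        inter_mem_nhdsWithin _ (ball_mem_nhds p₀ (by positivity)), r / 2, by positivity, c, hc,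
        fun p hp y hy hd => H p hp.1 ?_ y hy ?_⟩
      · exact (mem_ball.1 hp.2).trans (by linarith)
      · have := dist_triangle y p p₀
        have := mem_ball.1 hp.2
        linarith
  obtain ⟨δ, hδ, c, hc, H⟩ := hloc
  obtain ⟨R, hR, hRΩ⟩ := hΩ.bounded.exists_pos_norm_le
  have hcl : ∀ p ∈ closure Ω, ‖p‖ ≤ R := fun p hp =>
    closure_minimal (fun y hy => hRΩ y hy) (isClosed_le continuous_norm continuous_const) hp
  refine ⟨min c (c * (δ / 2) / (2 * R)), by positivity, fun p hp y hy => ?_⟩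
  by_cases hd : dist y p < δ
  · refine (H p hp y hy hd).trans ?_
    gcongr
    exact min_le_left _ _
  -- far points are moved towards `p` along a segment
  · push Not at hd
    rw [dist_eq_norm] at hd
    have hs : 0 < ‖y - p‖ := hδ.trans_le hd
    set t : ℝ := δ / 2 / ‖y - p‖ with ht
    have ht0 : 0 < t := by positivity
    have ht1 : t ≤ 1 := by rw [ht, div_le_one hs]; linarith
    have hmem : p + t • (y - p) ∈ Ω := by
      have := hΩ.convex.add_smul_mem_interior' (frontier_subset_closure hp)
        (y := y - p) (by rw [hΩ.isOpen.interior_eq]; simpa using hy) ⟨ht0, ht1⟩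
      rwa [hΩ.isOpen.interior_eq] at this
    have hn : ‖t • (y - p)‖ = δ / 2 := by
      rw [norm_smul, Real.norm_eq_abs, abs_of_pos ht0, ht, div_mul_cancel₀ _ hs.ne']
    have := H p hp _ hmem (by rw [dist_eq_norm, add_sub_cancel_left, hn]; linarith)
    rw [add_sub_cancel_left, hn, inner_smul_right] at this
    have h2 : inner ℝ (outwardNormal Ω p) (y - p) ≤ -(c * (δ / 2) * ‖y - p‖) := by
      have h3 : t * ‖y - p‖ = δ / 2 := by rw [ht, div_mul_cancel₀ _ hs.ne']
      refine le_of_mul_le_mul_left (this.trans (le_of_eq ?_)) ht0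
      rw [← h3]; ring
    refine h2.trans (neg_le_neg ?_)
    have hle : ‖y - p‖ ≤ 2 * R := by
      have := norm_sub_le y p
      have := hRΩ y hy
      have := hcl p (frontier_subset_closure hp)
      linarith
    calc min c (c * (δ / 2) / (2 * R)) * ‖y - p‖ ^ 2
        ≤ (c * (δ / 2) / (2 * R)) * (‖y - p‖ * (2 * R)) := by
          rw [sq]; gcongr; exact min_le_right _ _
      _ = c * (δ / 2) * ‖y - p‖ := by field_simp

lemma IsAdmissibleDomain.norm_outwardNormal (hΩ : IsAdmissibleDomain Ω) (hp : p ∈ frontier Ω) :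
    ‖outwardNormal Ω p‖ = 1 := by
  obtain ⟨U, ρ, h⟩ := hΩ.c2Boundary p hp
  rw [h.outwardNormal_eq hΩ.isOpen hΩ.convex hp, norm_smul, norm_inv, norm_norm,
    inv_mul_cancel₀ (norm_pos_iff.2 (h.gradient_ne_zero p h.mem)).ne']

/-- The backward trajectory leaves the domain at a boundary point after a positive time. -/
lemma IsAdmissibleDomain.exitPoint_mem_frontier (hΩ : IsAdmissibleDomain Ω) {x ζ : V} (hx : x ∈ Ω)
    (hζ : ζ ≠ 0) : 0 < tauMinus Ω x ζ ∧ exitPoint Ω x ζ ∈ frontier Ω := by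
  have hn : 0 < ‖ζ‖ := norm_pos_iff.2 hζ
  have hcont : Continuous (fun s : ℝ => x - s • ζ) := by fun_prop
  set S : Set ℝ := {s : ℝ | 0 < s ∧ x - s • ζ ∉ Ω}
  have hbdd : BddBelow S := ⟨0, fun s hs => hs.1.le⟩
  have hne : S.Nonempty := by
    obtain ⟨R, hR, hRΩ⟩ := hΩ.bounded.exists_pos_norm_le
    refine ⟨(‖x‖ + R + 1) / ‖ζ‖, by positivity, fun hmem => ?_⟩
    have h1 := hRΩ _ hmem
    have h2 : ‖((‖x‖ + R + 1) / ‖ζ‖) • ζ‖ = ‖x‖ + R + 1 := by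
      rw [norm_smul, Real.norm_eq_abs, abs_of_pos (by positivity), div_mul_cancel₀ _ hn.ne']
    have h3 := norm_sub_norm_le (((‖x‖ + R + 1) / ‖ζ‖) • ζ) x
    rw [norm_sub_rev] at h3
    linarith
  have hev : ∀ᶠ s in 𝓝 (0 : ℝ), x - s • ζ ∈ Ω :=
    hcont.continuousAt.eventually (by simpa using hΩ.isOpen.mem_nhds hx)
  obtain ⟨r, hr, hball⟩ := Metric.eventually_nhds_iff.1 hev
  have hrS : ∀ s ∈ S, r ≤ s := by
    intro s hs
    by_contra hlt
    push Not at hlt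
    exact hs.2 (hball (by rw [Real.dist_eq, sub_zero, abs_of_pos hs.1]; exact hlt))
  have hτ : 0 < sInf S := hr.trans_le (le_csInf hne hrS)
  have hclosed : IsClosed S := by
    have : S = Ici r ∩ (fun s : ℝ => x - s • ζ) ⁻¹' Ωᶜ := by
      ext s
      exact ⟨fun hs => ⟨hrS s hs, hs.2⟩, fun hs => ⟨hr.trans_le hs.1, hs.2⟩⟩
    rw [this]
    exact isClosed_Ici.inter (hΩ.isOpen.isClosed_compl.preimage hcont)
  have hmem : sInf S ∈ S := hclosed.csInf_mem hne hbdd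
  refine ⟨hτ, ?_⟩
  rw [frontier, hΩ.isOpen.interior_eq]
  refine ⟨?_, hmem.2⟩
  have hlim : Tendsto (fun s : ℝ => x - s • ζ) (𝓝[<] (sInf S)) (𝓝 (x - sInf S • ζ)) :=
    (hcont.tendsto _).mono_left nhdsWithin_le_nhds
  refine mem_closure_of_tendsto hlim ?_
  filter_upwards [Ioo_mem_nhdsLT hτ] with s hs
  by_contra hcon
  exact absurd (csInf_le hbdd (show s ∈ S from ⟨hs.1, hcon⟩)) (not_le.2 hs.2)

lemma IsAdmissibleDomain.frontier_nonempty (hΩ : IsAdmissibleDomain Ω) :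
    (frontier Ω).Nonempty := by
  obtain ⟨x, hx⟩ := hΩ.nonempty
  obtain ⟨ζ, hζ⟩ := exists_ne (0 : V)
  exact ⟨_, (hΩ.exitPoint_mem_frontier hx hζ).2⟩

lemma IsAdmissibleDomain.bdryDist_pos (hΩ : IsAdmissibleDomain Ω) {x : V} (hx : x ∈ Ω) :
    0 < bdryDist Ω x := by
  refine (isClosed_frontier.notMem_iff_infDist_pos hΩ.frontier_nonempty).1 ?_
  rw [frontier, hΩ.isOpen.interior_eq]
  exact fun h => h.2 hx

lemma normalCos_le_one (hΩ : IsAdmissibleDomain Ω) {x ζ : V} (hx : x ∈ Ω) (hζ : ζ ≠ 0) :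
    normalCos Ω x ζ ≤ 1 := by
  have hn : 0 < ‖ζ‖ := norm_pos_iff.2 hζ
  rw [normalCos, div_le_one hn]
  have := abs_real_inner_le_norm (outwardNormal Ω (exitPoint Ω x ζ)) ζ
  rwa [hΩ.norm_outwardNormal (hΩ.exitPoint_mem_frontier hx hζ).2, one_mul] at this

lemma exists_mem_frontier_of_mem_of_notMem (hΩ : IsOpen Ω) {x y : V} (hx : x ∈ Ω) (hy : y ∉ Ω) :
    ∃ z ∈ frontier Ω, ‖z - x‖ ≤ ‖y - x‖ := by
  by_contra! hcon
  have hsplit : ∀ z ∈ segment ℝ x y, z ∉ Ω → z ∉ closure Ω := fun z hz hzΩ hzc =>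
    (hcon z (by rw [frontier, hΩ.interior_eq]; exact ⟨hzc, hzΩ⟩)).not_ge
      (norm_sub_le_of_mem_segment hz)
  obtain ⟨z, -, hz1, hz2⟩ := (convex_segment (𝕜 := ℝ) x y).isPreconnected Ω (closure Ω)ᶜ hΩ
    isClosed_closure.isOpen_compl
    (fun z hz => (em (z ∈ Ω)).imp id (hsplit z hz))
    ⟨x, left_mem_segment ℝ x y, hx⟩
    ⟨y, right_mem_segment ℝ x y, hsplit y (right_mem_segment ℝ x y) hy⟩
  exact hz2 (subset_closure hz1)

/-- The grazing estimate: the backward trajectory through `x` meets the boundary at an angle whose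
sine is bounded below by a multiple of `√d_x`. -/
lemma IsAdmissibleDomain.exists_normalCos_ge (hΩ : IsAdmissibleDomain Ω) :
    ∃ c > 0, ∀ x ∈ Ω, ∀ ζ : V, ζ ≠ 0 →
      c * bdryDist Ω x ^ (1 / 2 : ℝ) ≤ normalCos Ω x ζ := by
  obtain ⟨c, hc, H⟩ := hΩ.exists_paraboloid
  refine ⟨Real.sqrt c, Real.sqrt_pos.2 hc, fun x hx ζ hζ => ?_⟩
  have hn : 0 < ‖ζ‖ := norm_pos_iff.2 hζ
  obtain ⟨hτ, hq⟩ := hΩ.exitPoint_mem_frontier hx hζ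
  set τ := tauMinus Ω x ζ with hτd
  set q := exitPoint Ω x ζ with hqd
  set n := outwardNormal Ω q
  have hxq : x - q = τ • ζ := by rw [hqd, exitPoint]; simp [hτd]
  have hn1 : ‖n‖ = 1 := hΩ.norm_outwardNormal hq
  have h1 := H q hq x hx
  rw [hxq, inner_smul_right, norm_smul, Real.norm_eq_abs, abs_of_pos hτ] at h1
  set I : ℝ := inner ℝ n ζ with hI
  set N := normalCos Ω x ζ with hN
  have hNI : N * ‖ζ‖ = |I| := by
    rw [hN, normalCos, div_mul_cancel₀ _ hn.ne']
  have hI0 : I ≤ -(c * (τ * ‖ζ‖ ^ 2)) := by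
    refine le_of_mul_le_mul_left (h1.trans (le_of_eq ?_)) hτ
    ring
  have hIneg : I ≤ 0 := hI0.trans (by rw [neg_nonpos]; positivity)
  rw [abs_of_nonpos hIneg] at hNI
  have hNlow : c * (τ * ‖ζ‖) ≤ N := by
    refine le_of_mul_le_mul_right ?_ hn
    rw [hNI]; nlinarith
  -- the distance to the boundary is at most the distance to the tangent plane at `q`
  have hd : bdryDist Ω x ≤ τ * ‖ζ‖ * N := by
    set δ := τ * ‖ζ‖ * N with hδ
    have hδ0 : 0 ≤ δ := mul_nonneg (by positivity) (le_trans (by positivity) hNlow)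
    have hout : x + δ • n ∉ Ω := by
      intro hin
      have h2 := H q hq _ hin
      have e : x + δ • n - q = τ • ζ + δ • n := by rw [← hxq]; abel
      have e2 : inner ℝ n (x + δ • n - q) = (0 : ℝ) := by
        rw [e, inner_add_right, inner_smul_right, inner_smul_right, real_inner_self_eq_norm_sq,
          hn1, ← hI, hδ]
        nlinarith
      rw [e2] at h2
      have h3 : ‖x + δ • n - q‖ ^ 2 ≤ 0 := by nlinarith
      have h4 : x + δ • n - q = 0 := by
        rw [← norm_eq_zero]
        exact pow_eq_zero_iff (two_ne_zero) |>.1 (le_antisymm h3 (sq_nonneg _))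
      rw [sub_eq_zero] at h4
      rw [h4] at hin
      rw [frontier, hΩ.isOpen.interior_eq] at hq
      exact hq.2 hin
    obtain ⟨z, hz, hzx⟩ := exists_mem_frontier_of_mem_of_notMem hΩ.isOpen hx hout
    calc bdryDist Ω x ≤ dist x z := infDist_le_dist_of_mem hz
      _ = ‖z - x‖ := by rw [dist_comm, dist_eq_norm]
      _ ≤ ‖x + δ • n - x‖ := hzx
      _ = δ := by rw [add_sub_cancel_left, norm_smul, hn1, mul_one, Real.norm_eq_abs,
                    abs_of_nonneg hδ0]
  have hN0 : 0 ≤ N := le_trans (by positivity) hNlow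
  rw [← Real.sqrt_eq_rpow, ← Real.sqrt_mul hc.le]
  refine Real.sqrt_le_iff.2 ⟨hN0, ?_⟩
  calc c * bdryDist Ω x ≤ c * (τ * ‖ζ‖ * N) := by gcongr
    _ = c * (τ * ‖ζ‖) * N := by ring
    _ ≤ N * N := by gcongr
    _ = N ^ 2 := by ring

/-- The inverse weight is bounded by `d_x^{-1/2}`, up to the singularity at zero velocity; moreover
`d_x^{-1/2}` is bounded below. -/
lemma IsAdmissibleDomain.exists_weight_inv_le (hΩ : IsAdmissibleDomain Ω) :
    ∃ C > 0, (∀ x ∈ Ω, 1 ≤ C * bdryDist Ω x ^ (-(1 / 2) : ℝ)) ∧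
      ∀ x ∈ Ω, ∀ ζ : V, ζ ≠ 0 → 0 < weight Ω x ζ ∧
        (weight Ω x ζ)⁻¹ ≤ C * bdryDist Ω x ^ (-(1 / 2) : ℝ) * (1 + ‖ζ‖⁻¹) := by
  obtain ⟨c, hc, H⟩ := hΩ.exists_normalCos_ge
  refine ⟨c⁻¹, inv_pos.2 hc, fun x hx => ?_, fun x hx ζ hζ => ?_⟩
  · obtain ⟨ζ, hζ⟩ := exists_ne (0 : V)
    have h1 := (H x hx ζ hζ).trans (normalCos_le_one hΩ hx hζ)
    have hd := hΩ.bdryDist_pos hx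
    rw [Real.rpow_neg hd.le, ← mul_inv]
    exact (one_le_inv₀ (by positivity)).2 h1
  · have hd := hΩ.bdryDist_pos hx
    have hn : 0 < ‖ζ‖ := norm_pos_iff.2 hζ
    have hN := H x hx ζ hζ
    have hNpos : 0 < normalCos Ω x ζ := lt_of_lt_of_le (by positivity) hN
    refine ⟨by rw [weight]; positivity, ?_⟩
    rw [Real.rpow_neg hd.le, ← mul_inv, weight, mul_inv, mul_comm]
    have e : (‖ζ‖ / (1 + ‖ζ‖))⁻¹ = 1 + ‖ζ‖⁻¹ := by field_simp; ring
    rw [e]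
    gcongr

end Geometry

/-! ### Weak directional derivatives -/

section WeakDeriv

set_option linter.unusedSectionVars false

open Filter Topology Metric Function

variable {E : Type*} [NormedAddCommGroup E] [NormedSpace ℝ E] [MeasurableSpace E]

/-- `g` is the weak derivative of `h` on the set `O` in the direction `w`. -/
structure HasWeakDeriv (μ : Measure E) (O : Set E) (w : E) (h g : E → ℝ) : Prop where
  locallyIntegrable : LocallyIntegrableOn h O μ
  locallyIntegrable_deriv : LocallyIntegrableOn g O μ
  integral_eq : ∀ φ : E → ℝ, ContDiff ℝ ∞ φ → HasCompactSupport φ → tsupport φ ⊆ O →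
    ∫ z in O, h z * fderiv ℝ φ z w ∂μ = -∫ z in O, g z * φ z ∂μ

variable {μ : Measure E} {O : Set E} {w : E} {h g h₁ h₂ g₁ g₂ : E → ℝ}

lemma fderiv_apply_eq_zero_of_notMem {φ : E → ℝ} {z : E} (hz : z ∉ tsupport φ) (w : E) :
    fderiv ℝ φ z w = 0 :=
  image_eq_zero_of_notMem_tsupport (f := fun z => fderiv ℝ φ z w)
    fun hmem => hz (tsupport_fderiv_apply_subset ℝ w hmem)

lemma setIntegral_mul_eq_of_support_subset (f : E → ℝ) {ψ : E → ℝ} {K : Set E} (hK : K ⊆ O)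
    (hψ : ∀ z, z ∉ K → ψ z = 0) : ∫ z in O, f z * ψ z ∂μ = ∫ z, f z * ψ z ∂μ :=
  setIntegral_eq_integral_of_forall_compl_eq_zero fun z hz => by
    rw [hψ z fun h => hz (hK h), mul_zero]

variable [BorelSpace E]

lemma integrable_mul_of_locallyIntegrableOn {f ψ : E → ℝ} {K : Set E}
    (hf : LocallyIntegrableOn f O μ) (hK : IsCompact K) (hKO : K ⊆ O) (hψc : Continuous ψ)
    (hψ : ∀ z, z ∉ K → ψ z = 0) :
    Integrable (fun z => f z * ψ z) μ := by
  have h1 : IntegrableOn f K μ := hf.integrableOn_compact_subset hKO hK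
  have h2 := h1.mul_continuousOn hψc.continuousOn hK
  refine (integrableOn_iff_integrable_of_support_subset ?_).1 h2
  intro z hz
  by_contra hzK
  exact hz (by simp [hψ z hzK])

variable [FiniteDimensional ℝ E] [μ.IsAddHaarMeasure]

lemma integrable_mul_mul_comp_sub {a b R : E → ℝ} (ha : Integrable a μ) (hb : Integrable b μ)
    (hRc : Continuous R) {C : ℝ} (hR : ∀ x, ‖R x‖ ≤ C) :
    Integrable (fun p : E × E => a p.1 * (b p.2 * R (p.1 - p.2))) (μ.prod μ) := by
  have := (ha.mul_prod hb).mul_bdd (g := fun p : E × E => R (p.1 - p.2)) (c := C)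
    (by fun_prop) (Eventually.of_forall fun p => hR _)
  simpa only [mul_assoc] using this

lemma integral_mul_integral_comp_sub_swap {a b R : E → ℝ} (ha : Integrable a μ)
    (hb : Integrable b μ) (hRc : Continuous R) {C : ℝ} (hR : ∀ x, ‖R x‖ ≤ C) :
    ∫ y, a y * ∫ z, b z * R (y - z) ∂μ ∂μ = ∫ z, b z * ∫ y, a y * R (y - z) ∂μ ∂μ := by
  simp_rw [← integral_const_mul]
  rw [integral_integral_swap (integrable_mul_mul_comp_sub ha hb hRc hR)]
  refine integral_congr_ae (Eventually.of_forall fun z =>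
    integral_congr_ae (Eventually.of_forall fun y => ?_))
  ring

/-- Testing mollifications of a bounded function against an integrable function. -/
lemma tendsto_integral_mul_mollify {ι : Type*} {l : Filter ι} [l.IsCountablyGenerated]
    {φ : ι → ContDiffBump (0 : E)} {k : ℝ} (hφ : Tendsto (fun i => (φ i).rOut) l (𝓝 0))
    (hφk : ∀ᶠ i in l, (φ i).rOut ≤ k * (φ i).rIn) {a b : E → ℝ} (ha : Integrable a μ)
    (hb : Integrable b μ) (hbm : Measurable b) {C : ℝ} (hbC : ∀ z, ‖b z‖ ≤ C) :
    Tendsto (fun i => ∫ y, a y * ∫ z, b z * (φ i).normed μ (y - z) ∂μ ∂μ) l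
      (𝓝 (∫ y, a y * b y ∂μ)) := by
  have hconv : ∀ i y, convolution ((φ i).normed μ) b (ContinuousLinearMap.lsmul ℝ ℝ) μ y
      = ∫ z, b z * (φ i).normed μ (y - z) ∂μ := fun i y => by
    rw [convolution_eq_swap]
    simp [mul_comm]
  have hlim := ContDiffBump.ae_convolution_tendsto_right_of_locallyIntegrable hφ hφk
    hb.locallyIntegrable
  simp_rw [hconv] at hlim
  refine tendsto_integral_filter_of_dominated_convergence (fun y => ‖a y‖ * C) ?_ ?_
    (ha.norm.mul_const C) ?_
  · refine Eventually.of_forall fun i => ha.aestronglyMeasurable.mul ?_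
    refine (Measurable.stronglyMeasurable ?_).integral_prod_right'
      (f := fun p : E × E => b p.2 * (φ i).normed μ (p.1 - p.2)) |>.aestronglyMeasurable
    exact (hbm.comp measurable_snd).mul
      (((φ i).continuous_normed.comp (by fun_prop)).measurable)
  · refine Eventually.of_forall fun i => Eventually.of_forall fun y => ?_
    rw [norm_mul]
    refine mul_le_mul_of_nonneg_left ?_ (norm_nonneg _)
    have hint : Integrable (fun z => (φ i).normed μ (y - z)) μ :=
      ((φ i).integrable_normed (μ := μ)).comp_sub_left y
    calc ‖∫ z, b z * (φ i).normed μ (y - z) ∂μ‖ ≤ ∫ z, C * (φ i).normed μ (y - z) ∂μ := by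
          refine norm_integral_le_of_norm_le (hint.const_mul C) (Eventually.of_forall fun z => ?_)
          rw [norm_mul, Real.norm_of_nonneg ((φ i).nonneg_normed (y - z))]
          exact mul_le_mul_of_nonneg_right (hbC z) ((φ i).nonneg_normed _)
      _ = C := by
          rw [integral_const_mul, integral_sub_left_eq_self (fun x => (φ i).normed μ x) μ y,
            (φ i).integral_normed, mul_one]
  · filter_upwards [hlim] with y hy
    exact hy.const_mul (a y)

/-- **Product rule** for the weak derivatives of bounded functions. Only one factor is regularised:
the test function `φ(y) ρ_n(y - z)` on the doubled space carries the mollifier. -/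
theorem HasWeakDeriv.mul (hO : IsOpen O) (H₁ : HasWeakDeriv μ O w h₁ g₁)
    (H₂ : HasWeakDeriv μ O w h₂ g₂) (m₁ : Measurable h₁) (m₂ : Measurable h₂) {C₁ C₂ : ℝ}
    (b₁ : ∀ z, ‖h₁ z‖ ≤ C₁) (b₂ : ∀ z, ‖h₂ z‖ ≤ C₂) :
    HasWeakDeriv μ O w (fun z => h₁ z * h₂ z) (fun z => g₁ z * h₂ z + h₁ z * g₂ z) := by
  have hLC : IsLocallyClosed O := hO.isLocallyClosed
  have hbm : ∀ {f b : E → ℝ} {C : ℝ}, LocallyIntegrableOn f O μ → Measurable b →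
      (∀ z, ‖b z‖ ≤ C) → LocallyIntegrableOn (fun z => f z * b z) O μ := by
    intro f b C hf hb hC
    rw [locallyIntegrableOn_iff hLC] at hf ⊢
    intro k hk hkc
    exact (hf k hk hkc).mul_bdd hb.aestronglyMeasurable (Eventually.of_forall hC)
  refine ⟨hbm H₁.locallyIntegrable m₂ b₂, (hbm H₁.locallyIntegrable_deriv m₂ b₂).add ?_, ?_⟩
  · simpa only [mul_comm] using hbm H₂.locallyIntegrable_deriv m₁ b₁
  intro φ hφ hφc hφO
  set K := tsupport φ
  have hKc : IsCompact K := hφc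
  obtain ⟨δ, hδ, hδO⟩ := hKc.exists_cthickening_subset_open hO hφO
  set K' := cthickening δ K
  have hK'c : IsCompact K' := hKc.cthickening
  have hK'm : MeasurableSet K' := hK'c.measurableSet
  have hKK' : K ⊆ K' := self_subset_cthickening K
  have hφ0 : ∀ z, z ∉ K → φ z = 0 := fun z hz => image_eq_zero_of_notMem_tsupport hz
  have hdφ0 : ∀ z, z ∉ K → fderiv ℝ φ z w = 0 := fun z hz => fderiv_apply_eq_zero_of_notMem hz w
  have hφcont : Continuous φ := hφ.continuous
  have hdφcont : Continuous (fun z => fderiv ℝ φ z w) :=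
    (hφ.continuous_fderiv (by simp)).clm_apply continuous_const
  -- truncations, so that everything becomes globally integrable
  set H : (E → ℝ) → E → ℝ := fun f => K'.indicator f
  have hHK : ∀ f z, z ∈ K' → H f z = f z := fun f z hz => indicator_of_mem hz f
  have hint : ∀ {f}, LocallyIntegrableOn f O μ → Integrable (H f) μ := fun hf =>
    (hf.integrableOn_compact_subset hδO hK'c).integrable_indicator hK'm
  have hweak : ∀ {f g : E → ℝ}, HasWeakDeriv μ O w f g → ∀ ψ : E → ℝ, ContDiff ℝ ∞ ψ →
      HasCompactSupport ψ → tsupport ψ ⊆ K' →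
      ∫ z, H f z * fderiv ℝ ψ z w ∂μ = -∫ z, H g z * ψ z ∂μ := by
    intro f g hfg ψ h1 h2 h3
    have h4 := hfg.integral_eq ψ h1 h2 (h3.trans hδO)
    rw [setIntegral_mul_eq_of_support_subset f (h3.trans hδO)
      (fun z hz => fderiv_apply_eq_zero_of_notMem hz w),
      setIntegral_mul_eq_of_support_subset g (h3.trans hδO)
      (fun z hz => image_eq_zero_of_notMem_tsupport hz)] at h4
    have e : ∀ (f ψ' : E → ℝ), (∀ z, z ∉ tsupport ψ → ψ' z = 0) →
        ∀ z, H f z * ψ' z = f z * ψ' z := by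
      intro f ψ' hψ' z
      by_cases hz : z ∈ tsupport ψ
      · rw [hHK f z (h3 hz)]
      · rw [hψ' z hz, mul_zero, mul_zero]
    simp_rw [e f _ (fun z hz => fderiv_apply_eq_zero_of_notMem hz w),
      e g _ (fun z hz => image_eq_zero_of_notMem_tsupport hz)]
    exact h4
  have hHb : ∀ {f : E → ℝ} {C : ℝ}, (∀ z, ‖f z‖ ≤ C) → ∀ z, ‖H f z‖ ≤ C := fun hf z =>
    (norm_indicator_le_norm_self _ _).trans (hf z)
  obtain ⟨Cφ, hCφ⟩ := hφcont.bounded_above_of_compact_support hφc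
  obtain ⟨Cd, hCd⟩ := hdφcont.bounded_above_of_compact_support (hφc.fderiv_apply ℝ w)
  -- the four integrable factors
  have iH₁ := hint H₁.locallyIntegrable
  have iH₂ := hint H₂.locallyIntegrable
  have iG₁ := hint H₁.locallyIntegrable_deriv
  have iG₂ := hint H₂.locallyIntegrable_deriv
  have iA : Integrable (fun z => H h₁ z * fderiv ℝ φ z w) μ :=
    iH₁.mul_bdd hdφcont.aestronglyMeasurable (Eventually.of_forall hCd)
  have iB : Integrable (fun z => H h₁ z * φ z) μ :=
    iH₁.mul_bdd hφcont.aestronglyMeasurable (Eventually.of_forall hCφ)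
  have iD : Integrable (fun z => H g₁ z * φ z) μ :=
    iG₁.mul_bdd hφcont.aestronglyMeasurable (Eventually.of_forall hCφ)
  have mH₁ : Measurable (H h₁) := m₁.indicator hK'm
  have mH₂ : Measurable (H h₂) := m₂.indicator hK'm
  -- a sequence of mollifiers
  let ρ : ℕ → ContDiffBump (0 : E) := fun n =>
    ⟨δ / (2 * (n + 1)), δ / (n + 1), by positivity, by
      rw [div_lt_div_iff₀ (by positivity) (by positivity)]; nlinarith⟩
  have hρ0 : Tendsto (fun n => (ρ n).rOut) atTop (𝓝 0) :=
    tendsto_const_nhds.div_atTop (tendsto_natCast_atTop_atTop.atTop_add tendsto_const_nhds)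
  have hρk : ∀ᶠ n in atTop, (ρ n).rOut ≤ 2 * (ρ n).rIn := Eventually.of_forall fun n => by
    simp only [ρ]; apply le_of_eq; field_simp
  have hρδ : ∀ n, (ρ n).rOut ≤ δ := fun n => by
    simp only [ρ]; exact div_le_self hδ.le (by linarith [n.cast_nonneg (α := ℝ)])
  have hid : ∀ n, (∫ y, (H h₁ y * fderiv ℝ φ y w) * ∫ z, H h₂ z * (ρ n).normed μ (y - z) ∂μ ∂μ)
      + (∫ z, H g₂ z * ∫ y, (H h₁ y * φ y) * (ρ n).normed μ (z - y) ∂μ ∂μ)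
      = -∫ y, (H g₁ y * φ y) * ∫ z, H h₂ z * (ρ n).normed μ (y - z) ∂μ ∂μ := by
    intro n
    set R : E → ℝ := (ρ n).normed μ with hR
    have hRs : ContDiff ℝ ∞ R := (ρ n).contDiff_normed
    have hRcs : HasCompactSupport R := (ρ n).hasCompactSupport_normed
    have hRt : tsupport R = closedBall 0 (ρ n).rOut := (ρ n).tsupport_normed_eq
    have hRneg : ∀ y z, R (z - y) = R (y - z) := fun y z => by
      rw [← neg_sub, hR, (ρ n).normed_neg]
    set dR : E → ℝ := fun x => fderiv ℝ R x w with hdR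
    have hRc : Continuous R := hRs.continuous
    have hdRc : Continuous dR := (hRs.continuous_fderiv (by simp)).clm_apply continuous_const
    obtain ⟨CR, hCR⟩ := hRc.bounded_above_of_compact_support hRcs
    obtain ⟨CdR, hCdR⟩ := hdRc.bounded_above_of_compact_support (hRcs.fderiv_apply ℝ w)
    have hRd : ∀ x, DifferentiableAt ℝ R x := fun x => hRs.differentiable (by simp) x
    have hd1 : ∀ y z, fderiv ℝ (fun y => R (y - z)) y w = dR (y - z) := fun y z => by
      rw [fderiv_comp_sub]
    have hd2 : ∀ y z, fderiv ℝ (fun z => R (y - z)) z w = -dR (y - z) := fun y z => by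
      have : HasFDerivAt (fun z => R (y - z)) ((fderiv ℝ R (y - z)).comp
          (-(ContinuousLinearMap.id ℝ E))) z :=
        (hRd (y - z)).hasFDerivAt.comp z ((hasFDerivAt_id z).const_sub y)
      rw [this.fderiv]
      simp [hdR]
    -- integration by parts in the second variable
    have II : ∀ y, φ y * ∫ z, H h₂ z * dR (y - z) ∂μ = φ y * ∫ z, H g₂ z * R (y - z) ∂μ := by
      intro y
      by_cases hy : y ∈ K
      · have hts : tsupport (fun z => R (y - z)) ⊆ closedBall y (ρ n).rOut := by
          refine closure_minimal (fun z hz => ?_) isClosed_closedBall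
          have : y - z ∈ closedBall (0 : E) (ρ n).rOut := hRt ▸ subset_tsupport R hz
          rwa [mem_closedBall_zero_iff, ← dist_eq_norm, dist_comm, ← mem_closedBall] at this
        have := hweak H₂ (fun z => R (y - z)) (hRs.comp (contDiff_const.sub contDiff_id))
          ((isCompact_closedBall y (ρ n).rOut).of_isClosed_subset (isClosed_tsupport _) hts)
          (hts.trans ((closedBall_subset_closedBall (hρδ n)).trans
            (closedBall_subset_cthickening hy δ)))
        simp_rw [hd2, mul_neg, integral_neg] at this
        rw [neg_inj.1 this]
      · rw [hφ0 y hy, zero_mul, zero_mul]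
    -- integration by parts in the first variable
    have I : ∀ z, (∫ y, (H h₁ y * fderiv ℝ φ y w) * R (y - z) ∂μ)
        + (∫ y, (H h₁ y * φ y) * dR (y - z) ∂μ) = -∫ y, (H g₁ y * φ y) * R (y - z) ∂μ := by
      intro z
      have hts : tsupport (fun y => φ y * R (y - z)) ⊆ K := tsupport_mul_subset_left
      have hs : ContDiff ℝ ∞ (fun y => R (y - z)) := hRs.comp (contDiff_id.sub contDiff_const)
      have := hweak H₁ (fun y => φ y * R (y - z)) (hφ.mul hs)
        (hKc.of_isClosed_subset (isClosed_tsupport _) hts) (hts.trans hKK')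
      have hder : ∀ y, fderiv ℝ (fun y => φ y * R (y - z)) y w
          = φ y * dR (y - z) + R (y - z) * fderiv ℝ φ y w := fun y => by
        rw [fderiv_fun_mul (hφ.differentiable (by simp) y) (hs.differentiable (by simp) y),
          add_apply, smul_apply, smul_apply, hd1, smul_eq_mul, smul_eq_mul]
      simp_rw [hder] at this
      rw [← integral_add (iA.mul_bdd (c := CR) (by fun_prop) (Eventually.of_forall fun y => hCR _))
        (iB.mul_bdd (c := CdR) (by fun_prop) (Eventually.of_forall fun y => hCdR _))]
      simp_rw [mul_assoc]
      rw [← this]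
      refine integral_congr_ae (Eventually.of_forall fun y => ?_)
      ring
    have e1 := integral_mul_integral_comp_sub_swap iA iH₂ hRc hCR
    have e2 : (∫ z, H g₂ z * ∫ y, (H h₁ y * φ y) * R (z - y) ∂μ ∂μ)
        = ∫ z, H h₂ z * ∫ y, (H h₁ y * φ y) * dR (y - z) ∂μ ∂μ := by
      have hswap : ∀ z, (∫ y, (H h₁ y * φ y) * R (z - y) ∂μ)
          = ∫ y, (H h₁ y * φ y) * R (y - z) ∂μ := fun z =>
        integral_congr_ae (Eventually.of_forall fun y => by beta_reduce; rw [hRneg])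
      simp_rw [hswap]
      rw [← integral_mul_integral_comp_sub_swap iB iG₂ hRc hCR,
        ← integral_mul_integral_comp_sub_swap iB iH₂ hdRc hCdR]
      refine integral_congr_ae (Eventually.of_forall fun y => ?_)
      change H h₁ y * φ y * _ = H h₁ y * φ y * _
      rw [mul_assoc, mul_assoc, II y]
    have e3 := integral_mul_integral_comp_sub_swap iD iH₂ hRc hCR
    rw [e1, e2, e3, ← integral_neg, ← integral_add]
    · refine integral_congr_ae (Eventually.of_forall fun z => ?_)
      beta_reduce
      rw [← mul_add, I z, mul_neg]
    · have := (integrable_mul_mul_comp_sub iA iH₂ hRc hCR).integral_prod_right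
      refine this.congr (Eventually.of_forall fun z => ?_)
      beta_reduce
      rw [← integral_const_mul]
      exact integral_congr_ae (Eventually.of_forall fun y => by ring)
    · have := (integrable_mul_mul_comp_sub iB iH₂ hdRc hCdR).integral_prod_right
      refine this.congr (Eventually.of_forall fun z => ?_)
      beta_reduce
      rw [← integral_const_mul]
      exact integral_congr_ae (Eventually.of_forall fun y => by ring)
  have L1 := tendsto_integral_mul_mollify hρ0 hρk iA iH₂ mH₂ (hHb b₂)
  have L2 := tendsto_integral_mul_mollify hρ0 hρk iG₂ iB (mH₁.mul hφcont.measurable)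
    (C := C₁ * Cφ) (fun z => by
      rw [norm_mul]
      exact mul_le_mul (hHb b₁ z) (hCφ z) (norm_nonneg _) ((norm_nonneg _).trans (b₁ z)))
  have L3 := tendsto_integral_mul_mollify hρ0 hρk iD iH₂ mH₂ (hHb b₂)
  have hlim := tendsto_nhds_unique ((L1.add L2).congr hid) L3.neg
  have E1 : ∀ z, H h₁ z * fderiv ℝ φ z w * H h₂ z = h₁ z * h₂ z * fderiv ℝ φ z w := fun z => by
    by_cases hz : z ∈ K
    · rw [hHK _ z (hKK' hz), hHK _ z (hKK' hz)]; ring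
    · rw [hdφ0 z hz]; ring
  have E2 : ∀ z, H g₂ z * (H h₁ z * φ z) = h₁ z * g₂ z * φ z := fun z => by
    by_cases hz : z ∈ K
    · rw [hHK _ z (hKK' hz), hHK _ z (hKK' hz)]; ring
    · rw [hφ0 z hz]; ring
  have E3 : ∀ z, H g₁ z * φ z * H h₂ z = g₁ z * h₂ z * φ z := fun z => by
    by_cases hz : z ∈ K
    · rw [hHK _ z (hKK' hz), hHK _ z (hKK' hz)]; ring
    · rw [hφ0 z hz]; ring
  rw [setIntegral_mul_eq_of_support_subset _ hφO hdφ0,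
    setIntegral_mul_eq_of_support_subset _ hφO hφ0]
  have i2 : Integrable (fun z => h₁ z * g₂ z * φ z) μ := by
    have := iG₂.mul_bdd (g := fun z => H h₁ z * φ z) (c := C₁ * Cφ)
      (mH₁.mul hφcont.measurable).aestronglyMeasurable (Eventually.of_forall fun z => by
      rw [norm_mul]
      exact mul_le_mul (hHb b₁ z) (hCφ z) (norm_nonneg _) ((norm_nonneg _).trans (b₁ z)))
    exact this.congr (Eventually.of_forall E2)
  have i3 : Integrable (fun z => g₁ z * h₂ z * φ z) μ := by
    have := iD.mul_bdd mH₂.aestronglyMeasurable (Eventually.of_forall (hHb b₂))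
    exact this.congr (Eventually.of_forall E3)
  simp_rw [E1, E2, E3] at hlim
  simp_rw [add_mul]
  rw [integral_add i3 i2]
  linarith

lemma HasWeakDeriv.sub (H₁ : HasWeakDeriv μ O w h₁ g₁) (H₂ : HasWeakDeriv μ O w h₂ g₂) :
    HasWeakDeriv μ O w (fun z => h₁ z - h₂ z) (fun z => g₁ z - g₂ z) := by
  refine ⟨H₁.locallyIntegrable.sub H₂.locallyIntegrable,
    H₁.locallyIntegrable_deriv.sub H₂.locallyIntegrable_deriv, fun φ hφ hφc hφO => ?_⟩
  have hd : Continuous (fun z => fderiv ℝ φ z w) :=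
    (hφ.continuous_fderiv (by simp)).clm_apply continuous_const
  have hd0 : ∀ z, z ∉ tsupport φ → fderiv ℝ φ z w = 0 :=
    fun z hz => fderiv_apply_eq_zero_of_notMem hz w
  have h0 : ∀ z, z ∉ tsupport φ → φ z = 0 := fun z hz => image_eq_zero_of_notMem_tsupport hz
  simp_rw [sub_mul]
  rw [integral_sub, integral_sub, H₁.integral_eq φ hφ hφc hφO, H₂.integral_eq φ hφ hφc hφO]
  · ring
  · exact (integrable_mul_of_locallyIntegrableOn H₁.locallyIntegrable_deriv hφc hφO hφ.continuous
      h0).integrableOn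
  · exact (integrable_mul_of_locallyIntegrableOn H₂.locallyIntegrable_deriv hφc hφO hφ.continuous
      h0).integrableOn
  · exact (integrable_mul_of_locallyIntegrableOn H₁.locallyIntegrable hφc hφO hd hd0).integrableOn
  · exact (integrable_mul_of_locallyIntegrableOn H₂.locallyIntegrable hφc hφO hd hd0).integrableOn

lemma HasWeakDeriv.smooth_mul (hO : IsOpen O) (H : HasWeakDeriv μ O w h g) {k : E → ℝ}
    (hk : ContDiff ℝ ∞ k) :
    HasWeakDeriv μ O w (fun z => k z * h z) (fun z => k z * g z + fderiv ℝ k z w * h z) := by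
  have hloc : ∀ {f a : E → ℝ}, LocallyIntegrableOn f O μ → Continuous a →
      LocallyIntegrableOn (fun z => a z * f z) O μ := by
    intro f a hf ha
    rw [locallyIntegrableOn_iff hO.isLocallyClosed] at hf ⊢
    exact fun K hK hKc => (hf K hK hKc).continuousOn_mul ha.continuousOn hKc
  have hdk : Continuous (fun z => fderiv ℝ k z w) :=
    (hk.continuous_fderiv (by simp)).clm_apply continuous_const
  refine ⟨hloc H.locallyIntegrable hk.continuous,
    (hloc H.locallyIntegrable_deriv hk.continuous).add (hloc H.locallyIntegrable hdk),
    fun φ hφ hφc hφO => ?_⟩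
  have hd : Continuous (fun z => fderiv ℝ φ z w) :=
    (hφ.continuous_fderiv (by simp)).clm_apply continuous_const
  have hd0 : ∀ z, z ∉ tsupport φ → fderiv ℝ φ z w = 0 :=
    fun z hz => fderiv_apply_eq_zero_of_notMem hz w
  have h0 : ∀ z, z ∉ tsupport φ → φ z = 0 := fun z hz => image_eq_zero_of_notMem_tsupport hz
  have hts : tsupport (fun z => k z * φ z) ⊆ tsupport φ := tsupport_mul_subset_right
  have key := H.integral_eq (fun z => k z * φ z) (hk.mul hφ)
    (IsCompact.of_isClosed_subset hφc (isClosed_tsupport _) hts) (hts.trans hφO)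
  have hder : ∀ z, fderiv ℝ (fun z => k z * φ z) z w
      = k z * fderiv ℝ φ z w + φ z * fderiv ℝ k z w := fun z => by
    rw [fderiv_fun_mul (hk.differentiable (by simp) z) (hφ.differentiable (by simp) z),
      add_apply, smul_apply, smul_apply, smul_eq_mul, smul_eq_mul]
  simp_rw [hder, mul_add] at key
  have i1 : Integrable (fun z => h z * (k z * fderiv ℝ φ z w)) μ :=
    integrable_mul_of_locallyIntegrableOn H.locallyIntegrable hφc hφO (hk.continuous.mul hd)
      fun z hz => by rw [hd0 z hz, mul_zero]
  have i2 : Integrable (fun z => h z * (φ z * fderiv ℝ k z w)) μ :=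
    integrable_mul_of_locallyIntegrableOn H.locallyIntegrable hφc hφO (hφ.continuous.mul hdk)
      fun z hz => by rw [h0 z hz, zero_mul]
  have i3 : Integrable (fun z => g z * (k z * φ z)) μ :=
    integrable_mul_of_locallyIntegrableOn H.locallyIntegrable_deriv hφc hφO
      (hk.continuous.mul hφ.continuous) fun z hz => by rw [h0 z hz, mul_zero]
  rw [integral_add i1.integrableOn i2.integrableOn] at key
  have e1 : ∀ z, k z * h z * fderiv ℝ φ z w = h z * (k z * fderiv ℝ φ z w) := fun z => by ring
  have e2 : ∀ z, (k z * g z + fderiv ℝ k z w * h z) * φ z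
      = g z * (k z * φ z) + h z * (φ z * fderiv ℝ k z w) := fun z => by ring
  simp_rw [e1, e2]
  rw [integral_add i3.integrableOn i2.integrableOn]
  linarith

lemma HasWeakDeriv.comp_add (hO : IsOpen O) (H : HasWeakDeriv μ O w h g) {a : E}
    (ha : ∀ z, z + a ∈ O ↔ z ∈ O) :
    HasWeakDeriv μ O w (fun z => h (z + a)) (fun z => g (z + a)) := by
  have hloc : ∀ {f : E → ℝ}, LocallyIntegrableOn f O μ →
      LocallyIntegrableOn (fun z => f (z + a)) O μ := by
    intro f hf
    rw [locallyIntegrableOn_iff hO.isLocallyClosed] at hf ⊢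
    intro K hK hKc
    have h1 : IntegrableOn f ((fun z => z + a) '' K) μ := by
      refine hf _ ?_ (hKc.image (by fun_prop))
      rintro _ ⟨z, hz, rfl⟩
      exact (ha z).2 (hK hz)
    have h2 := ((measurePreserving_add_right μ a).integrableOn_image
      (Homeomorph.addRight a).measurableEmbedding (f := f) (s := K)).1 h1
    exact h2
  refine ⟨hloc H.locallyIntegrable, hloc H.locallyIntegrable_deriv, fun φ hφ hφc hφO => ?_⟩
  have hts : tsupport (fun z => φ (z - a)) ⊆ (fun z => z + a) '' tsupport φ := by
    rw [image_add_right, show (fun z => z + -a) = fun z => z - a from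
      funext fun z => (sub_eq_add_neg z a).symm]
    exact closure_minimal (fun z hz => subset_tsupport φ hz)
      ((isClosed_tsupport φ).preimage (by fun_prop))
  have hsub : (fun z => z + a) '' tsupport φ ⊆ O := by
    rintro _ ⟨z, hz, rfl⟩
    exact (ha z).2 (hφO hz)
  have key := H.integral_eq (fun z => φ (z - a)) (hφ.comp (contDiff_id.sub contDiff_const))
    ((hφc.isCompact.image (by fun_prop)).of_isClosed_subset (isClosed_tsupport _) hts)
    (hts.trans hsub)
  rw [setIntegral_mul_eq_of_support_subset _ (hts.trans hsub)
      (fun z hz => fderiv_apply_eq_zero_of_notMem hz w),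
    setIntegral_mul_eq_of_support_subset _ (hts.trans hsub)
      (fun z hz => image_eq_zero_of_notMem_tsupport hz)] at key
  rw [setIntegral_mul_eq_of_support_subset _ hφO
      (fun z hz => fderiv_apply_eq_zero_of_notMem hz w),
    setIntegral_mul_eq_of_support_subset _ hφO
      (fun z hz => image_eq_zero_of_notMem_tsupport hz)]
  simp_rw [fderiv_comp_sub] at key
  rw [← integral_add_right_eq_self _ a, ← integral_add_right_eq_self (fun z => g z * _) a] at key
  simpa using key

/-- Differentiation under the integral sign, for weak derivatives. -/
theorem HasWeakDeriv.integral_param {P : Type*} [MeasurableSpace P] {ν : Measure P} [SFinite ν]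
    (hO : IsOpen O) {f g : E → P → ℝ} (hf : Measurable (uncurry f)) (hg : Measurable (uncurry g))
    (hfg : ∀ᵐ p ∂ν, HasWeakDeriv μ O w (fun z => f z p) (fun z => g z p)) {A B : E → ℝ}
    (hA : LocallyIntegrableOn A O μ) (hB : LocallyIntegrableOn B O μ)
    (hfA : ∀ z ∈ O, ∫⁻ p, ‖f z p‖ₑ ∂ν ≤ ENNReal.ofReal (A z))
    (hgB : ∀ z ∈ O, ∫⁻ p, ‖g z p‖ₑ ∂ν ≤ ENNReal.ofReal (B z)) :
    HasWeakDeriv μ O w (fun z => ∫ p, f z p ∂ν) (fun z => ∫ p, g z p ∂ν) := by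
  have hloc : ∀ {f : E → P → ℝ} {A : E → ℝ}, Measurable (uncurry f) →
      LocallyIntegrableOn A O μ → (∀ z ∈ O, ∫⁻ p, ‖f z p‖ₑ ∂ν ≤ ENNReal.ofReal (A z)) →
      LocallyIntegrableOn (fun z => ∫ p, f z p ∂ν) O μ := by
    intro f A hf hA hfA
    rw [locallyIntegrableOn_iff hO.isLocallyClosed] at hA ⊢
    intro K hK hKc
    refine Integrable.mono (hA K hK hKc)
      hf.stronglyMeasurable.integral_prod_right.aestronglyMeasurable ?_
    filter_upwards [ae_restrict_mem hKc.measurableSet] with z hz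
    rw [← enorm_le_iff_norm_le]
    exact (enorm_integral_le_lintegral_enorm _).trans
      ((hfA z (hK hz)).trans (Real.ofReal_le_enorm _))
  have hint : ∀ {f : E → P → ℝ} {A ψ : E → ℝ} {K : Set E}, Measurable (uncurry f) →
      LocallyIntegrableOn A O μ → (∀ z ∈ O, ∫⁻ p, ‖f z p‖ₑ ∂ν ≤ ENNReal.ofReal (A z)) →
      IsCompact K → K ⊆ O → Continuous ψ → (∀ z, z ∉ K → ψ z = 0) →
      Integrable (uncurry fun z p => f z p * ψ z) ((μ.restrict O).prod ν) := by
    intro f A ψ K hf hA hfA hK hKO hψ hψ0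
    have hmeas : Measurable (uncurry fun z p => f z p * ψ z) :=
      hf.mul (hψ.measurable.comp measurable_fst)
    refine ⟨hmeas.aestronglyMeasurable, ?_⟩
    rw [HasFiniteIntegral, lintegral_prod _ hmeas.enorm.aemeasurable]
    have hI := (integrable_mul_of_locallyIntegrableOn hA hK hKO hψ hψ0).integrableOn (s := O)
    refine lt_of_le_of_lt ?_ hI.hasFiniteIntegral
    refine setLIntegral_mono' hO.measurableSet fun z hz => ?_
    simp only [uncurry_apply_pair, enorm_mul]
    rw [lintegral_mul_const _ (hf.of_uncurry_left (x := z)).enorm]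
    gcongr
    exact (hfA z hz).trans (Real.ofReal_le_enorm _)
  refine ⟨hloc hf hA hfA, hloc hg hB hgB, fun φ hφ hφc hφO => ?_⟩
  have hd : Continuous (fun z => fderiv ℝ φ z w) :=
    (hφ.continuous_fderiv (by simp)).clm_apply continuous_const
  have I1 := hint hf hA hfA hφc hφO hd fun z hz => fderiv_apply_eq_zero_of_notMem hz w
  have I2 := hint hg hB hgB hφc hφO hφ.continuous
    fun z hz => image_eq_zero_of_notMem_tsupport hz
  simp_rw [← integral_mul_const]
  rw [integral_integral_swap I1, integral_integral_swap I2, ← integral_neg]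
  refine integral_congr_ae ?_
  filter_upwards [hfg] with p hp
  exact hp.integral_eq φ hφ hφc hφO

end WeakDeriv

/-! ### Collision frames -/

section Frames

open Filter Topology Function

lemma exists_cos_sin_eq {a b : ℝ} (h : a ^ 2 + b ^ 2 = 1) :
    ∃ t : ℝ, a = Real.cos t ∧ b = Real.sin t := by
  have hn : ‖(⟨a, b⟩ : ℂ)‖ = 1 := by
    rw [← sq_eq_sq₀ (norm_nonneg _) zero_le_one, Complex.sq_norm, Complex.normSq_mk]
    linarith
  have hne : (⟨a, b⟩ : ℂ) ≠ 0 := by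
    rw [← norm_pos_iff, hn]; exact one_pos
  refine ⟨Complex.arg ⟨a, b⟩, ?_, ?_⟩
  · rw [Complex.cos_arg hne, hn, div_one]
  · rw [Complex.sin_arg, hn, div_one]

/-- Two orthonormal bases with the same first vector differ by a rotation or a reflection of the
remaining plane. -/
lemma exists_angle_of_orthonormal {k a b a' b' : V} (h : Orthonormal ℝ ![k, a, b])
    (h' : Orthonormal ℝ ![k, a', b']) :
    ∃ t ε : ℝ, (ε = 1 ∨ ε = -1) ∧ ∀ φ : ℝ, Real.cos φ • a + Real.sin φ • b
      = Real.cos (t + ε * φ) • a' + Real.sin (t + ε * φ) • b' := by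
  have hi := orthonormal_iff_ite.1 h
  have hi' := orthonormal_iff_ite.1 h'
  have hka : inner ℝ k a = (0 : ℝ) := by simpa using hi 0 1
  have hkb : inner ℝ k b = (0 : ℝ) := by simpa using hi 0 2
  have haa : inner ℝ a a = (1 : ℝ) := by
    rw [real_inner_self_eq_norm_sq, show ‖a‖ = 1 by simpa using h.1 1]; norm_num
  have hbb : inner ℝ b b = (1 : ℝ) := by
    rw [real_inner_self_eq_norm_sq, show ‖b‖ = 1 by simpa using h.1 2]; norm_num
  have hab : inner ℝ a b = (0 : ℝ) := by simpa using hi 1 2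
  have haa' : inner ℝ a' a' = (1 : ℝ) := by
    rw [real_inner_self_eq_norm_sq, show ‖a'‖ = 1 by simpa using h'.1 1]; norm_num
  have hbb' : inner ℝ b' b' = (1 : ℝ) := by
    rw [real_inner_self_eq_norm_sq, show ‖b'‖ = 1 by simpa using h'.1 2]; norm_num
  have hab' : inner ℝ a' b' = (0 : ℝ) := by simpa using hi' 1 2
  have hba' : inner ℝ b' a' = (0 : ℝ) := by rw [real_inner_comm, hab']
  have ea := eq_sum_of_orthonormal h' a
  have eb := eq_sum_of_orthonormal h' b
  rw [hka, zero_smul, zero_add] at ea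
  rw [hkb, zero_smul, zero_add] at eb
  set p : ℝ := inner ℝ a' a
  set q : ℝ := inner ℝ b' a
  set c : ℝ := inner ℝ a' b
  set d : ℝ := inner ℝ b' b
  clear_value p q c d
  subst ea eb
  simp only [inner_add_left, inner_add_right, inner_smul_left, inner_smul_right, haa', hbb', hab',
    hba', conj_trivial, mul_one, mul_zero, add_zero, zero_add] at haa hbb hab
  have h1 : p ^ 2 + q ^ 2 = 1 := by nlinarith
  have h2 : c ^ 2 + d ^ 2 = 1 := by nlinarith
  have h3 : p * c + q * d = 0 := by nlinarith
  obtain ⟨t, rfl, rfl⟩ := exists_cos_sin_eq h1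
  set ε : ℝ := Real.cos t * d - Real.sin t * c with hε
  have hd : d = ε * Real.cos t := by
    rw [hε]; linear_combination (-d) * h1 + Real.sin t * h3
  have hc : c = -(ε * Real.sin t) := by
    rw [hε]; linear_combination (-c) * h1 + Real.cos t * h3
  have hε2 : ε ^ 2 = 1 := by
    rw [hc, hd] at h2; linear_combination h2 - ε ^ 2 * h1
  have hε' : ε = 1 ∨ ε = -1 := mul_self_eq_one_iff.1 (by rw [← sq, hε2])
  clear_value ε
  refine ⟨t, ε, hε', fun φ => ?_⟩
  have hcos : Real.cos (ε * φ) = Real.cos φ := by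
    rcases hε' with rfl | rfl <;> simp
  have hsin : Real.sin (ε * φ) = ε * Real.sin φ := by
    rcases hε' with rfl | rfl <;> simp
  rw [Real.cos_add, Real.sin_add, hcos, hsin, hc, hd]
  module

lemma lintegral_periodic_comp {f : ℝ → ENNReal} {T : ℝ} (hT : 0 < T) (hf : Periodic f T)
    (t : ℝ) {ε : ℝ} (hε : ε = 1 ∨ ε = -1) :
    ∫⁻ x in Ioc 0 T, f (t + ε * x) = ∫⁻ x in Ioc 0 T, f x := by
  have hshift : ∀ a b : ℝ, ∫⁻ x in Ioc a (a + T), f x = ∫⁻ x in Ioc b (b + T), f x := fun a b => by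
    have : VAddInvariantMeasure (AddSubgroup.zmultiples T) ℝ volume :=
      ⟨fun c s _ => measure_preimage_add _ _ _⟩
    exact (isAddFundamentalDomain_Ioc hT a).setLIntegral_eq (isAddFundamentalDomain_Ioc hT b) f
      hf.map_vadd_zmultiples
  rcases hε with rfl | rfl
  · have := (measurePreserving_add_left volume t).setLIntegral_comp_preimage_emb
      (measurableEmbedding_addLeft t) f (Ioc t (t + T))
    rw [preimage_const_add_Ioc, sub_self, add_sub_cancel_left] at this
    simp only [one_mul]
    rw [this, hshift t 0, zero_add]
  · have := (Measure.measurePreserving_sub_left volume t).setLIntegral_comp_preimage_emb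
      (MeasurableEquiv.subLeft t).measurableEmbedding f (Ico (t - T) t)
    rw [preimage_const_sub_Ico, sub_self, sub_sub_cancel] at this
    simp only [neg_one_mul, ← sub_eq_add_neg]
    rw [this, setLIntegral_congr Ico_ae_eq_Ioc]
    have h2 := hshift (t - T) 0
    rwa [sub_add_cancel, zero_add] at h2

lemma intervalIntegral_periodic_comp {f : ℝ → ℝ} {T : ℝ} (hf : Periodic f T)
    (t : ℝ) {ε : ℝ} (hε : ε = 1 ∨ ε = -1) :
    ∫ x in (0 : ℝ)..T, f (t + ε * x) = ∫ x in (0 : ℝ)..T, f x := by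
  rcases hε with rfl | rfl
  · simp only [one_mul]
    rw [intervalIntegral.integral_comp_add_left f t, add_zero, hf.intervalIntegral_add_eq t 0,
      zero_add]
  · simp only [neg_one_mul, ← sub_eq_add_neg]
    rw [intervalIntegral.integral_comp_sub_left f t, sub_zero]
    have := hf.intervalIntegral_add_eq (t - T) 0
    rwa [sub_add_cancel, zero_add] at this

variable (e e' : CollisionFrame)

lemma CollisionFrame.omega_add_two_pi (ζ ζs : V) (φ θ : ℝ) :
    e.omega ζ ζs (φ + 2 * Real.pi) θ = e.omega ζ ζs φ θ := by
  simp [CollisionFrame.omega]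

lemma CollisionFrame.exists_omega_eq {ζ ζs : V} (hne : ζ ≠ ζs) :
    ∃ t ε : ℝ, (ε = 1 ∨ ε = -1) ∧
      ∀ φ θ : ℝ, e.omega ζ ζs φ θ = e'.omega ζ ζs (t + ε * φ) θ := by
  obtain ⟨t, ε, hε, h⟩ := exists_angle_of_orthonormal (e.orthonormal ζ ζs hne)
    (e'.orthonormal ζ ζs hne)
  refine ⟨t, ε, hε, fun φ θ => ?_⟩
  have := congrArg (fun v => Real.cos θ • (‖ζs - ζ‖⁻¹ • (ζs - ζ)) + Real.sin θ • v) (h φ)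
  simp only [smul_add, smul_smul, ← add_assoc] at this
  simpa only [CollisionFrame.omega, smul_smul] using this

/-- Angular integrals do not depend on the collision frame. -/
lemma lintegral_omega_eq {ζ ζs : V} (hne : ζ ≠ ζs) (f : V → ℝ → ENNReal) :
    ∫⁻ φ in Ioc 0 (2 * Real.pi), ∫⁻ θ in Ioc 0 (Real.pi / 2), f (e.omega ζ ζs φ θ) θ
      = ∫⁻ φ in Ioc 0 (2 * Real.pi), ∫⁻ θ in Ioc 0 (Real.pi / 2), f (e'.omega ζ ζs φ θ) θ := by
  obtain ⟨t, ε, hε, h⟩ := e.exists_omega_eq e' hne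
  simp_rw [h]
  exact lintegral_periodic_comp Real.two_pi_pos
    (f := fun φ => ∫⁻ θ in Ioc 0 (Real.pi / 2), f (e'.omega ζ ζs φ θ) θ)
    (fun φ => by simp only [CollisionFrame.omega_add_two_pi]) t hε

lemma intervalIntegral_omega_eq {ζ ζs : V} (hne : ζ ≠ ζs) (f : V → ℝ → ℝ) :
    ∫ φ in (0 : ℝ)..(2 * Real.pi), ∫ θ in (0 : ℝ)..(Real.pi / 2), f (e.omega ζ ζs φ θ) θ
      = ∫ φ in (0 : ℝ)..(2 * Real.pi), ∫ θ in (0 : ℝ)..(Real.pi / 2),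
          f (e'.omega ζ ζs φ θ) θ := by
  obtain ⟨t, ε, hε, h⟩ := e.exists_omega_eq e' hne
  simp_rw [h]
  exact intervalIntegral_periodic_comp
    (f := fun φ => ∫ θ in (0 : ℝ)..(Real.pi / 2), f (e'.omega ζ ζs φ θ) θ)
    (fun φ => by simp only [CollisionFrame.omega_add_two_pi]) t hε

lemma ae_ne_volume (ζ : V) : ∀ᵐ ζs : V, ζ ≠ ζs := by
  filter_upwards [(countable_singleton ζ).ae_notMem volume] with ζs h h'
  exact h h'.symm

/-- The collision operator does not depend on the frame, whether or not its integral converges. -/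
lemma collisionQ_eq (B₀ γ : ℝ) (F G : V → ℝ) (ζ : V) :
    collisionQ e B₀ γ F G ζ = collisionQ e' B₀ γ F G ζ := by
  refine integral_congr_ae ?_
  filter_upwards [ae_ne_volume ζ] with ζs hne
  exact intervalIntegral_omega_eq e e' hne fun o θ =>
    (F (ζ + inner ℝ (ζs - ζ) o • o) * G (ζs - inner ℝ (ζs - ζ) o • o) - F ζ * G ζs)
      * crossSection B₀ γ ‖ζ - ζs‖ θ

lemma nonlinearTerm_eq (B₀ γ : ℝ) (h₁ h₂ : V × V → ℝ) :
    nonlinearTerm e B₀ γ h₁ h₂ = nonlinearTerm e' B₀ γ h₁ h₂ := by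
  funext z
  rw [nonlinearTerm, nonlinearTerm, collisionQ_eq e e']

/-- The frame obtained by translating the vectors of `e` at base point `0`; it depends on the
relative velocity only. -/
def CollisionFrame.relative : CollisionFrame where
  e₂ ζ ζs := e.e₂ 0 (ζs - ζ)
  e₃ ζ ζs := e.e₃ 0 (ζs - ζ)
  measurable_e₂ := e.measurable_e₂.comp
    (measurable_const.prodMk (measurable_snd.sub measurable_fst))
  measurable_e₃ := e.measurable_e₃.comp
    (measurable_const.prodMk (measurable_snd.sub measurable_fst))
  orthonormal ζ ζs hne := by
    simpa using e.orthonormal 0 (ζs - ζ) (sub_ne_zero.2 hne.symm).symm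

/-- The velocity increment `((ζ_* - ζ) · ω) ω` of a collision, in terms of the relative velocity
`u = ζ_* - ζ`. -/
def CollisionFrame.jump (p : V × ℝ × ℝ) : V :=
  inner ℝ p.1 (e.omega 0 p.1 p.2.1 p.2.2) • e.omega 0 p.1 p.2.1 p.2.2

lemma CollisionFrame.relative_omega (ζ u : V) (φ θ : ℝ) :
    e.relative.omega ζ (ζ + u) φ θ = e.omega 0 u φ θ := by
  simp [CollisionFrame.omega, CollisionFrame.relative]

lemma CollisionFrame.relative_zetaPrime (ζ u : V) (φ θ : ℝ) :
    e.relative.zetaPrime ζ (ζ + u) φ θ = ζ + e.jump (u, φ, θ) := by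
  simp [CollisionFrame.zetaPrime, CollisionFrame.relative_omega, CollisionFrame.jump]

lemma CollisionFrame.relative_zetaStarPrime (ζ u : V) (φ θ : ℝ) :
    e.relative.zetaStarPrime ζ (ζ + u) φ θ = ζ + (u - e.jump (u, φ, θ)) := by
  simp [CollisionFrame.zetaStarPrime, CollisionFrame.relative_omega, CollisionFrame.jump,
    add_sub_assoc]

lemma CollisionFrame.norm_omega {ζ ζs : V} (hne : ζ ≠ ζs) (φ θ : ℝ) :
    ‖e.omega ζ ζs φ θ‖ = 1 := by
  have h := e.orthonormal ζ ζs hne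
  have hi := orthonormal_iff_ite.1 h
  set k := ‖ζs - ζ‖⁻¹ • (ζs - ζ) with hk
  have h00 : inner ℝ k k = (1 : ℝ) := by
    rw [real_inner_self_eq_norm_sq, show ‖k‖ = 1 by simpa using h.1 0]; norm_num
  have h11 : inner ℝ (e.e₂ ζ ζs) (e.e₂ ζ ζs) = (1 : ℝ) := by
    rw [real_inner_self_eq_norm_sq, show ‖e.e₂ ζ ζs‖ = 1 by simpa using h.1 1]; norm_num
  have h22 : inner ℝ (e.e₃ ζ ζs) (e.e₃ ζ ζs) = (1 : ℝ) := by
    rw [real_inner_self_eq_norm_sq, show ‖e.e₃ ζ ζs‖ = 1 by simpa using h.1 2]; norm_num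
  have h01 : inner ℝ k (e.e₂ ζ ζs) = (0 : ℝ) := by simpa [hk] using hi 0 1
  have h02 : inner ℝ k (e.e₃ ζ ζs) = (0 : ℝ) := by simpa [hk] using hi 0 2
  have h12 : inner ℝ (e.e₂ ζ ζs) (e.e₃ ζ ζs) = (0 : ℝ) := by simpa using hi 1 2
  have h10 : inner ℝ (e.e₂ ζ ζs) k = (0 : ℝ) := by rw [real_inner_comm, h01]
  have h20 : inner ℝ (e.e₃ ζ ζs) k = (0 : ℝ) := by rw [real_inner_comm, h02]
  have h21 : inner ℝ (e.e₃ ζ ζs) (e.e₂ ζ ζs) = (0 : ℝ) := by rw [real_inner_comm, h12]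
  rw [← sq_eq_sq₀ (norm_nonneg _) zero_le_one, ← real_inner_self_eq_norm_sq,
    CollisionFrame.omega, ← hk]
  clear_value k
  simp only [inner_add_left, inner_add_right, inner_smul_left, inner_smul_right, h00, h11, h22,
    h01, h02, h12, h10, h20, h21, conj_trivial, mul_one, mul_zero, add_zero, zero_add]
  have s1 := Real.sin_sq_add_cos_sq θ
  have s2 := Real.sin_sq_add_cos_sq φ
  linear_combination s1 + Real.sin θ ^ 2 * s2

/-- Conservation of energy. -/
lemma CollisionFrame.energy (ζ ζs : V) (φ θ : ℝ) :
    ‖e.zetaPrime ζ ζs φ θ‖ ^ 2 + ‖e.zetaStarPrime ζ ζs φ θ‖ ^ 2 = ‖ζ‖ ^ 2 + ‖ζs‖ ^ 2 := by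
  by_cases hne : ζ = ζs
  · simp [CollisionFrame.zetaPrime, CollisionFrame.zetaStarPrime, hne]
  · have h1 : inner ℝ (e.omega ζ ζs φ θ) (e.omega ζ ζs φ θ) = (1 : ℝ) := by
      rw [real_inner_self_eq_norm_sq, e.norm_omega hne]; norm_num
    simp only [← real_inner_self_eq_norm_sq, CollisionFrame.zetaPrime,
      CollisionFrame.zetaStarPrime, inner_add_left, inner_add_right, inner_sub_left,
      inner_sub_right, inner_smul_left, inner_smul_right, conj_trivial, h1,
      real_inner_comm ζ (e.omega ζ ζs φ θ), real_inner_comm ζs (e.omega ζ ζs φ θ)]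
    ring

/-- The measure `dζ_* dφ dθ` of the collision integral. -/
abbrev collisionMeasure : Measure (V × ℝ × ℝ) :=
  (volume : Measure V).prod
      (((volume : Measure ℝ).restrict (Ioc 0 (2 * Real.pi))).prod
        ((volume : Measure ℝ).restrict (Ioc 0 (Real.pi / 2))))

lemma CollisionFrame.measurable_omega {X : Type*} [MeasurableSpace X] {a b : X → V} {c d : X → ℝ}
    (ha : Measurable a) (hb : Measurable b) (hc : Measurable c) (hd : Measurable d) :
    Measurable (fun x => e.omega (a x) (b x) (c x) (d x)) := by
  have h2 : Measurable (fun x => e.e₂ (a x) (b x)) := e.measurable_e₂.comp (ha.prodMk hb)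
  have h3 : Measurable (fun x => e.e₃ (a x) (b x)) := e.measurable_e₃.comp (ha.prodMk hb)
  unfold CollisionFrame.omega
  fun_prop

lemma CollisionFrame.measurable_zetaPrime {X : Type*} [MeasurableSpace X] {a b : X → V}
    {c d : X → ℝ} (ha : Measurable a) (hb : Measurable b) (hc : Measurable c) (hd : Measurable d) :
    Measurable (fun x => e.zetaPrime (a x) (b x) (c x) (d x)) := by
  have h := e.measurable_omega ha hb hc hd
  unfold CollisionFrame.zetaPrime
  fun_prop

lemma CollisionFrame.measurable_zetaStarPrime {X : Type*} [MeasurableSpace X] {a b : X → V}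
    {c d : X → ℝ} (ha : Measurable a) (hb : Measurable b) (hc : Measurable c) (hd : Measurable d) :
    Measurable (fun x => e.zetaStarPrime (a x) (b x) (c x) (d x)) := by
  have h := e.measurable_omega ha hb hc hd
  unfold CollisionFrame.zetaStarPrime
  fun_prop

lemma CollisionFrame.measurable_jump : Measurable e.jump := by
  have h := e.measurable_omega (X := V × ℝ × ℝ) measurable_const measurable_fst
    (measurable_fst.comp measurable_snd) (measurable_snd.comp measurable_snd) (a := fun _ => 0)
  unfold CollisionFrame.jump
  fun_prop

/-- Integrals over collisions in terms of the relative velocity. -/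
lemma lintegral_collision_eq {f : V → V → V → ℝ → ENNReal} (ζ : V)
    (hf : Measurable fun p : V × V × V × ℝ => f p.1 p.2.1 p.2.2.1 p.2.2.2) :
    ∫⁻ p, f p.1 (e.zetaPrime ζ p.1 p.2.1 p.2.2) (e.zetaStarPrime ζ p.1 p.2.1 p.2.2) p.2.2
        ∂collisionMeasure
      = ∫⁻ p, f (ζ + p.1) (ζ + e.jump p) (ζ + (p.1 - e.jump p)) p.2.2 ∂collisionMeasure := by
  have hm : ∀ e : CollisionFrame, Measurable (fun p : V × ℝ × ℝ =>
      f p.1 (e.zetaPrime ζ p.1 p.2.1 p.2.2) (e.zetaStarPrime ζ p.1 p.2.1 p.2.2) p.2.2) := by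
    intro e
    have h1 := e.measurable_zetaPrime (X := V × ℝ × ℝ) (a := fun _ => ζ) measurable_const
      measurable_fst (measurable_fst.comp measurable_snd) (measurable_snd.comp measurable_snd)
    have h2 := e.measurable_zetaStarPrime (X := V × ℝ × ℝ) (a := fun _ => ζ) measurable_const
      measurable_fst (measurable_fst.comp measurable_snd) (measurable_snd.comp measurable_snd)
    exact hf.comp
      (measurable_fst.prodMk (h1.prodMk (h2.prodMk (measurable_snd.comp measurable_snd))))
  have hj := e.measurable_jump
  have hm2 : Measurable (fun p : V × ℝ × ℝ =>
      f (ζ + p.1) (ζ + e.jump p) (ζ + (p.1 - e.jump p)) p.2.2) :=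
    hf.comp (f := fun p : V × ℝ × ℝ => (ζ + p.1, ζ + e.jump p, ζ + (p.1 - e.jump p), p.2.2))
      (by fun_prop)
  have split : ∀ g : V × ℝ × ℝ → ENNReal, Measurable g → ∫⁻ p, g p ∂collisionMeasure
      = ∫⁻ ζs, ∫⁻ φ in Ioc 0 (2 * Real.pi), ∫⁻ θ in Ioc 0 (Real.pi / 2), g (ζs, φ, θ) := by
    intro g hg
    rw [lintegral_prod _ hg.aemeasurable]
    refine lintegral_congr fun ζs => ?_
    exact lintegral_prod _ (hg.comp measurable_prodMk_left).aemeasurable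
  rw [split _ (hm e), split _ hm2]
  calc _ = ∫⁻ ζs, ∫⁻ φ in Ioc 0 (2 * Real.pi), ∫⁻ θ in Ioc 0 (Real.pi / 2),
        f ζs (e.relative.zetaPrime ζ ζs φ θ) (e.relative.zetaStarPrime ζ ζs φ θ) θ := by
        refine lintegral_congr_ae ?_
        filter_upwards [ae_ne_volume ζ] with ζs hne
        exact lintegral_omega_eq e e.relative hne fun o θ =>
          f ζs (ζ + inner ℝ (ζs - ζ) o • o) (ζs - inner ℝ (ζs - ζ) o • o) θ
    _ = _ := by
        rw [← lintegral_add_left_eq_self _ ζ]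
        simp_rw [CollisionFrame.relative_zetaPrime, CollisionFrame.relative_zetaStarPrime]

lemma lintegral_phase_translate {f : V × V → ENNReal} (hf : Measurable f)
    {a : V × ℝ × ℝ → V} (ha : Measurable a) (h0 : ∫⁻ z, f z = 0) :
    ∫⁻ z : V × V, ∫⁻ p, f (z.1, z.2 + a p) ∂collisionMeasure = 0 := by
  have hm : Measurable (uncurry fun (z : V × V) (p : V × ℝ × ℝ) => f (z.1, z.2 + a p)) :=
    hf.comp (f := fun q : (V × V) × V × ℝ × ℝ => (q.1.1, q.1.2 + a q.2)) (by fun_prop)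
  rw [lintegral_lintegral_swap hm.aemeasurable]
  have : ∀ p, ∫⁻ z : V × V, f (z.1, z.2 + a p) = 0 := fun p => by
    have : (volume : Measure (V × V)).IsAddHaarMeasure := Measure.prod.instIsAddHaarMeasure _ _
    have e1 : ∀ z : V × V, (z.1, z.2 + a p) = z + (0, a p) := fun z => by
      ext1 <;> simp
    simp_rw [e1]
    rw [lintegral_add_right_eq_self f, h0]
  simp [this]

/-- Pre- and post-collisional velocities avoid null sets of the phase space almost surely. -/
lemma ae_collision_notMem {N : Set (V × V)} (hN : volume N = 0) :
    ∀ᵐ z : V × V, ∀ᵐ p ∂collisionMeasure, (z.1, p.1) ∉ N ∧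
      (z.1, e.zetaPrime z.2 p.1 p.2.1 p.2.2) ∉ N ∧
      (z.1, e.zetaStarPrime z.2 p.1 p.2.1 p.2.2) ∉ N := by
  set N' := toMeasurable volume N with hN'
  have hN'm : MeasurableSet N' := measurableSet_toMeasurable _ _
  have hN'0 : volume N' = 0 := by rw [hN', measure_toMeasurable, hN]
  set χ : V × V → ENNReal := N'.indicator 1 with hχ
  have hχm : Measurable χ := measurable_one.indicator hN'm
  have hχ0 : ∫⁻ z, χ z = 0 := by rw [hχ, lintegral_indicator_one hN'm, hN'0]
  have hj := e.measurable_jump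
  let S : V × V → V × ℝ × ℝ → ENNReal := fun z p => χ (z.1, p.1)
    + χ (z.1, e.zetaPrime z.2 p.1 p.2.1 p.2.2) + χ (z.1, e.zetaStarPrime z.2 p.1 p.2.1 p.2.2)
  have hS : Measurable (uncurry S) := by
    have h1 := e.measurable_zetaPrime (X := (V × V) × V × ℝ × ℝ) (a := fun q => q.1.2)
      (b := fun q => q.2.1) (c := fun q => q.2.2.1) (d := fun q => q.2.2.2)
      (by fun_prop) (by fun_prop) (by fun_prop) (by fun_prop)
    have h2 := e.measurable_zetaStarPrime (X := (V × V) × V × ℝ × ℝ) (a := fun q => q.1.2)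
      (b := fun q => q.2.1) (c := fun q => q.2.2.1) (d := fun q => q.2.2.2)
      (by fun_prop) (by fun_prop) (by fun_prop) (by fun_prop)
    have h0 : Measurable (fun q : (V × V) × V × ℝ × ℝ => q.1.1) := by fun_prop
    have h3 : Measurable (fun q : (V × V) × V × ℝ × ℝ => q.2.1) := by fun_prop
    exact ((hχm.comp (h0.prodMk h3)).add (hχm.comp (h0.prodMk h1))).add (hχm.comp (h0.prodMk h2))
  have hSz : ∀ z, ∫⁻ p, S z p ∂collisionMeasure = ∫⁻ p, (χ (z.1, z.2 + p.1)
      + χ (z.1, z.2 + e.jump p) + χ (z.1, z.2 + (p.1 - e.jump p))) ∂collisionMeasure := fun z =>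
    lintegral_collision_eq e (f := fun a b c _ => χ (z.1, a) + χ (z.1, b) + χ (z.1, c)) z.2
      (by fun_prop)
  have hj' : Measurable (fun p : V × ℝ × ℝ => p.1 - e.jump p) := measurable_fst.sub hj
  have htot : ∫⁻ z, ∫⁻ p, S z p ∂collisionMeasure = 0 := by
    simp_rw [hSz]
    have m1 : ∀ (z : V × V) (a : V × ℝ × ℝ → V), Measurable a →
        Measurable (fun p => χ (z.1, z.2 + a p)) := fun z a ha => by fun_prop
    have m2 : ∀ (a : V × ℝ × ℝ → V), Measurable a →
        Measurable (fun z : V × V => ∫⁻ p, χ (z.1, z.2 + a p) ∂collisionMeasure) := fun a ha =>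
      Measurable.lintegral_prod_right'
        (f := fun q : (V × V) × V × ℝ × ℝ => χ (q.1.1, q.1.2 + a q.2)) (by fun_prop)
    have e1 : ∀ z : V × V, ∫⁻ p, (χ (z.1, z.2 + p.1)
      + χ (z.1, z.2 + e.jump p) + χ (z.1, z.2 + (p.1 - e.jump p))) ∂collisionMeasure
      = ∫⁻ p, χ (z.1, z.2 + p.1) ∂collisionMeasure
        + ∫⁻ p, χ (z.1, z.2 + e.jump p) ∂collisionMeasure
        + ∫⁻ p, χ (z.1, z.2 + (p.1 - e.jump p)) ∂collisionMeasure := fun z => by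
      rw [lintegral_add_right _ (m1 z _ hj'),
        lintegral_add_right _ (m1 z _ hj)]
    simp_rw [e1]
    rw [lintegral_add_right _ (m2 _ hj'), lintegral_add_right _ (m2 _ hj),
      lintegral_phase_translate hχm measurable_fst hχ0, lintegral_phase_translate hχm hj hχ0,
      lintegral_phase_translate hχm hj' hχ0]
    simp
  rw [lintegral_eq_zero_iff hS.lintegral_prod_right] at htot
  filter_upwards [htot] with z hz
  have hz' : ∫⁻ p, S z p ∂collisionMeasure = 0 := hz
  rw [lintegral_eq_zero_iff hS.of_uncurry_left] at hz'
  filter_upwards [hz'] with p hp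
  have key : ∀ y, χ y = 0 → y ∉ N := fun y hy hyN => by
    have : y ∈ N' := subset_toMeasurable _ _ hyN
    simp [hχ, this] at hy
  simp only [S, Pi.zero_apply, add_eq_zero] at hp
  exact ⟨key _ hp.1.1, key _ hp.1.2, key _ hp.2⟩

end Frames

/-! ### Singular integrals over collisions -/

section Singular

open Filter Topology Function Metric
open scoped ENNReal

lemma ennreal_rpow_neg_anti {a b : ℝ≥0∞} (h : a ≤ b) {p : ℝ} (hp : 0 ≤ p) :
    b ^ (-p) ≤ a ^ (-p) := by
  rw [ENNReal.rpow_neg, ENNReal.rpow_neg]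
  exact ENNReal.inv_le_inv.2 (ENNReal.rpow_le_rpow h hp)

lemma lintegral_ball_norm_rpow_lt_top {E : Type*} [NormedAddCommGroup E] [NormedSpace ℝ E]
    [Nontrivial E] [FiniteDimensional ℝ E] [MeasurableSpace E] [BorelSpace E] (μ : Measure E)
    [μ.IsAddHaarMeasure] {β : ℝ} (hβ : β < Module.finrank ℝ E) :
    ∫⁻ x in ball (0 : E) 1, ‖x‖ₑ ^ (-β) ∂μ < ⊤ := by
  have hdim : 1 ≤ Module.finrank ℝ E := Module.finrank_pos
  have hint : IntegrableOn (fun x : E => ‖x‖ ^ (-β)) (ball 0 1) μ := by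
    rw [integrableOn_fun_norm_addHaar μ (f := fun y : ℝ => y ^ (-β))]
    have h1 : IntegrableOn (fun y : ℝ => y ^ ((Module.finrank ℝ E : ℝ) - 1 - β)) (Ioo 0 1) :=
      (intervalIntegral.integrableOn_Ioo_rpow_iff one_pos).2 (by linarith)
    refine h1.congr_fun (fun y hy => ?_) measurableSet_Ioo
    have hy0 : 0 < y := hy.1
    simp only [smul_eq_mul]
    rw [sub_eq_add_neg, Real.rpow_add hy0, ← Real.rpow_natCast, Nat.cast_sub hdim, Nat.cast_one]
  have h2 := hint.hasFiniteIntegral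
  rw [HasFiniteIntegral] at h2
  refine lt_of_le_of_lt (le_of_eq ?_) h2
  refine lintegral_congr_ae (ae_restrict_of_ae ?_)
  filter_upwards [(countable_singleton (0 : E)).ae_notMem μ] with x hx
  have hx : 0 < ‖x‖ := norm_pos_iff.2 hx
  rw [← ofReal_norm, ENNReal.ofReal_rpow_of_pos hx, Real.enorm_of_nonneg (by positivity)]

/-- A one-dimensional singularity of exponent less than `1` is integrable uniformly in its position;
the interval contains `[0, 2π]`. -/
lemma exists_lintegral_abs_sub_rpow_le {β : ℝ} (hβ0 : 0 ≤ β) (hβ : β < 1) :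
    ∃ C : ℝ≥0∞, C ≠ ⊤ ∧ ∀ a : ℝ, ∫⁻ x in Icc (-7 : ℝ) 7, ‖x - a‖ₑ ^ (-β) ≤ C := by
  refine ⟨(∫⁻ x in ball (0 : ℝ) 1, ‖x‖ₑ ^ (-β)) + volume (Icc (-7 : ℝ) 7),
    ENNReal.add_ne_top.2 ⟨(lintegral_ball_norm_rpow_lt_top volume (by simpa using hβ)).ne,
      by simp⟩, fun a => ?_⟩
  calc ∫⁻ x in Icc (-7 : ℝ) 7, ‖x - a‖ₑ ^ (-β)
      ≤ ∫⁻ x in Icc (-7 : ℝ) 7,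
          ((ball (0 : ℝ) 1).indicator (fun y => ‖y‖ₑ ^ (-β)) (x - a) + 1) := by
        refine lintegral_mono fun x => ?_
        by_cases hx : x - a ∈ ball (0 : ℝ) 1
        · rw [indicator_of_mem hx]; exact le_self_add
        · rw [indicator_of_notMem hx, zero_add]
          rw [mem_ball_zero_iff, not_lt] at hx
          have h1 : (1 : ℝ≥0∞) ≤ ‖x - a‖ₑ := by
            rw [← ofReal_norm]; exact ENNReal.one_le_ofReal.2 hx
          simpa using ennreal_rpow_neg_anti h1 hβ0
    _ = (∫⁻ x in Icc (-7 : ℝ) 7, (ball (0 : ℝ) 1).indicator (fun y => ‖y‖ₑ ^ (-β)) (x - a))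
          + volume (Icc (-7 : ℝ) 7) := by
        rw [lintegral_add_right _ measurable_const]; simp
    _ ≤ (∫⁻ x, (ball (0 : ℝ) 1).indicator (fun y => ‖y‖ₑ ^ (-β)) (x - a))
          + volume (Icc (-7 : ℝ) 7) := by
        gcongr
        exact Measure.restrict_le_self
    _ = _ := by
        rw [lintegral_sub_right_eq_self (fun x => (ball (0 : ℝ) 1).indicator
          (fun y => ‖y‖ₑ ^ (-β)) x) a, lintegral_indicator measurableSet_ball]

lemma exists_mul_abs_sub_le_abs_sin {φ : ℝ} (h0 : 0 ≤ φ) (h1 : φ ≤ 2 * Real.pi) :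
    ∃ c ∈ ({0, Real.pi, 2 * Real.pi} : Set ℝ), 2 / Real.pi * |φ - c| ≤ |Real.sin φ| := by
  have hpi := Real.pi_pos
  by_cases hA : φ ≤ Real.pi / 2
  · refine ⟨0, by simp, ?_⟩
    rw [sub_zero]
    exact Real.mul_abs_le_abs_sin (by rw [abs_of_nonneg h0]; exact hA)
  by_cases hB : φ ≤ 3 * Real.pi / 2
  · refine ⟨Real.pi, by simp, ?_⟩
    have := Real.mul_abs_le_abs_sin (x := φ - Real.pi)
      (abs_le.2 ⟨by linarith, by linarith⟩)
    rwa [Real.sin_sub_pi, abs_neg] at this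
  · refine ⟨2 * Real.pi, by simp, ?_⟩
    have := Real.mul_abs_le_abs_sin (x := φ - 2 * Real.pi)
      (abs_le.2 ⟨by linarith, by linarith⟩)
    rwa [Real.sin_sub_two_pi] at this

lemma sin_rpow_neg_le {φ : ℝ} (h0 : 0 ≤ φ) (h1 : φ ≤ 2 * Real.pi) :
    ‖Real.sin φ‖ₑ ^ (-(1 / 2) : ℝ) ≤ ENNReal.ofReal (2 / Real.pi) ^ (-(1 / 2) : ℝ) *
      (‖φ - 0‖ₑ ^ (-(1 / 2) : ℝ) + ‖φ - Real.pi‖ₑ ^ (-(1 / 2) : ℝ)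
        + ‖φ - 2 * Real.pi‖ₑ ^ (-(1 / 2) : ℝ)) := by
  obtain ⟨c, hc, h⟩ := exists_mul_abs_sub_le_abs_sin h0 h1
  have h2 : ENNReal.ofReal (2 / Real.pi) * ‖φ - c‖ₑ ≤ ‖Real.sin φ‖ₑ := by
    rw [← ofReal_norm, ← ofReal_norm, ← ENNReal.ofReal_mul (by positivity)]
    exact ENNReal.ofReal_le_ofReal h
  refine (ennreal_rpow_neg_anti h2 (by norm_num)).trans ?_
  rw [ENNReal.mul_rpow_of_ne_top ENNReal.ofReal_ne_top enorm_ne_top]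
  gcongr
  rcases hc with rfl | rfl | rfl
  · exact le_self_add.trans le_self_add
  · exact le_add_self.trans le_self_add
  · exact le_add_self

lemma measurable_enorm_sub_rpow (β a : ℝ) : Measurable (fun x : ℝ => ‖x - a‖ₑ ^ β) := by
  fun_prop

lemma exists_lintegral_sin_rpow_le :
    ∃ C : ℝ≥0∞, C ≠ ⊤ ∧ ∫⁻ φ in Ioc 0 (2 * Real.pi), ‖Real.sin φ‖ₑ ^ (-(1 / 2) : ℝ) ≤ C := by
  obtain ⟨C, hC, H⟩ := exists_lintegral_abs_sub_rpow_le (β := 1 / 2) (by norm_num) (by norm_num)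
  have hpi := Real.pi_pos
  have hpi4 := Real.pi_lt_d2
  set D : ℝ≥0∞ := ENNReal.ofReal (2 / Real.pi) ^ (-(1 / 2) : ℝ) with hD
  have hDt : D ≠ ⊤ := by
    rw [hD, ENNReal.ofReal_rpow_of_pos (by positivity)]; exact ENNReal.ofReal_ne_top
  refine ⟨D * (C + C + C), by finiteness, ?_⟩
  calc _ ≤ ∫⁻ φ in Ioc 0 (2 * Real.pi), D * (‖φ - 0‖ₑ ^ (-(1 / 2) : ℝ)
          + ‖φ - Real.pi‖ₑ ^ (-(1 / 2) : ℝ) + ‖φ - 2 * Real.pi‖ₑ ^ (-(1 / 2) : ℝ)) :=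
        setLIntegral_mono' measurableSet_Ioc fun φ hφ => sin_rpow_neg_le hφ.1.le hφ.2
    _ ≤ ∫⁻ φ in Icc (-7 : ℝ) 7, D * (‖φ - 0‖ₑ ^ (-(1 / 2) : ℝ)
          + ‖φ - Real.pi‖ₑ ^ (-(1 / 2) : ℝ) + ‖φ - 2 * Real.pi‖ₑ ^ (-(1 / 2) : ℝ)) :=
        lintegral_mono_set fun φ hφ => ⟨by linarith [hφ.1], by linarith [hφ.2]⟩
    _ ≤ D * (C + C + C) := by
        rw [lintegral_const_mul' _ _ hDt,
          lintegral_add_right _ (measurable_enorm_sub_rpow _ _),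
          lintegral_add_right _ (measurable_enorm_sub_rpow _ _)]
        gcongr
        exacts [H 0, H _, H _]

/-- The polar integral, in the form left by Young's inequality. -/
lemma exists_lintegral_polar_le :
    ∃ C : ℝ≥0∞, C ≠ ⊤ ∧ ∀ q : ℝ, ∫⁻ θ in Ioc 0 (Real.pi / 2),
      (ENNReal.ofReal (Real.sin θ * Real.cos θ) ^ (-(1 / 2) : ℝ)
        + ENNReal.ofReal (Real.sin θ * Real.cos θ) * ‖q + Real.cos θ ^ 2‖ₑ ^ (-(3 / 4) : ℝ))
      ≤ C := by
  obtain ⟨C, hC, H⟩ := exists_lintegral_abs_sub_rpow_le (β := 1 / 2) (by norm_num) (by norm_num)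
  obtain ⟨C', hC', H'⟩ := exists_lintegral_abs_sub_rpow_le (β := 3 / 4) (by norm_num) (by norm_num)
  have hpi := Real.pi_pos
  have hpi4 := Real.pi_lt_d2
  set D : ℝ≥0∞ := ENNReal.ofReal (2 / Real.pi) ^ (-(1 / 2) : ℝ) with hD
  have hDt : D ≠ ⊤ := by
    rw [hD, ENNReal.ofReal_rpow_of_pos (by positivity)]; exact ENNReal.ofReal_ne_top
  refine ⟨D * (C + C + C) + C', by finiteness, fun q => ?_⟩
  rw [lintegral_add_left (by fun_prop)]
  refine add_le_add ?_ ?_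
  · calc _ ≤ ∫⁻ θ in Ioc 0 (Real.pi / 2), D * (‖θ - 0‖ₑ ^ (-(1 / 2) : ℝ)
            + ‖θ - Real.pi / 2‖ₑ ^ (-(1 / 2) : ℝ) + ‖θ - Real.pi‖ₑ ^ (-(1 / 2) : ℝ)) := by
          refine setLIntegral_mono' measurableSet_Ioc fun θ hθ => ?_
          have hs : 0 ≤ Real.sin (2 * θ) := Real.sin_nonneg_of_nonneg_of_le_pi
            (by linarith [hθ.1]) (by linarith [hθ.2])
          obtain ⟨c, hc, h⟩ := exists_mul_abs_sub_le_abs_sin (φ := 2 * θ) (by linarith [hθ.1])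
            (by linarith [hθ.2])
          have h2 : ENNReal.ofReal (2 / Real.pi) * ‖θ - c / 2‖ₑ
              ≤ ENNReal.ofReal (Real.sin θ * Real.cos θ) := by
            rw [← ofReal_norm, ← ENNReal.ofReal_mul (by positivity)]
            refine ENNReal.ofReal_le_ofReal ?_
            rw [abs_of_nonneg hs, Real.sin_two_mul, show 2 * θ - c = 2 * (θ - c / 2) by ring,
              abs_mul, abs_two] at h
            rw [Real.norm_eq_abs]
            linarith
          refine (ennreal_rpow_neg_anti h2 (by norm_num)).trans ?_
          rw [ENNReal.mul_rpow_of_ne_top ENNReal.ofReal_ne_top enorm_ne_top]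
          gcongr
          rcases hc with rfl | rfl | rfl
          · rw [zero_div]; exact le_self_add.trans le_self_add
          · exact le_add_self.trans le_self_add
          · rw [mul_div_cancel_left₀ _ (two_ne_zero)]; exact le_add_self
      _ ≤ ∫⁻ θ in Icc (-7 : ℝ) 7, D * (‖θ - 0‖ₑ ^ (-(1 / 2) : ℝ)
            + ‖θ - Real.pi / 2‖ₑ ^ (-(1 / 2) : ℝ) + ‖θ - Real.pi‖ₑ ^ (-(1 / 2) : ℝ)) :=
          lintegral_mono_set fun φ hφ => ⟨by linarith [hφ.1], by linarith [hφ.2]⟩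
      _ ≤ D * (C + C + C) := by
          rw [lintegral_const_mul' _ _ hDt,
            lintegral_add_right _ (measurable_enorm_sub_rpow _ _),
            lintegral_add_right _ (measurable_enorm_sub_rpow _ _)]
          gcongr
          exacts [H 0, H _, H _]
  -- the substitution `s = cos² θ`
  · have hder : ∀ θ ∈ Ioo 0 (Real.pi / 2), HasDerivWithinAt (fun θ => Real.cos θ ^ 2)
        (-(2 * (Real.sin θ * Real.cos θ))) (Ioo 0 (Real.pi / 2)) θ := fun θ _ => by
      have := (Real.hasDerivAt_cos θ).pow 2
      refine (this.congr_deriv ?_).hasDerivWithinAt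
      simp only [Nat.add_one_sub_one, pow_one]
      push_cast
      ring
    have hinj : InjOn (fun θ => Real.cos θ ^ 2) (Ioo 0 (Real.pi / 2)) := by
      intro x hx y hy hxy
      have hx' : 0 ≤ Real.cos x := Real.cos_nonneg_of_mem_Icc ⟨by linarith [hx.1], hx.2.le⟩
      have hy' : 0 ≤ Real.cos y := Real.cos_nonneg_of_mem_Icc ⟨by linarith [hy.1], hy.2.le⟩
      exact Real.injOn_cos ⟨hx.1.le, by linarith [hx.2]⟩ ⟨hy.1.le, by linarith [hy.2]⟩
        ((sq_eq_sq₀ hx' hy').1 hxy)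
    have hsub := lintegral_image_eq_lintegral_abs_deriv_mul measurableSet_Ioo hder hinj
      (fun x => ‖x - -q‖ₑ ^ (-(3 / 4) : ℝ))
    calc _ = ∫⁻ θ in Ioo 0 (Real.pi / 2), ENNReal.ofReal (Real.sin θ * Real.cos θ)
              * ‖q + Real.cos θ ^ 2‖ₑ ^ (-(3 / 4) : ℝ) := setLIntegral_congr Ioo_ae_eq_Ioc.symm
      _ ≤ ∫⁻ θ in Ioo 0 (Real.pi / 2), ENNReal.ofReal |-(2 * (Real.sin θ * Real.cos θ))|
              * ‖Real.cos θ ^ 2 - -q‖ₑ ^ (-(3 / 4) : ℝ) := by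
          refine setLIntegral_mono' measurableSet_Ioo fun θ hθ => ?_
          rw [sub_neg_eq_add, add_comm q]
          gcongr
          rw [abs_neg]
          refine le_trans ?_ (le_abs_self _)
          have h1 : 0 ≤ Real.cos θ := Real.cos_nonneg_of_mem_Icc ⟨by linarith [hθ.1], hθ.2.le⟩
          have h2 : 0 ≤ Real.sin θ := Real.sin_nonneg_of_nonneg_of_le_pi hθ.1.le
            (by linarith [hθ.2])
          nlinarith [mul_nonneg h2 h1]
      _ = ∫⁻ x in (fun θ => Real.cos θ ^ 2) '' Ioo 0 (Real.pi / 2),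
            ‖x - -q‖ₑ ^ (-(3 / 4) : ℝ) := hsub.symm
      _ ≤ ∫⁻ x in Icc (-7 : ℝ) 7, ‖x - -q‖ₑ ^ (-(3 / 4) : ℝ) := by
          refine lintegral_mono_set ?_
          rintro _ ⟨θ, _, rfl⟩
          exact ⟨by nlinarith [sq_nonneg (Real.cos θ)], by nlinarith [Real.cos_sq_le_one θ]⟩
      _ ≤ C' := H' _

/-- A vector whose components in two orthogonal unit directions are bounded below by `r x S` and
`r Y` respectively has norm at least `r (x S Y)^{1/2}`; Young's inequality then separates the
variables. The values `S = 0` and `Y = 0` make the right-hand side infinite. -/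
lemma mul_enorm_inv_le {n r x S Y : ℝ} (hr : 0 < r) (hx : 0 < x) (hS : 0 ≤ S) (hY : 0 ≤ Y)
    (h1 : r * (x * S) ≤ n) (h2 : r * Y ≤ n) :
    ENNReal.ofReal x * (ENNReal.ofReal n)⁻¹ ≤ (ENNReal.ofReal r)⁻¹ *
      (ENNReal.ofReal S ^ (-(1 / 2) : ℝ) * (ENNReal.ofReal x ^ (-(1 / 2) : ℝ)
        + ENNReal.ofReal x * ENNReal.ofReal Y ^ (-(3 / 4) : ℝ))) := by
  have hrinv : (ENNReal.ofReal r)⁻¹ ≠ 0 := ENNReal.inv_ne_zero.2 ENNReal.ofReal_ne_top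
  rcases hS.eq_or_lt with rfl | hS
  · have e : ENNReal.ofReal 0 ^ (-(1 / 2) : ℝ) = ⊤ := by
      rw [ENNReal.ofReal_zero, ENNReal.zero_rpow_of_neg (by norm_num)]
    rw [e, ENNReal.top_mul (by simp), ENNReal.mul_top hrinv]
    exact le_top
  have hS2 : ENNReal.ofReal S ^ (-(1 / 2) : ℝ) ≠ 0 := by
    rw [ENNReal.ofReal_rpow_of_pos hS]; simp; positivity
  rcases hY.eq_or_lt with rfl | hY
  · have e : ENNReal.ofReal 0 ^ (-(3 / 4) : ℝ) = ⊤ := by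
      rw [ENNReal.ofReal_zero, ENNReal.zero_rpow_of_neg (by norm_num)]
    rw [e, ENNReal.mul_top (by simpa using hx), add_top, ENNReal.mul_top hS2,
      ENNReal.mul_top hrinv]
    exact le_top
  have hn : 0 < n := lt_of_lt_of_le (by positivity) h2
  rw [ENNReal.ofReal_rpow_of_pos hS, ENNReal.ofReal_rpow_of_pos hx, ENNReal.ofReal_rpow_of_pos hY,
    ← ENNReal.ofReal_inv_of_pos hr, ← ENNReal.ofReal_inv_of_pos hn,
    ← ENNReal.ofReal_mul hx.le, ← ENNReal.ofReal_mul hx.le,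
    ← ENNReal.ofReal_add (by positivity) (by positivity), ← ENNReal.ofReal_mul (by positivity),
    ← ENNReal.ofReal_mul (by positivity)]
  refine ENNReal.ofReal_le_ofReal ?_
  -- pass to the roots `x = P²`, `S = T²`, `Y = Q⁴`
  obtain ⟨P, hP, rfl⟩ : ∃ P : ℝ, 0 < P ∧ x = P ^ 2 :=
    ⟨√x, Real.sqrt_pos.2 hx, (Real.sq_sqrt hx.le).symm⟩
  obtain ⟨T, hT, rfl⟩ : ∃ T : ℝ, 0 < T ∧ S = T ^ 2 :=
    ⟨√S, Real.sqrt_pos.2 hS, (Real.sq_sqrt hS.le).symm⟩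
  obtain ⟨Q, hQ, rfl⟩ : ∃ Q : ℝ, 0 < Q ∧ Y = Q ^ 4 :=
    ⟨√(√Y), Real.sqrt_pos.2 (Real.sqrt_pos.2 hY), by
      rw [show (4 : ℕ) = 2 * 2 from rfl, pow_mul, Real.sq_sqrt (Real.sqrt_nonneg _),
        Real.sq_sqrt hY.le]⟩
  have e1 : (T ^ 2) ^ (-(1 / 2) : ℝ) = T⁻¹ := by
    rw [← Real.rpow_natCast, ← Real.rpow_mul hT.le, ← Real.rpow_neg_one]; norm_num
  have e2 : (P ^ 2) ^ (-(1 / 2) : ℝ) = P⁻¹ := by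
    rw [← Real.rpow_natCast, ← Real.rpow_mul hP.le, ← Real.rpow_neg_one]; norm_num
  have e3 : (Q ^ 4) ^ (-(3 / 4) : ℝ) = (Q ^ 3)⁻¹ := by
    rw [← Real.rpow_natCast, ← Real.rpow_mul hQ.le, ← Real.rpow_natCast, ← Real.rpow_neg hQ.le]
    norm_num
  rw [e1, e2, e3]
  have hlow : r * (P * T * Q ^ 2) ≤ n := by
    refine (pow_le_pow_iff_left₀ (by positivity) hn.le two_ne_zero).1 ?_
    calc (r * (P * T * Q ^ 2)) ^ 2 = (r * (P ^ 2 * T ^ 2)) * (r * Q ^ 4) := by ring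
      _ ≤ n * n := by gcongr
      _ = n ^ 2 := by ring
  have hy : P / Q ^ 2 ≤ P⁻¹ + P ^ 2 * (Q ^ 3)⁻¹ := by
    have e : P⁻¹ + P ^ 2 * (Q ^ 3)⁻¹ = (Q ^ 3 + P ^ 3) / (P * Q ^ 3) := by field_simp
    rw [e, div_le_div_iff₀ (by positivity) (by positivity)]
    have key : P ^ 2 * Q ≤ Q ^ 3 + P ^ 3 := by
      rcases le_total P Q with h | h
      · have : P ^ 2 * Q ≤ Q ^ 2 * Q := by gcongr
        nlinarith [pow_pos hP 3]
      · have : P ^ 2 * Q ≤ P ^ 2 * P := by gcongr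
        nlinarith [pow_pos hQ 3]
    nlinarith [mul_le_mul_of_nonneg_right key (pow_pos hQ 2).le]
  calc P ^ 2 * n⁻¹ ≤ P ^ 2 * (r * (P * T * Q ^ 2))⁻¹ := by gcongr
    _ = r⁻¹ * (T⁻¹ * (P / Q ^ 2)) := by field_simp
    _ ≤ _ := by gcongr

/-- The collision average of the Newtonian singularity `1/|ζ'|` is at most a multiple of
`1/|ζ - ζ_*|`. The proof combines the component of `ζ'` along the relative velocity with its
component orthogonal to both velocities. -/
lemma exists_angular_bound : ∃ C : ℝ≥0∞, C ≠ ⊤ ∧ ∀ (k a b y : V) (r : ℝ),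
    Orthonormal ℝ ![k, a, b] → r ≠ 0 →
    ∫⁻ φ in Ioc 0 (2 * Real.pi), ∫⁻ θ in Ioc 0 (Real.pi / 2),
      ENNReal.ofReal (Real.sin θ * Real.cos θ) * ‖y + (r * Real.cos θ) • (Real.cos θ • k
        + (Real.sin θ * Real.cos φ) • a + (Real.sin θ * Real.sin φ) • b)‖ₑ⁻¹ ≤ C * ‖r‖ₑ⁻¹ := by
  obtain ⟨C₁, hC₁, H₁⟩ := exists_lintegral_sin_rpow_le
  obtain ⟨C₂, hC₂, H₂⟩ := exists_lintegral_polar_le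
  refine ⟨C₁ * C₂, ENNReal.mul_ne_top hC₁ hC₂, fun k a b y r hon hr => ?_⟩
  have hpi := Real.pi_pos
  have hi := orthonormal_iff_ite.1 hon
  have hk1 : ‖k‖ = 1 := by simpa using hon.1 0
  have hkk : inner ℝ k k = (1 : ℝ) := by rw [real_inner_self_eq_norm_sq, hk1]; norm_num
  have haa : inner ℝ a a = (1 : ℝ) := by
    rw [real_inner_self_eq_norm_sq, show ‖a‖ = 1 by simpa using hon.1 1]; norm_num
  have hbb : inner ℝ b b = (1 : ℝ) := by
    rw [real_inner_self_eq_norm_sq, show ‖b‖ = 1 by simpa using hon.1 2]; norm_num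
  have hka : inner ℝ k a = (0 : ℝ) := by simpa using hi 0 1
  have hkb : inner ℝ k b = (0 : ℝ) := by simpa using hi 0 2
  have hab : inner ℝ a b = (0 : ℝ) := by simpa using hi 1 2
  have hak : inner ℝ a k = (0 : ℝ) := by rw [real_inner_comm, hka]
  have hbk : inner ℝ b k = (0 : ℝ) := by rw [real_inner_comm, hkb]
  have hba : inner ℝ b a = (0 : ℝ) := by rw [real_inner_comm, hab]
  -- a unit vector of the plane of `a, b` orthogonal to `y`
  obtain ⟨t, ht⟩ : ∃ t : ℝ, Real.sin t * inner ℝ a y + Real.cos t * inner ℝ b y = 0 := by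
    by_cases h0 : inner ℝ a y ^ 2 + inner ℝ b y ^ 2 = (0 : ℝ)
    · have h1 : inner ℝ a y = (0 : ℝ) := by
        nlinarith [sq_nonneg (inner ℝ a y : ℝ), sq_nonneg (inner ℝ b y : ℝ)]
      have h2 : inner ℝ b y = (0 : ℝ) := by
        nlinarith [sq_nonneg (inner ℝ a y : ℝ), sq_nonneg (inner ℝ b y : ℝ)]
      exact ⟨0, by rw [h1, h2]; simp⟩
    · have hpos : (0 : ℝ) < inner ℝ a y ^ 2 + inner ℝ b y ^ 2 :=
        lt_of_le_of_ne (by positivity) (Ne.symm h0)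
      set R := √(inner ℝ a y ^ 2 + inner ℝ b y ^ 2 : ℝ)
      have hRpos : 0 < R := Real.sqrt_pos.2 hpos
      have hRsq : R ^ 2 = inner ℝ a y ^ 2 + inner ℝ b y ^ 2 := Real.sq_sqrt hpos.le
      obtain ⟨t, h1, h2⟩ := exists_cos_sin_eq (a := inner ℝ a y / R) (b := -inner ℝ b y / R)
        (by field_simp; linarith)
      exact ⟨t, by rw [← h1, ← h2]; field_simp; ring⟩
  set m : V := Real.sin t • a + Real.cos t • b with hm
  have hm1 : ‖m‖ = 1 := by
    rw [← sq_eq_sq₀ (norm_nonneg _) zero_le_one, ← real_inner_self_eq_norm_sq, hm]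
    simp only [inner_add_left, inner_add_right, inner_smul_left, inner_smul_right, haa, hbb, hab,
      hba, conj_trivial, mul_one, mul_zero, add_zero, zero_add]
    have := Real.sin_sq_add_cos_sq t
    linear_combination this
  have hmy : inner ℝ m y = (0 : ℝ) := by
    rw [hm, inner_add_left, inner_smul_left, inner_smul_left]
    simpa using ht
  set q : ℝ := inner ℝ k y / r with hq
  let o : ℝ → ℝ → V := fun φ θ => Real.cos θ • k
        + (Real.sin θ * Real.cos φ) • a + (Real.sin θ * Real.sin φ) • b
  have hvk : ∀ φ θ, inner ℝ k (y + (r * Real.cos θ) • o φ θ) = r * (q + Real.cos θ ^ 2) := by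
    intro φ θ
    simp only [o, inner_add_right, inner_smul_right, hkk, hka, hkb, hq]
    field_simp
    ring
  have hvm : ∀ φ θ, inner ℝ m (y + (r * Real.cos θ) • o φ θ)
      = r * (Real.sin θ * Real.cos θ * Real.sin (t + φ)) := by
    intro φ θ
    rw [inner_add_right, hmy, inner_smul_right]
    simp only [o, hm, inner_add_left, inner_add_right, inner_smul_left, inner_smul_right, haa, hbb,
      hab, hba, hak, hbk, conj_trivial, mul_one, mul_zero, add_zero, zero_add, Real.sin_add]
    ring
  have hr' : 0 < |r| := abs_pos.2 hr
  have hpt : ∀ φ, ∀ θ ∈ Ioo 0 (Real.pi / 2),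
      ENNReal.ofReal (Real.sin θ * Real.cos θ) * ‖y + (r * Real.cos θ) • o φ θ‖ₑ⁻¹
      ≤ ‖r‖ₑ⁻¹ * (‖Real.sin (t + φ)‖ₑ ^ (-(1 / 2) : ℝ) *
        (ENNReal.ofReal (Real.sin θ * Real.cos θ) ^ (-(1 / 2) : ℝ)
        + ENNReal.ofReal (Real.sin θ * Real.cos θ) * ‖q + Real.cos θ ^ 2‖ₑ ^ (-(3 / 4) : ℝ))) := by
    intro φ θ hθ
    have hc : 0 < Real.cos θ := Real.cos_pos_of_mem_Ioo ⟨by linarith [hθ.1], hθ.2⟩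
    have hs : 0 < Real.sin θ := Real.sin_pos_of_pos_of_lt_pi hθ.1 (by linarith [hθ.2])
    have hsc := mul_pos hs hc
    have h1 := abs_real_inner_le_norm m (y + (r * Real.cos θ) • o φ θ)
    have h2 := abs_real_inner_le_norm k (y + (r * Real.cos θ) • o φ θ)
    rw [hvm, hm1, one_mul, abs_mul, abs_mul, abs_of_pos hsc] at h1
    rw [hvk, hk1, one_mul, abs_mul] at h2
    have := mul_enorm_inv_le hr' hsc (abs_nonneg (Real.sin (t + φ)))
      (abs_nonneg (q + Real.cos θ ^ 2)) h1 h2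
    simpa only [← Real.norm_eq_abs, ofReal_norm] using this
  calc ∫⁻ φ in Ioc 0 (2 * Real.pi), ∫⁻ θ in Ioc 0 (Real.pi / 2),
        ENNReal.ofReal (Real.sin θ * Real.cos θ) * ‖y + (r * Real.cos θ) • o φ θ‖ₑ⁻¹
      ≤ ∫⁻ φ in Ioc 0 (2 * Real.pi), ‖r‖ₑ⁻¹ * (‖Real.sin (t + φ)‖ₑ ^ (-(1 / 2) : ℝ) * C₂) := by
        refine lintegral_mono fun φ => ?_
        rw [← setLIntegral_congr (Ioo_ae_eq_Ioc (a := (0 : ℝ)) (b := Real.pi / 2))]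
        refine (setLIntegral_mono' measurableSet_Ioo (hpt φ)).trans ?_
        rw [lintegral_const_mul _ (by fun_prop), lintegral_const_mul _ (by fun_prop)]
        gcongr
        refine (lintegral_mono_set Ioo_subset_Ioc_self).trans (H₂ q)
    _ = ‖r‖ₑ⁻¹ * ((∫⁻ φ in Ioc 0 (2 * Real.pi), ‖Real.sin (t + φ)‖ₑ ^ (-(1 / 2) : ℝ)) * C₂) := by
        rw [lintegral_const_mul _ (by fun_prop), lintegral_mul_const _ (by fun_prop)]
    _ ≤ ‖r‖ₑ⁻¹ * (C₁ * C₂) := by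
        gcongr
        have := lintegral_periodic_comp Real.two_pi_pos
          (f := fun φ => ‖Real.sin φ‖ₑ ^ (-(1 / 2) : ℝ)) (fun φ => by simp) t (ε := 1) (Or.inl rfl)
        simp only [one_mul] at this
        rw [this]
        exact H₁
    _ = C₁ * C₂ * ‖r‖ₑ⁻¹ := mul_comm _ _

end Singular

/-! ### The Gaussian and the fundamental collision integral -/

section Gaussian

open Filter Topology Function Metric
open scoped ENNReal

lemma sqrt_maxwellian_eq (v : V) :
    √(maxwellian v) = √(Real.pi ^ (-(3 / 2) : ℝ)) * Real.exp (-(1 / 2) * ‖v‖ ^ 2) := by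
  rw [maxwellian, Real.sqrt_mul (by positivity), ← Real.exp_half]
  congr 2; ring

lemma sqrt_maxwellian_pos (v : V) : 0 < √(maxwellian v) := by
  rw [sqrt_maxwellian_eq]; positivity

lemma sqrt_maxwellian_le (v : V) : √(maxwellian v) ≤ Real.exp (-(1 / 2) * ‖v‖ ^ 2) := by
  rw [sqrt_maxwellian_eq]
  refine mul_le_of_le_one_left (by positivity) ?_
  refine Real.sqrt_le_one.2 ?_
  exact Real.rpow_le_one_of_one_le_of_nonpos (by linarith [Real.pi_gt_three]) (by norm_num)

lemma contDiff_sqrt_maxwellian : ContDiff ℝ ∞ (fun v : V => √(maxwellian v)) := by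
  simp_rw [sqrt_maxwellian_eq]
  exact contDiff_const.mul (Real.contDiff_exp.comp (contDiff_const.mul (contDiff_norm_sq ℝ)))

lemma measurable_sqrt_maxwellian : Measurable (fun v : V => √(maxwellian v)) :=
  contDiff_sqrt_maxwellian.continuous.measurable

lemma fderiv_sqrt_maxwellian (v w : V) :
    fderiv ℝ (fun v : V => √(maxwellian v)) v w = inner ℝ (-(√(maxwellian v)) • v) w := by
  simp_rw [sqrt_maxwellian_eq]
  have h1 : HasFDerivAt (fun v : V => ‖v‖ ^ 2) (2 • (innerSL ℝ v)) v :=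
    (hasStrictFDerivAt_norm_sq v).hasFDerivAt
  have h2 := ((h1.const_mul (-(1 / 2))).exp).const_mul √(Real.pi ^ (-(3 / 2) : ℝ))
  rw [h2.fderiv]
  simp only [smul_apply, smul_eq_mul, innerSL_apply_apply, inner_smul_left, conj_trivial,
    nsmul_eq_mul]
  push_cast
  ring

/-- By conservation of energy. -/
lemma sqrt_maxwellian_mul (e : CollisionFrame) (ζ ζs : V) (φ θ : ℝ) :
    √(maxwellian (e.zetaPrime ζ ζs φ θ)) * √(maxwellian (e.zetaStarPrime ζ ζs φ θ))
      = √(maxwellian ζ) * √(maxwellian ζs) := by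
  simp only [sqrt_maxwellian_eq]
  have h := e.energy ζ ζs φ θ
  have key : ∀ a b : ℝ, Real.exp (-(1 / 2) * a) * Real.exp (-(1 / 2) * b)
      = Real.exp (-(1 / 2) * (a + b)) := fun a b => by rw [← Real.exp_add]; congr 1; ring
  rw [mul_mul_mul_comm, key, mul_mul_mul_comm, key, h]

lemma lintegral_gaussian_lt_top {b : ℝ} (hb : 0 < b) :
    ∫⁻ v : V, ENNReal.ofReal (Real.exp (-b * ‖v‖ ^ 2)) < ⊤ := by
  have h := (GaussianFourier.integrable_cexp_neg_mul_sq_norm_add (V := V) (b := (b : ℂ))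
    (by simpa using hb) 0 0).norm
  have e : ∀ v : V, ‖Complex.exp (-(b : ℂ) * (‖v‖ : ℂ) ^ 2 + 0 * ((inner ℝ (0 : V) v : ℝ) : ℂ))‖
      = Real.exp (-b * ‖v‖ ^ 2) := fun v => by
    rw [Complex.norm_exp]
    congr 1
    simp [← Complex.ofReal_pow]
  simp_rw [e] at h
  exact h.lintegral_lt_top

lemma sq_mul_exp_le (t : ℝ) :
    (1 + t) ^ 2 * Real.exp (-(1 / 2) * t ^ 2) ≤ 8 * Real.exp (-(1 / 4) * t ^ 2) := by
  have h1 : 1 + t ^ 2 / 4 ≤ Real.exp (t ^ 2 / 4) := by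
    have := Real.add_one_le_exp (t ^ 2 / 4); linarith
  have h2 : (1 + t) ^ 2 ≤ 8 * Real.exp (t ^ 2 / 4) := by nlinarith [sq_nonneg (t - 1)]
  calc (1 + t) ^ 2 * Real.exp (-(1 / 2) * t ^ 2)
      ≤ 8 * Real.exp (t ^ 2 / 4) * Real.exp (-(1 / 2) * t ^ 2) := by gcongr
    _ = 8 * Real.exp (-(1 / 4) * t ^ 2) := by
        rw [mul_assoc, ← Real.exp_add]; congr 2; ring

/-- A Gaussian with polynomial weight has bounded Newtonian potential. -/
lemma exists_gaussian_potential_le : ∃ C : ℝ≥0∞, C ≠ ⊤ ∧ ∀ ζ : V,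
    ∫⁻ u : V, ENNReal.ofReal ((1 + ‖ζ + u‖) ^ 2 * Real.exp (-(1 / 2) * ‖ζ + u‖ ^ 2))
      * (1 + ‖u‖ₑ⁻¹) ≤ C := by
  have hball : ∫⁻ x in ball (0 : V) 1, ‖x‖ₑ⁻¹ < ⊤ := by
    have := lintegral_ball_norm_rpow_lt_top (volume : Measure V) (β := 1)
      (by simp)
    simpa only [ENNReal.rpow_neg_one] using this
  set I : ℝ≥0∞ := ∫⁻ v : V, ENNReal.ofReal (Real.exp (-(1 / 4) * ‖v‖ ^ 2)) with hI
  have hIt : I ≠ ⊤ := (lintegral_gaussian_lt_top (by norm_num)).ne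
  refine ⟨16 * I + 8 * ∫⁻ x in ball (0 : V) 1, ‖x‖ₑ⁻¹,
    ENNReal.add_ne_top.2 ⟨ENNReal.mul_ne_top (by norm_num) hIt,
      ENNReal.mul_ne_top (by norm_num) hball.ne⟩, fun ζ => ?_⟩
  have hm : Measurable fun u : V => ‖u‖ₑ⁻¹ := by fun_prop
  calc _ ≤ ∫⁻ u : V, (16 * ENNReal.ofReal (Real.exp (-(1 / 4) * ‖ζ + u‖ ^ 2))
          + (ball (0 : V) 1).indicator (fun u => 8 * ‖u‖ₑ⁻¹) u) := by
        refine lintegral_mono fun u => ?_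
        have h0 := sq_mul_exp_le ‖ζ + u‖
        have h1 : ENNReal.ofReal ((1 + ‖ζ + u‖) ^ 2 * Real.exp (-(1 / 2) * ‖ζ + u‖ ^ 2))
            ≤ 8 * ENNReal.ofReal (Real.exp (-(1 / 4) * ‖ζ + u‖ ^ 2)) := by
          refine (ENNReal.ofReal_le_ofReal h0).trans (le_of_eq ?_)
          rw [ENNReal.ofReal_mul (by norm_num)]; norm_num
        have h2 : ENNReal.ofReal (Real.exp (-(1 / 4) * ‖ζ + u‖ ^ 2)) ≤ 1 := by
          rw [ENNReal.ofReal_le_one, Real.exp_le_one_iff]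
          nlinarith [sq_nonneg ‖ζ + u‖]
        by_cases hu : u ∈ ball (0 : V) 1
        · rw [indicator_of_mem hu, mul_add, mul_one]
          refine add_le_add (h1.trans (by gcongr; norm_num)) ?_
          gcongr
          calc _ ≤ 8 * ENNReal.ofReal (Real.exp (-(1 / 4) * ‖ζ + u‖ ^ 2)) := h1
            _ ≤ 8 * 1 := by gcongr
            _ = 8 := mul_one _
        · rw [indicator_of_notMem hu, add_zero]
          rw [mem_ball_zero_iff, not_lt] at hu
          have h3 : (1 : ℝ≥0∞) ≤ ‖u‖ₑ := by
            rw [← ofReal_norm]; exact ENNReal.one_le_ofReal.2 hu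
          have h4 : 1 + ‖u‖ₑ⁻¹ ≤ 2 := by
            calc 1 + ‖u‖ₑ⁻¹ ≤ 1 + 1 := by gcongr; exact ENNReal.inv_le_one.2 h3
              _ = 2 := by norm_num
          calc _ ≤ 8 * ENNReal.ofReal (Real.exp (-(1 / 4) * ‖ζ + u‖ ^ 2)) * 2 := by gcongr
            _ = _ := by rw [mul_right_comm]; norm_num
    _ = _ := by
        rw [lintegral_add_left (by fun_prop), lintegral_const_mul _ (by fun_prop),
          lintegral_add_left_eq_self (fun u : V =>
            ENNReal.ofReal (Real.exp (-(1 / 4) * ‖u‖ ^ 2))) ζ,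
          lintegral_indicator measurableSet_ball, lintegral_const_mul _ hm]

lemma rpow_norm_le {γ : ℝ} (hγ₀ : 0 ≤ γ) (hγ₁ : γ ≤ 1) (ζ u : V) :
    ‖u‖ ^ γ ≤ (1 + ‖ζ‖) ^ γ * (1 + ‖ζ + u‖) := by
  have h1 : ‖u‖ ≤ (1 + ‖ζ‖) * (1 + ‖ζ + u‖) := by
    have : ‖u‖ ≤ ‖ζ + u‖ + ‖ζ‖ := by
      have := norm_sub_le (ζ + u) ζ
      rwa [add_sub_cancel_left] at this
    nlinarith [norm_nonneg ζ, norm_nonneg (ζ + u), mul_nonneg (norm_nonneg ζ) (norm_nonneg (ζ + u))]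
  calc ‖u‖ ^ γ ≤ ((1 + ‖ζ‖) * (1 + ‖ζ + u‖)) ^ γ := by gcongr
    _ = (1 + ‖ζ‖) ^ γ * (1 + ‖ζ + u‖) ^ γ := Real.mul_rpow (by positivity) (by positivity)
    _ ≤ (1 + ‖ζ‖) ^ γ * (1 + ‖ζ + u‖) ^ (1 : ℝ) := by
        gcongr
        linarith [norm_nonneg (ζ + u)]
    _ = _ := by rw [Real.rpow_one]

/-- The kernel `B(|u|, θ) (1 + |ζ_*|) M(ζ_*)^{1/2}` with `ζ_* = ζ + u`. It dominates both
`B M(ζ_*)^{1/2}` and its velocity gradient. -/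
def collisionWeight (B₀ γ : ℝ) (ζ : V) (p : V × ℝ × ℝ) : ℝ :=
  crossSection B₀ γ ‖p.1‖ p.2.2 * ((1 + ‖ζ + p.1‖) * √(maxwellian (ζ + p.1)))

lemma measurable_collisionWeight (B₀ γ : ℝ) :
    Measurable (uncurry (collisionWeight B₀ γ)) := by
  have h1 : Measurable (fun q : V × V × ℝ × ℝ => √(maxwellian (q.1 + q.2.1))) :=
    measurable_sqrt_maxwellian.comp (by fun_prop)
  unfold collisionWeight crossSection uncurry
  fun_prop

lemma jump_eq_smul (e : CollisionFrame) {u : V} (hu : u ≠ 0) (φ θ : ℝ) :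
    e.jump (u, φ, θ) = (‖u‖ * Real.cos θ) • (Real.cos θ • (‖u‖⁻¹ • u)
      + (Real.sin θ * Real.cos φ) • e.e₂ 0 u + (Real.sin θ * Real.sin φ) • e.e₃ 0 u) := by
  have hn : 0 < ‖u‖ := norm_pos_iff.2 hu
  have hon := e.orthonormal 0 u hu.symm
  rw [sub_zero] at hon
  have hi := orthonormal_iff_ite.1 hon
  have h1 : inner ℝ (‖u‖⁻¹ • u) (e.e₂ 0 u) = (0 : ℝ) := by simpa using hi 0 1
  have h2 : inner ℝ (‖u‖⁻¹ • u) (e.e₃ 0 u) = (0 : ℝ) := by simpa using hi 0 2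
  rw [inner_smul_left, conj_trivial] at h1 h2
  have h1' := (mul_eq_zero.1 h1).resolve_left (inv_ne_zero hn.ne')
  have h2' := (mul_eq_zero.1 h2).resolve_left (inv_ne_zero hn.ne')
  have e1 : inner ℝ u (e.omega 0 u φ θ) = ‖u‖ * Real.cos θ := by
    simp only [CollisionFrame.omega, sub_zero, inner_add_right, inner_smul_right, h1', h2',
      real_inner_self_eq_norm_sq, mul_zero, add_zero]
    field_simp
  simp only [CollisionFrame.jump, e1]
  simp [CollisionFrame.omega]

/-- The fundamental collision integral: the kernel integrates the singularities `1/|ζ'|`,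
`1/|ζ_*'|` and `1/|ζ_*|` with the growth `(1 + |ζ|)^γ`. -/
lemma exists_lintegral_collisionWeight_le {B₀ γ : ℝ} (hB₀ : 0 < B₀) (hγ₀ : 0 ≤ γ)
    (hγ₁ : γ ≤ 1) :
    ∃ C : ℝ, 0 < C ∧ ∀ (e : CollisionFrame) (ζ : V),
      ∫⁻ p, ENNReal.ofReal (collisionWeight B₀ γ ζ p) * (1 + ‖ζ + e.jump p‖ₑ⁻¹
        + ‖ζ + (p.1 - e.jump p)‖ₑ⁻¹ + ‖ζ + p.1‖ₑ⁻¹) ∂collisionMeasure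
      ≤ ENNReal.ofReal (C * (1 + ‖ζ‖) ^ γ) := by
  obtain ⟨CA, hCA, HA⟩ := exists_angular_bound
  obtain ⟨CG, hCG, HG⟩ := exists_gaussian_potential_le
  have hpi := Real.pi_pos
  set L : ℝ≥0∞ := ∫⁻ _ in Ioc 0 (2 * Real.pi), ∫⁻ _ in Ioc 0 (Real.pi / 2), (1 : ℝ≥0∞) with hL
  have hLt : L ≠ ⊤ := by
    rw [hL]; simp only [lintegral_const, MeasurableSet.univ, Measure.restrict_apply, univ_inter,
      Real.volume_Ioc, sub_zero, one_mul]
    finiteness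
  set D : ℝ≥0∞ := ENNReal.ofReal B₀ * ((L + CA + CA) * CG + L * CG) with hD
  have hDt : D ≠ ⊤ := by finiteness
  refine ⟨D.toReal + 1, by positivity, fun e ζ => ?_⟩
  have hj := e.measurable_jump
  have hw : Measurable (collisionWeight B₀ γ ζ) :=
    (measurable_collisionWeight B₀ γ).of_uncurry_left
  have hmeas : Measurable (fun p : V × ℝ × ℝ => ENNReal.ofReal (collisionWeight B₀ γ ζ p)
      * (1 + ‖ζ + e.jump p‖ₑ⁻¹ + ‖ζ + (p.1 - e.jump p)‖ₑ⁻¹ + ‖ζ + p.1‖ₑ⁻¹)) := by fun_prop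
  set G : V → ℝ := fun v => (1 + ‖v‖) ^ 2 * Real.exp (-(1 / 2) * ‖v‖ ^ 2) with hG
  have hGm : Measurable G := by fun_prop
  set K : ℝ≥0∞ := ENNReal.ofReal B₀ * ENNReal.ofReal ((1 + ‖ζ‖) ^ γ) with hK
  have hKt : K ≠ ⊤ := by finiteness
  -- pointwise bound of the kernel
  have hker : ∀ u φ θ, θ ∈ Ioc 0 (Real.pi / 2) →
      ENNReal.ofReal (collisionWeight B₀ γ ζ (u, φ, θ))
      ≤ K * ENNReal.ofReal (G (ζ + u)) * ENNReal.ofReal (Real.sin θ * Real.cos θ) := by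
    intro u φ θ hθ
    have hc : 0 ≤ Real.cos θ := Real.cos_nonneg_of_mem_Icc ⟨by linarith [hθ.1], hθ.2⟩
    have hs : 0 ≤ Real.sin θ := Real.sin_nonneg_of_nonneg_of_le_pi hθ.1.le (by linarith [hθ.2])
    rw [hK, ← ENNReal.ofReal_mul hB₀.le, ← ENNReal.ofReal_mul (by positivity),
      ← ENNReal.ofReal_mul (by positivity)]
    refine ENNReal.ofReal_le_ofReal ?_
    simp only [collisionWeight, crossSection, hG]
    calc B₀ * ‖u‖ ^ γ * Real.sin θ * Real.cos θ * ((1 + ‖ζ + u‖) * √(maxwellian (ζ + u)))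
        ≤ B₀ * ((1 + ‖ζ‖) ^ γ * (1 + ‖ζ + u‖)) * Real.sin θ * Real.cos θ
          * ((1 + ‖ζ + u‖) * Real.exp (-(1 / 2) * ‖ζ + u‖ ^ 2)) := by
          gcongr
          · exact rpow_norm_le hγ₀ hγ₁ ζ u
          · exact sqrt_maxwellian_le _
      _ = _ := by ring
  -- the angular integral, for fixed relative velocity
  have hang : ∀ u : V, u ≠ 0 → ∫⁻ φ in Ioc 0 (2 * Real.pi), ∫⁻ θ in Ioc 0 (Real.pi / 2),
      ENNReal.ofReal (Real.sin θ * Real.cos θ) * (1 + ‖ζ + e.jump (u, φ, θ)‖ₑ⁻¹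
        + ‖ζ + (u - e.jump (u, φ, θ))‖ₑ⁻¹ + ‖ζ + u‖ₑ⁻¹)
      ≤ (L + CA + CA) * (1 + ‖u‖ₑ⁻¹) + L * (1 + ‖ζ + u‖ₑ⁻¹) := by
    intro u hu
    have hon := e.orthonormal 0 u hu.symm
    rw [sub_zero] at hon
    have hn : ‖u‖ ≠ 0 := norm_ne_zero_iff.2 hu
    have A1 := HA _ _ _ ζ ‖u‖ hon hn
    have A2 := HA _ _ _ (ζ + u) (-‖u‖) hon (neg_ne_zero.2 hn)
    have e2 : ∀ φ θ, ζ + (u - e.jump (u, φ, θ)) = ζ + u + (-‖u‖ * Real.cos θ) •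
        (Real.cos θ • (‖u‖⁻¹ • u) + (Real.sin θ * Real.cos φ) • e.e₂ 0 u
          + (Real.sin θ * Real.sin φ) • e.e₃ 0 u) := fun φ θ => by
      rw [jump_eq_smul e hu, neg_mul, neg_smul]; abel
    simp_rw [← e2] at A2
    simp_rw [← jump_eq_smul e hu] at A1
    rw [enorm_neg] at A2
    rw [enorm_norm] at A1 A2
    have hS : ∀ θ, ENNReal.ofReal (Real.sin θ * Real.cos θ) ≤ 1 := fun θ => by
      rw [ENNReal.ofReal_le_one]
      nlinarith [Real.sin_sq_add_cos_sq θ, sq_nonneg (Real.sin θ - Real.cos θ)]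
    have mA : ∀ φ, Measurable (fun θ => ENNReal.ofReal (Real.sin θ * Real.cos θ)
        * ‖ζ + e.jump (u, φ, θ)‖ₑ⁻¹) := fun φ => by
      have : Measurable (fun θ => e.jump (u, φ, θ)) := hj.comp (by fun_prop)
      fun_prop
    have mB : ∀ φ, Measurable (fun θ => ENNReal.ofReal (Real.sin θ * Real.cos θ)
        * ‖ζ + (u - e.jump (u, φ, θ))‖ₑ⁻¹) := fun φ => by
      have : Measurable (fun θ => e.jump (u, φ, θ)) := hj.comp (by fun_prop)
      fun_prop
    have mA' : Measurable (fun φ => ∫⁻ θ in Ioc 0 (Real.pi / 2),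
        ENNReal.ofReal (Real.sin θ * Real.cos θ) * ‖ζ + e.jump (u, φ, θ)‖ₑ⁻¹) := by
      refine Measurable.lintegral_prod_right' (f := fun q : ℝ × ℝ =>
        ENNReal.ofReal (Real.sin q.2 * Real.cos q.2) * ‖ζ + e.jump (u, q.1, q.2)‖ₑ⁻¹) ?_
      have : Measurable (fun q : ℝ × ℝ => e.jump (u, q.1, q.2)) := hj.comp (by fun_prop)
      fun_prop
    have mB' : Measurable (fun φ => ∫⁻ θ in Ioc 0 (Real.pi / 2),
        ENNReal.ofReal (Real.sin θ * Real.cos θ) * ‖ζ + (u - e.jump (u, φ, θ))‖ₑ⁻¹) := by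
      refine Measurable.lintegral_prod_right' (f := fun q : ℝ × ℝ =>
        ENNReal.ofReal (Real.sin q.2 * Real.cos q.2) * ‖ζ + (u - e.jump (u, q.1, q.2))‖ₑ⁻¹) ?_
      have : Measurable (fun q : ℝ × ℝ => e.jump (u, q.1, q.2)) := hj.comp (by fun_prop)
      fun_prop
    calc _ ≤ ∫⁻ φ in Ioc 0 (2 * Real.pi), ∫⁻ θ in Ioc 0 (Real.pi / 2),
          ((1 + ‖ζ + u‖ₑ⁻¹) * 1 + ENNReal.ofReal (Real.sin θ * Real.cos θ)
              * ‖ζ + e.jump (u, φ, θ)‖ₑ⁻¹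
            + ENNReal.ofReal (Real.sin θ * Real.cos θ) * ‖ζ + (u - e.jump (u, φ, θ))‖ₑ⁻¹) := by
          refine lintegral_mono fun φ => lintegral_mono fun θ => ?_
          calc _ = ENNReal.ofReal (Real.sin θ * Real.cos θ) * (1 + ‖ζ + u‖ₑ⁻¹)
              + ENNReal.ofReal (Real.sin θ * Real.cos θ) * ‖ζ + e.jump (u, φ, θ)‖ₑ⁻¹
              + ENNReal.ofReal (Real.sin θ * Real.cos θ) * ‖ζ + (u - e.jump (u, φ, θ))‖ₑ⁻¹ := by
                ring
            _ ≤ 1 * (1 + ‖ζ + u‖ₑ⁻¹)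
              + ENNReal.ofReal (Real.sin θ * Real.cos θ) * ‖ζ + e.jump (u, φ, θ)‖ₑ⁻¹
              + ENNReal.ofReal (Real.sin θ * Real.cos θ) * ‖ζ + (u - e.jump (u, φ, θ))‖ₑ⁻¹ := by
                gcongr
                exact hS θ
            _ = _ := by rw [one_mul, mul_one]
      _ = (1 + ‖ζ + u‖ₑ⁻¹) * L
          + (∫⁻ φ in Ioc 0 (2 * Real.pi), ∫⁻ θ in Ioc 0 (Real.pi / 2),
              ENNReal.ofReal (Real.sin θ * Real.cos θ) * ‖ζ + e.jump (u, φ, θ)‖ₑ⁻¹)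
          + ∫⁻ φ in Ioc 0 (2 * Real.pi), ∫⁻ θ in Ioc 0 (Real.pi / 2),
            ENNReal.ofReal (Real.sin θ * Real.cos θ) * ‖ζ + (u - e.jump (u, φ, θ))‖ₑ⁻¹ := by
          have i1 : ∀ φ, ∫⁻ θ in Ioc 0 (Real.pi / 2),
              ((1 + ‖ζ + u‖ₑ⁻¹) * 1 + ENNReal.ofReal (Real.sin θ * Real.cos θ)
              * ‖ζ + e.jump (u, φ, θ)‖ₑ⁻¹
            + ENNReal.ofReal (Real.sin θ * Real.cos θ) * ‖ζ + (u - e.jump (u, φ, θ))‖ₑ⁻¹)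
            = (1 + ‖ζ + u‖ₑ⁻¹) * (∫⁻ _ in Ioc 0 (Real.pi / 2), 1)
              + (∫⁻ θ in Ioc 0 (Real.pi / 2), ENNReal.ofReal (Real.sin θ * Real.cos θ)
                * ‖ζ + e.jump (u, φ, θ)‖ₑ⁻¹)
              + ∫⁻ θ in Ioc 0 (Real.pi / 2), ENNReal.ofReal (Real.sin θ * Real.cos θ)
                * ‖ζ + (u - e.jump (u, φ, θ))‖ₑ⁻¹ := fun φ => by
            rw [lintegral_add_right _ (mB φ), lintegral_add_right _ (mA φ),
              lintegral_const_mul _ measurable_const]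
          simp_rw [i1]
          rw [lintegral_add_right _ mB', lintegral_add_right _ mA',
            lintegral_const_mul _ measurable_const, hL]
      _ ≤ (1 + ‖ζ + u‖ₑ⁻¹) * L + CA * ‖u‖ₑ⁻¹ + CA * ‖u‖ₑ⁻¹ := by gcongr
      _ ≤ (L * (1 + ‖u‖ₑ⁻¹) + CA * (1 + ‖u‖ₑ⁻¹) + CA * (1 + ‖u‖ₑ⁻¹))
            + L * (1 + ‖ζ + u‖ₑ⁻¹) := by
          have h1 : CA * ‖u‖ₑ⁻¹ ≤ CA * (1 + ‖u‖ₑ⁻¹) := by gcongr; exact le_add_self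
          calc (1 + ‖ζ + u‖ₑ⁻¹) * L + CA * ‖u‖ₑ⁻¹ + CA * ‖u‖ₑ⁻¹
              ≤ L * (1 + ‖u‖ₑ⁻¹) + ((1 + ‖ζ + u‖ₑ⁻¹) * L + CA * (1 + ‖u‖ₑ⁻¹)
                + CA * (1 + ‖u‖ₑ⁻¹)) := by
                refine le_trans ?_ le_add_self
                gcongr
            _ = _ := by ring
      _ = _ := by ring
  calc _ = ∫⁻ u, ∫⁻ φ in Ioc 0 (2 * Real.pi), ∫⁻ θ in Ioc 0 (Real.pi / 2),
        ENNReal.ofReal (collisionWeight B₀ γ ζ (u, φ, θ)) * (1 + ‖ζ + e.jump (u, φ, θ)‖ₑ⁻¹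
        + ‖ζ + (u - e.jump (u, φ, θ))‖ₑ⁻¹ + ‖ζ + u‖ₑ⁻¹) := by
        rw [lintegral_prod _ hmeas.aemeasurable]
        exact lintegral_congr fun u =>
          lintegral_prod _ (hmeas.comp measurable_prodMk_left).aemeasurable
    _ ≤ ∫⁻ u, K * ENNReal.ofReal (G (ζ + u))
          * ((L + CA + CA) * (1 + ‖u‖ₑ⁻¹) + L * (1 + ‖ζ + u‖ₑ⁻¹)) := by
        refine lintegral_mono_ae ?_
        filter_upwards [ae_ne_volume 0] with u hu
        refine le_trans ?_ (mul_le_mul_right (hang u hu.symm) _)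
        have hKG : K * ENNReal.ofReal (G (ζ + u)) ≠ ⊤ := by finiteness
        rw [← lintegral_const_mul' _ _ hKG]
        refine lintegral_mono fun φ => ?_
        rw [← lintegral_const_mul' _ _ hKG]
        refine setLIntegral_mono' measurableSet_Ioc fun θ hθ => ?_
        rw [← mul_assoc]
        gcongr
        exact hker u φ θ hθ
    _ = K * ((L + CA + CA) * (∫⁻ u, ENNReal.ofReal (G (ζ + u)) * (1 + ‖u‖ₑ⁻¹))
          + L * ∫⁻ u, ENNReal.ofReal (G (ζ + u)) * (1 + ‖ζ + u‖ₑ⁻¹)) := by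
        rw [← lintegral_const_mul _ (by fun_prop), ← lintegral_const_mul _ (by fun_prop),
          ← lintegral_add_left (by fun_prop), ← lintegral_const_mul _ (by fun_prop)]
        exact lintegral_congr fun u => by ring
    _ ≤ K * ((L + CA + CA) * CG + L * CG) := by
        gcongr
        · exact HG ζ
        · rw [lintegral_add_left_eq_self (fun u => ENNReal.ofReal (G u) * (1 + ‖u‖ₑ⁻¹)) ζ]
          simpa only [zero_add] using HG 0
    _ = D * ENNReal.ofReal ((1 + ‖ζ‖) ^ γ) := by rw [hK, hD]; ring
    _ ≤ _ := by
        rw [ENNReal.ofReal_mul (by positivity)]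
        gcongr
        refine (ENNReal.ofReal_toReal hDt).symm.le.trans (ENNReal.ofReal_le_ofReal (by linarith))

end Gaussian

/-! ### The collision integral of bounded measurable profiles -/

section Collision

open Filter Topology Function Metric

-- The measure on a product is not unfolded by instance search.
instance : (volume : Measure (V × V)).IsAddHaarMeasure := Measure.prod.instIsAddHaarMeasure _ _

lemma collisionMeasure_eq : collisionMeasure = (volume : Measure (V × ℝ × ℝ)).restrict
    (univ ×ˢ (Ioc 0 (2 * Real.pi) ×ˢ Ioc 0 (Real.pi / 2))) := by
  rw [Measure.volume_eq_prod, Measure.volume_eq_prod, ← Measure.prod_restrict,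
    ← Measure.prod_restrict, Measure.restrict_univ]

lemma ae_collisionMeasure_mem :
    ∀ᵐ p ∂collisionMeasure, p.2.2 ∈ Ioc 0 (Real.pi / 2) := by
  rw [collisionMeasure_eq]
  filter_upwards [ae_restrict_mem (MeasurableSet.univ.prod
    (measurableSet_Ioc.prod measurableSet_Ioc))] with p hp
  exact hp.2.2

lemma integral_collisionMeasure {F : V × ℝ × ℝ → ℝ} (hF : Integrable F collisionMeasure) :
    ∫ p, F p ∂collisionMeasure = ∫ u : V, ∫ φ in (0 : ℝ)..(2 * Real.pi),
      ∫ θ in (0 : ℝ)..(Real.pi / 2), F (u, φ, θ) := by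
  rw [integral_prod F hF]
  refine integral_congr_ae ?_
  filter_upwards [hF.prod_right_ae] with u hu
  rw [integral_prod _ hu, intervalIntegral.integral_of_le Real.two_pi_pos.le]
  simp_rw [intervalIntegral.integral_of_le Real.pi_div_two_pos.le]

lemma crossSection_nonneg {B₀ γ r θ : ℝ} (hB₀ : 0 < B₀) (hr : 0 ≤ r)
    (hθ : θ ∈ Ioc 0 (Real.pi / 2)) : 0 ≤ crossSection B₀ γ r θ := by
  have hpi := Real.pi_pos
  have hc : 0 ≤ Real.cos θ := Real.cos_nonneg_of_mem_Icc ⟨by linarith [hθ.1], hθ.2⟩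
  have hs : 0 ≤ Real.sin θ := Real.sin_nonneg_of_nonneg_of_le_pi hθ.1.le (by linarith [hθ.2])
  unfold crossSection
  positivity

/-- The integrand of `Γ(h₁, h₂)` in the relative velocity `u = ζ_* - ζ`, after simplification by
conservation of energy. For fixed `(u, φ, θ)` the profiles are only translated in `ζ`. -/
def collisionTerm (e : CollisionFrame) (B₀ γ : ℝ) (h₁ h₂ : V × V → ℝ) (z : V × V)
    (p : V × ℝ × ℝ) : ℝ :=
  crossSection B₀ γ ‖p.1‖ p.2.2 *
    (√(maxwellian (z.2 + p.1)) * (h₁ (z.1, z.2 + e.jump p) * h₂ (z.1, z.2 + (p.1 - e.jump p)))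
      - √(maxwellian (z.2 + p.1)) * (h₁ z * h₂ (z.1, z.2 + p.1)))

lemma collisionIntegrand_relative (e : CollisionFrame) (B₀ γ : ℝ) (h₁ h₂ : V × V → ℝ) (z : V × V)
    (p : V × ℝ × ℝ) :
    collisionIntegrand e.relative B₀ γ (sqrtMaxwellianMul h₁ z.1) (sqrtMaxwellianMul h₂ z.1) z.2
      (z.2 + p.1) p.2.1 p.2.2 = √(maxwellian z.2) * collisionTerm e B₀ γ h₁ h₂ z p := by
  have h := sqrt_maxwellian_mul e.relative z.2 (z.2 + p.1) p.2.1 p.2.2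
  rw [e.relative_zetaPrime, e.relative_zetaStarPrime] at h
  simp only [collisionIntegrand, sqrtMaxwellianMul, collisionTerm, e.relative_zetaPrime,
    e.relative_zetaStarPrime, Prod.mk.eta]
  rw [show z.2 - (z.2 + p.1) = -p.1 by abel, norm_neg]
  linear_combination (h₁ (z.1, z.2 + e.jump p) * h₂ (z.1, z.2 + (p.1 - e.jump p))
    * crossSection B₀ γ ‖p.1‖ p.2.2) * h

lemma jump_energy (e : CollisionFrame) (ζ : V) (p : V × ℝ × ℝ) :
    ‖ζ + e.jump p‖ ^ 2 + ‖ζ + (p.1 - e.jump p)‖ ^ 2 = ‖ζ‖ ^ 2 + ‖ζ + p.1‖ ^ 2 := by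
  have h := e.relative.energy ζ (ζ + p.1) p.2.1 p.2.2
  rwa [e.relative_zetaPrime, e.relative_zetaStarPrime] at h

lemma measurable_collisionTerm (e : CollisionFrame) (B₀ γ : ℝ) {h₁ h₂ : V × V → ℝ}
    (m₁ : Measurable h₁) (m₂ : Measurable h₂) :
    Measurable (uncurry (collisionTerm e B₀ γ h₁ h₂)) := by
  have hj := e.measurable_jump
  have h0 : Measurable (fun q : (V × V) × V × ℝ × ℝ => √(maxwellian (q.1.2 + q.2.1))) :=
    measurable_sqrt_maxwellian.comp (by fun_prop)
  have h1 : Measurable (fun q : (V × V) × V × ℝ × ℝ => h₁ (q.1.1, q.1.2 + e.jump q.2)) :=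
    m₁.comp (by fun_prop)
  have h2 : Measurable (fun q : (V × V) × V × ℝ × ℝ =>
    h₂ (q.1.1, q.1.2 + (q.2.1 - e.jump q.2))) := m₂.comp (by fun_prop)
  have h3 : Measurable (fun q : (V × V) × V × ℝ × ℝ => h₁ q.1) := m₁.comp (by fun_prop)
  have h4 : Measurable (fun q : (V × V) × V × ℝ × ℝ => h₂ (q.1.1, q.1.2 + q.2.1)) :=
    m₂.comp (by fun_prop)
  unfold collisionTerm crossSection uncurry
  fun_prop

/-- A constant controlling the fundamental collision integral, with real-valued integrand. -/
def IsCollisionConst (B₀ γ C : ℝ) : Prop :=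
  0 < C ∧ ∀ (e : CollisionFrame) (ζ : V),
    ∫⁻ p, ENNReal.ofReal (collisionWeight B₀ γ ζ p * (1 + ‖ζ + e.jump p‖⁻¹
      + ‖ζ + (p.1 - e.jump p)‖⁻¹ + ‖ζ + p.1‖⁻¹)) ∂collisionMeasure
    ≤ ENNReal.ofReal (C * (1 + ‖ζ‖) ^ γ)

lemma ofReal_inv_norm_le (v : V) : ENNReal.ofReal ‖v‖⁻¹ ≤ ‖v‖ₑ⁻¹ := by
  by_cases hv : v = 0
  · simp [hv]
  · rw [ENNReal.ofReal_inv_of_pos (norm_pos_iff.2 hv), ofReal_norm]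

lemma exists_isCollisionConst {B₀ γ : ℝ} (hB₀ : 0 < B₀) (hγ₀ : 0 ≤ γ) (hγ₁ : γ ≤ 1) :
    ∃ C, IsCollisionConst B₀ γ C := by
  obtain ⟨C, hC, H⟩ := exists_lintegral_collisionWeight_le hB₀ hγ₀ hγ₁
  refine ⟨C, hC, fun e ζ => le_trans (lintegral_mono fun p => ?_) (H e ζ)⟩
  rw [ENNReal.ofReal_mul' (by positivity), ENNReal.ofReal_add (by positivity) (by positivity),
    ENNReal.ofReal_add (by positivity) (by positivity),
    ENNReal.ofReal_add (by positivity) (by positivity), ENNReal.ofReal_one]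
  gcongr <;> exact ofReal_inv_norm_le _

/-- A bound of an integrand by the collision kernel integrates to a bound with the growth
`(1 + |ζ|)^γ`. -/
lemma lintegral_le_of_norm_le {F : Type*} [NormedAddCommGroup F] {B₀ γ C : ℝ}
    (hC : IsCollisionConst B₀ γ C) (e : CollisionFrame) {ζ : V} {f : V × ℝ × ℝ → F} {m : ℝ}
    (hm : 0 ≤ m) (hf : ∀ p : V × ℝ × ℝ, p.2.2 ∈ Ioc 0 (Real.pi / 2) →
      ‖f p‖ ≤ collisionWeight B₀ γ ζ p * (1 + ‖ζ + e.jump p‖⁻¹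
        + ‖ζ + (p.1 - e.jump p)‖⁻¹ + ‖ζ + p.1‖⁻¹) * m) :
    ∫⁻ p, ‖f p‖ₑ ∂collisionMeasure ≤ ENNReal.ofReal (C * (1 + ‖ζ‖) ^ γ * m) := by
  calc ∫⁻ p, ‖f p‖ₑ ∂collisionMeasure
      ≤ ∫⁻ p, ENNReal.ofReal (collisionWeight B₀ γ ζ p * (1 + ‖ζ + e.jump p‖⁻¹
        + ‖ζ + (p.1 - e.jump p)‖⁻¹ + ‖ζ + p.1‖⁻¹)) * ENNReal.ofReal m ∂collisionMeasure := by
        refine lintegral_mono_ae ?_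
        filter_upwards [ae_collisionMeasure_mem] with p hp
        rw [← ofReal_norm, ← ENNReal.ofReal_mul' hm]
        exact ENNReal.ofReal_le_ofReal (hf p hp)
    _ = (∫⁻ p, ENNReal.ofReal (collisionWeight B₀ γ ζ p * (1 + ‖ζ + e.jump p‖⁻¹
        + ‖ζ + (p.1 - e.jump p)‖⁻¹ + ‖ζ + p.1‖⁻¹)) ∂collisionMeasure) * ENNReal.ofReal m :=
        lintegral_mul_const' _ _ ENNReal.ofReal_ne_top
    _ ≤ _ := by
        rw [ENNReal.ofReal_mul' hm]
        gcongr
        exact hC.2 e ζ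

lemma collisionWeight_nonneg {B₀ γ : ℝ} (hB₀ : 0 < B₀) (ζ : V) {p : V × ℝ × ℝ}
    (hp : p.2.2 ∈ Ioc 0 (Real.pi / 2)) : 0 ≤ collisionWeight B₀ γ ζ p :=
  mul_nonneg (crossSection_nonneg hB₀ (norm_nonneg _) hp) (by positivity)

lemma crossSection_mul_le {B₀ γ : ℝ} (hB₀ : 0 < B₀) (ζ : V) {p : V × ℝ × ℝ}
    (hp : p.2.2 ∈ Ioc 0 (Real.pi / 2)) :
    crossSection B₀ γ ‖p.1‖ p.2.2 * √(maxwellian (ζ + p.1)) ≤ collisionWeight B₀ γ ζ p := by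
  unfold collisionWeight
  refine mul_le_mul_of_nonneg_left ?_ (crossSection_nonneg hB₀ (norm_nonneg _) hp)
  exact le_mul_of_one_le_left (Real.sqrt_nonneg _) (by linarith [norm_nonneg (ζ + p.1)])

section Bounded

variable {α B₀ γ C : ℝ} {e : CollisionFrame} {h₁ h₂ : V × V → ℝ} {K₁ K₂ : ℝ}

/-- Products of profiles at velocities with at least the energy of `ζ`. -/
lemma abs_mul_le_of_energy (hα : 0 ≤ α) (hK₁ : 0 ≤ K₁)
    (b₁ : ∀ z, |h₁ z| ≤ K₁ * Real.exp (-α * ‖z.2‖ ^ 2))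
    (b₂ : ∀ z, |h₂ z| ≤ K₂ * Real.exp (-α * ‖z.2‖ ^ 2)) (hK₂ : 0 ≤ K₂) {x a b ζ : V}
    (hen : ‖ζ‖ ^ 2 ≤ ‖a‖ ^ 2 + ‖b‖ ^ 2) :
    |h₁ (x, a) * h₂ (x, b)| ≤ K₁ * K₂ * Real.exp (-α * ‖ζ‖ ^ 2) := by
  rw [abs_mul]
  calc |h₁ (x, a)| * |h₂ (x, b)|
      ≤ (K₁ * Real.exp (-α * ‖a‖ ^ 2)) * (K₂ * Real.exp (-α * ‖b‖ ^ 2)) :=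
        mul_le_mul (b₁ _) (b₂ _) (abs_nonneg _) (by positivity)
    _ = K₁ * K₂ * Real.exp (-α * (‖a‖ ^ 2 + ‖b‖ ^ 2)) := by
        rw [mul_mul_mul_comm, ← Real.exp_add]; congr 2; ring
    _ ≤ _ := by
        gcongr K₁ * K₂ * Real.exp ?_
        nlinarith

lemma lintegral_collisionTerm_le (hC : IsCollisionConst B₀ γ C) (hα : 0 ≤ α) (hB₀ : 0 < B₀)
    (hK₁ : 0 ≤ K₁) (hK₂ : 0 ≤ K₂)
    (b₁ : ∀ z, |h₁ z| ≤ K₁ * Real.exp (-α * ‖z.2‖ ^ 2))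
    (b₂ : ∀ z, |h₂ z| ≤ K₂ * Real.exp (-α * ‖z.2‖ ^ 2)) (z : V × V) :
    ∫⁻ p, ‖collisionTerm e B₀ γ h₁ h₂ z p‖ₑ ∂collisionMeasure
      ≤ ENNReal.ofReal (C * (1 + ‖z.2‖) ^ γ * (2 * K₁ * K₂ * Real.exp (-α * ‖z.2‖ ^ 2))) := by
  refine lintegral_le_of_norm_le hC e (by positivity) fun p hp => ?_
  have h1 := abs_mul_le_of_energy hα hK₁ b₁ b₂ hK₂ (x := z.1) (a := z.2 + e.jump p)
    (b := z.2 + (p.1 - e.jump p)) (ζ := z.2)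
    (by rw [jump_energy]; exact le_add_of_nonneg_right (by positivity))
  have h2 := abs_mul_le_of_energy hα hK₁ b₁ b₂ hK₂ (x := z.1) (a := z.2)
    (b := z.2 + p.1) (ζ := z.2) (le_add_of_nonneg_right (by positivity))
  have hcs := crossSection_nonneg (γ := γ) hB₀ (norm_nonneg p.1) hp
  have hcw := collisionWeight_nonneg (γ := γ) hB₀ z.2 hp
  rw [collisionTerm, Real.norm_eq_abs, ← mul_sub, ← mul_assoc, abs_mul,
    abs_of_nonneg (mul_nonneg hcs (Real.sqrt_nonneg _))]
  calc _ ≤ collisionWeight B₀ γ z.2 p * (2 * K₁ * K₂ * Real.exp (-α * ‖z.2‖ ^ 2)) := by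
        refine mul_le_mul (crossSection_mul_le hB₀ z.2 hp) ?_ (abs_nonneg _) hcw
        refine (abs_sub _ _).trans ?_
        rw [Prod.mk.eta] at h2
        linarith
    _ ≤ _ := by
        gcongr
        refine le_mul_of_one_le_right hcw ?_
        have : 0 ≤ ‖z.2 + e.jump p‖⁻¹ + ‖z.2 + (p.1 - e.jump p)‖⁻¹ + ‖z.2 + p.1‖⁻¹ := by
          positivity
        linarith

lemma integrable_collisionTerm (hC : IsCollisionConst B₀ γ C) (hα : 0 ≤ α) (hB₀ : 0 < B₀)
    (hK₁ : 0 ≤ K₁) (hK₂ : 0 ≤ K₂) (m₁ : Measurable h₁) (m₂ : Measurable h₂)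
    (b₁ : ∀ z, |h₁ z| ≤ K₁ * Real.exp (-α * ‖z.2‖ ^ 2))
    (b₂ : ∀ z, |h₂ z| ≤ K₂ * Real.exp (-α * ‖z.2‖ ^ 2)) (z : V × V) :
    Integrable (collisionTerm e B₀ γ h₁ h₂ z) collisionMeasure :=
  ⟨(measurable_collisionTerm e B₀ γ m₁ m₂).of_uncurry_left.aestronglyMeasurable,
    (lintegral_collisionTerm_le hC hα hB₀ hK₁ hK₂ b₁ b₂ z).trans_lt ENNReal.ofReal_lt_top⟩

lemma nonlinearTerm_eq_integral (hC : IsCollisionConst B₀ γ C) (hα : 0 ≤ α) (hB₀ : 0 < B₀)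
    (hK₁ : 0 ≤ K₁) (hK₂ : 0 ≤ K₂) (m₁ : Measurable h₁) (m₂ : Measurable h₂)
    (b₁ : ∀ z, |h₁ z| ≤ K₁ * Real.exp (-α * ‖z.2‖ ^ 2))
    (b₂ : ∀ z, |h₂ z| ≤ K₂ * Real.exp (-α * ‖z.2‖ ^ 2)) (z : V × V) :
    nonlinearTerm e B₀ γ h₁ h₂ z = ∫ p, collisionTerm e B₀ γ h₁ h₂ z p ∂collisionMeasure := by
  rw [integral_collisionMeasure (integrable_collisionTerm hC hα hB₀ hK₁ hK₂ m₁ m₂ b₁ b₂ z),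
    nonlinearTerm_eq e e.relative, nonlinearTerm, collisionQ,
    ← integral_add_left_eq_self _ z.2]
  have : ∀ u φ θ, collisionIntegrand e.relative B₀ γ (sqrtMaxwellianMul h₁ z.1)
      (sqrtMaxwellianMul h₂ z.1) z.2 (z.2 + u) φ θ
      = √(maxwellian z.2) * collisionTerm e B₀ γ h₁ h₂ z (u, φ, θ) := fun u φ θ =>
    collisionIntegrand_relative e B₀ γ h₁ h₂ z (u, φ, θ)
  simp_rw [this, intervalIntegral.integral_const_mul, integral_const_mul]
  rw [← mul_assoc, inv_mul_cancel₀ (sqrt_maxwellian_pos z.2).ne', one_mul]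

lemma collisionConverges_of_bounded (hC : IsCollisionConst B₀ γ C) (hα : 0 ≤ α) (hB₀ : 0 < B₀)
    (hK₁ : 0 ≤ K₁) (hK₂ : 0 ≤ K₂) (m₁ : Measurable h₁) (m₂ : Measurable h₂)
    (b₁ : ∀ z, |h₁ z| ≤ K₁ * Real.exp (-α * ‖z.2‖ ^ 2))
    (b₂ : ∀ z, |h₂ z| ≤ K₂ * Real.exp (-α * ‖z.2‖ ^ 2)) (z : V × V) :
    CollisionConverges e B₀ γ (sqrtMaxwellianMul h₁ z.1) (sqrtMaxwellianMul h₂ z.1) z.2 := by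
  have k₁ : Measurable (sqrtMaxwellianMul h₁ z.1) :=
    measurable_sqrt_maxwellian.mul (m₁.comp (by fun_prop))
  have k₂ : Measurable (sqrtMaxwellianMul h₂ z.1) :=
    measurable_sqrt_maxwellian.mul (m₂.comp (by fun_prop))
  have n1 := e.measurable_zetaPrime (X := V × ℝ × ℝ) (a := fun _ => z.2) measurable_const
      measurable_fst (measurable_fst.comp measurable_snd) (measurable_snd.comp measurable_snd)
  have n2 := e.measurable_zetaStarPrime (X := V × ℝ × ℝ) (a := fun _ => z.2) measurable_const
      measurable_fst (measurable_fst.comp measurable_snd) (measurable_snd.comp measurable_snd)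
  refine ⟨Measurable.aestronglyMeasurable ?_, ?_⟩
  · have := k₁.comp n1
    have := k₂.comp n2
    unfold collisionIntegrand crossSection
    fun_prop
  · have key := lintegral_collision_eq e (f := fun a b c θ =>
      ‖(sqrtMaxwellianMul h₁ z.1 b * sqrtMaxwellianMul h₂ z.1 c
        - sqrtMaxwellianMul h₁ z.1 z.2 * sqrtMaxwellianMul h₂ z.1 a)
        * crossSection B₀ γ ‖z.2 - a‖ θ‖ₑ) z.2 (by unfold crossSection; fun_prop)
    rw [HasFiniteIntegral]
    refine lt_of_eq_of_lt key ?_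
    have e1 : ∀ p : V × ℝ × ℝ, ‖(sqrtMaxwellianMul h₁ z.1 (z.2 + e.jump p)
        * sqrtMaxwellianMul h₂ z.1 (z.2 + (p.1 - e.jump p))
        - sqrtMaxwellianMul h₁ z.1 z.2 * sqrtMaxwellianMul h₂ z.1 (z.2 + p.1))
        * crossSection B₀ γ ‖z.2 - (z.2 + p.1)‖ p.2.2‖ₑ
        = ‖√(maxwellian z.2)‖ₑ * ‖collisionTerm e B₀ γ h₁ h₂ z p‖ₑ := fun p => by
      rw [← enorm_mul, ← collisionIntegrand_relative, collisionIntegrand, e.relative_zetaPrime,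
        e.relative_zetaStarPrime]
    simp_rw [e1]
    rw [lintegral_const_mul' _ _ enorm_ne_top]
    exact ENNReal.mul_lt_top enorm_lt_top
      ((lintegral_collisionTerm_le hC hα hB₀ hK₁ hK₂ b₁ b₂ z).trans_lt ENNReal.ofReal_lt_top)

lemma abs_nonlinearTerm_le (hC : IsCollisionConst B₀ γ C) (hα : 0 ≤ α) (hB₀ : 0 < B₀)
    (hK₁ : 0 ≤ K₁) (hK₂ : 0 ≤ K₂) (m₁ : Measurable h₁) (m₂ : Measurable h₂)
    (b₁ : ∀ z, |h₁ z| ≤ K₁ * Real.exp (-α * ‖z.2‖ ^ 2))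
    (b₂ : ∀ z, |h₂ z| ≤ K₂ * Real.exp (-α * ‖z.2‖ ^ 2)) (z : V × V) :
    |nonlinearTerm e B₀ γ h₁ h₂ z|
      ≤ C * (1 + ‖z.2‖) ^ γ * (2 * K₁ * K₂ * Real.exp (-α * ‖z.2‖ ^ 2)) := by
  rw [nonlinearTerm_eq_integral hC hα hB₀ hK₁ hK₂ m₁ m₂ b₁ b₂, ← Real.norm_eq_abs,
    ← ENNReal.ofReal_le_ofReal_iff (by have := hC.1; positivity), ofReal_norm]
  exact (enorm_integral_le_lintegral_enorm _).trans
    (lintegral_collisionTerm_le hC hα hB₀ hK₁ hK₂ b₁ b₂ z)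

end Bounded

end Collision

/-! ### Differentiating the collision integral -/

section Gradient

open Filter Topology Function Metric

lemma IsAdmissibleDomain.isOpen_phase {Ω : Set V} (hΩ : IsAdmissibleDomain Ω) :
    IsOpen (phase Ω) := hΩ.isOpen.prod isOpen_univ

/-- The gradient of `z ↦ M(z.2)^{1/2}` along the directions `ι v`, as a function of the velocity. -/
def kernelGrad (ι : V →L[ℝ] V × V) (ζ : V) : V :=
  ContinuousLinearMap.adjoint ((ContinuousLinearMap.snd ℝ V V).comp ι) (-(√(maxwellian ζ)) • ζ)

lemma measurable_kernelGrad (ι : V →L[ℝ] V × V) : Measurable (kernelGrad ι) := by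
  have := measurable_sqrt_maxwellian
  unfold kernelGrad
  fun_prop

lemma fderiv_sqrt_maxwellian_snd_add (ι : V →L[ℝ] V × V) (u : V) (z : V × V) (v : V) :
    fderiv ℝ (fun z : V × V => √(maxwellian (z.2 + u))) z (ι v)
      = inner ℝ (kernelGrad ι (z.2 + u)) v := by
  have h1 : HasFDerivAt (fun v : V => √(maxwellian v))
      (fderiv ℝ (fun v : V => √(maxwellian v)) (z.2 + u)) (z.2 + u) :=
    ((contDiff_sqrt_maxwellian.differentiable (by simp)) _).hasFDerivAt
  have h2 : HasFDerivAt (fun z : V × V => z.2 + u) (ContinuousLinearMap.snd ℝ V V) z :=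
    hasFDerivAt_snd.add_const u
  have h3 := h1.comp z h2
  rw [comp_def] at h3
  rw [h3.fderiv, ContinuousLinearMap.comp_apply, fderiv_sqrt_maxwellian, kernelGrad,
    ContinuousLinearMap.adjoint_inner_left]
  rfl

lemma norm_kernelGrad_le {ι : V →L[ℝ] V × V} (hι : ∀ v, ‖(ι v).2‖ ≤ ‖v‖) (ζ : V) :
    ‖kernelGrad ι ζ‖ ≤ (1 + ‖ζ‖) * √(maxwellian ζ) := by
  have h1 : ‖(ContinuousLinearMap.snd ℝ V V).comp ι‖ ≤ 1 :=
    ContinuousLinearMap.opNorm_le_bound _ zero_le_one fun v => by simpa using hι v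
  calc ‖kernelGrad ι ζ‖
      ≤ ‖ContinuousLinearMap.adjoint ((ContinuousLinearMap.snd ℝ V V).comp ι)‖
        * ‖-(√(maxwellian ζ)) • ζ‖ := ContinuousLinearMap.le_opNorm _ _
    _ ≤ 1 * ‖-(√(maxwellian ζ)) • ζ‖ := by
        rw [LinearIsometryEquiv.norm_map]
        gcongr
    _ = ‖ζ‖ * √(maxwellian ζ) := by
        rw [one_mul, norm_smul, norm_neg, Real.norm_of_nonneg (Real.sqrt_nonneg _), mul_comm]
    _ ≤ _ := by gcongr; linarith

/-- A profile `h` with weak gradient `g` along the directions `ι v` (the position directions for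
`ι = inl`, the velocity directions for `ι = inr`), both everywhere defined and measurable, with
pointwise bounds. The bound of `g` is the one that a finite weighted norm gives through
`IsAdmissibleDomain.exists_weight_inv_le`. -/
structure IsProfile (Ω : Set V) (α : ℝ) (ι : V →L[ℝ] V × V) (h : V × V → ℝ) (g : V × V → V)
    (K L : ℝ) : Prop where
  measurable : Measurable h
  measurable_grad : Measurable g
  nonneg : 0 ≤ K
  nonneg_grad : 0 ≤ L
  abs_le : ∀ z, |h z| ≤ K * Real.exp (-α * ‖z.2‖ ^ 2)
  norm_grad_le : ∀ z, ‖g z‖ ≤ L * bdryDist Ω z.1 ^ (-(1 / 2) : ℝ) * (1 + ‖z.2‖⁻¹)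
    * Real.exp (-α * ‖z.2‖ ^ 2)
  locallyIntegrable_grad : LocallyIntegrableOn g (phase Ω)
  hasWeakDeriv : ∀ v, HasWeakDeriv volume (phase Ω) (ι v) h (fun z => inner ℝ (g z) v)

/-- The gradient of `collisionTerm` along the directions `ι v`, by the product rule. -/
def collisionGrad (e : CollisionFrame) (B₀ γ : ℝ) (ι : V →L[ℝ] V × V) (h₁ h₂ : V × V → ℝ)
    (g₁ g₂ : V × V → V) (z : V × V) (p : V × ℝ × ℝ) : V :=
  crossSection B₀ γ ‖p.1‖ p.2.2 •
    ((√(maxwellian (z.2 + p.1)) •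
        (h₂ (z.1, z.2 + (p.1 - e.jump p)) • g₁ (z.1, z.2 + e.jump p)
          + h₁ (z.1, z.2 + e.jump p) • g₂ (z.1, z.2 + (p.1 - e.jump p)))
      + (h₁ (z.1, z.2 + e.jump p) * h₂ (z.1, z.2 + (p.1 - e.jump p)))
        • kernelGrad ι (z.2 + p.1))
    - (√(maxwellian (z.2 + p.1)) • (h₂ (z.1, z.2 + p.1) • g₁ z + h₁ z • g₂ (z.1, z.2 + p.1))
      + (h₁ z * h₂ (z.1, z.2 + p.1)) • kernelGrad ι (z.2 + p.1)))

variable {Ω : Set V} {α B₀ γ C : ℝ} {e : CollisionFrame} {ι : V →L[ℝ] V × V}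
  {h₁ h₂ : V × V → ℝ} {g₁ g₂ : V × V → V} {K₁ K₂ L₁ L₂ : ℝ}

lemma measurable_collisionGrad (e : CollisionFrame) (B₀ γ : ℝ) (ι : V →L[ℝ] V × V)
    (m₁ : Measurable h₁) (m₂ : Measurable h₂) (n₁ : Measurable g₁) (n₂ : Measurable g₂) :
    Measurable (uncurry (collisionGrad e B₀ γ ι h₁ h₂ g₁ g₂)) := by
  have hj := e.measurable_jump
  have h0 : Measurable (fun q : (V × V) × V × ℝ × ℝ => √(maxwellian (q.1.2 + q.2.1))) :=
    measurable_sqrt_maxwellian.comp (by fun_prop)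
  have hk : Measurable (fun q : (V × V) × V × ℝ × ℝ => kernelGrad ι (q.1.2 + q.2.1)) :=
    (measurable_kernelGrad ι).comp (by fun_prop)
  have hA : Measurable (fun q : (V × V) × V × ℝ × ℝ => (q.1.1, q.1.2 + e.jump q.2)) := by fun_prop
  have hB : Measurable (fun q : (V × V) × V × ℝ × ℝ =>
    (q.1.1, q.1.2 + (q.2.1 - e.jump q.2))) := by fun_prop
  have hU : Measurable (fun q : (V × V) × V × ℝ × ℝ => (q.1.1, q.1.2 + q.2.1)) := by fun_prop
  have a1 := m₁.comp hA
  have a2 := m₂.comp hB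
  have a3 := m₂.comp hU
  have a4 := n₁.comp hA
  have a5 := n₂.comp hB
  have a6 := n₂.comp hU
  simp only [comp_def] at a1 a2 a3 a4 a5 a6
  unfold collisionGrad crossSection uncurry
  fun_prop

/-- For fixed `(u, φ, θ)` the integrand is built from translates of the profiles in `ζ`, so that the
product rule applies. -/
lemma hasWeakDeriv_collisionTerm (hΩ : IsAdmissibleDomain Ω) (hα : 0 ≤ α)
    (P₁ : IsProfile Ω α ι h₁ g₁ K₁ L₁) (P₂ : IsProfile Ω α ι h₂ g₂ K₂ L₂) (v : V)
    (p : V × ℝ × ℝ) :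
    HasWeakDeriv volume (phase Ω) (ι v) (fun z => collisionTerm e B₀ γ h₁ h₂ z p)
      (fun z => inner ℝ (collisionGrad e B₀ γ ι h₁ h₂ g₁ g₂ z p) v) := by
  have hO := hΩ.isOpen_phase
  have eadd : ∀ (a : V) (z : V × V), z + ((0 : V), a) = (z.1, z.2 + a) := fun a z => by
    ext1 <;> simp
  have hinv : ∀ (a : V) (z : V × V), z + ((0 : V), a) ∈ phase Ω ↔ z ∈ phase Ω := fun a z => by
    simp [phase]
  have bd : ∀ {h : V × V → ℝ} {g : V × V → V} {K L : ℝ}, IsProfile Ω α ι h g K L →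
      ∀ z, ‖h z‖ ≤ K := fun P z => by
    refine (P.abs_le z).trans (mul_le_of_le_one_right P.nonneg (Real.exp_le_one_iff.2 ?_))
    nlinarith [sq_nonneg ‖z.2‖]
  have mt : ∀ {h : V × V → ℝ} (a : V), Measurable h →
      Measurable (fun z : V × V => h (z.1, z.2 + a)) := fun a hm => hm.comp (by fun_prop)
  have hA := (P₁.hasWeakDeriv v).comp_add hO (hinv (e.jump p))
  have hB := (P₂.hasWeakDeriv v).comp_add hO (hinv (p.1 - e.jump p))
  have hU := (P₂.hasWeakDeriv v).comp_add hO (hinv p.1)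
  simp only [eadd] at hA hB hU
  have hk : ContDiff ℝ ∞ (fun z : V × V => √(maxwellian (z.2 + p.1))) :=
    contDiff_sqrt_maxwellian.comp (contDiff_snd.add contDiff_const)
  have gain := (hA.mul hO hB (mt _ P₁.measurable) (mt _ P₂.measurable)
    (fun z => bd P₁ _) (fun z => bd P₂ _)).smooth_mul hO hk
  have loss := ((P₁.hasWeakDeriv v).mul hO hU P₁.measurable (mt _ P₂.measurable)
    (fun z => bd P₁ _) (fun z => bd P₂ _)).smooth_mul hO hk
  have key := (gain.sub loss).smooth_mul hO
    (contDiff_const (c := crossSection B₀ γ ‖p.1‖ p.2.2))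
  convert key using 2 with z z
  · rfl
  simp only [fderiv_sqrt_maxwellian_snd_add, fderiv_fun_const, Pi.zero_apply,
    _root_.zero_apply, zero_mul, add_zero, collisionGrad, inner_smul_left,
    inner_sub_left, inner_add_left, conj_trivial]
  ring

/-- The bound of the gradient of the collision integral; only the term where the derivative falls
on `h₁(x, ζ)` in the loss part is not controlled by the distance to the boundary alone. -/
def gradBound (Ω : Set V) (α γ C K₁ K₂ L₁ L₂ : ℝ) (g₁ : V × V → V) (z : V × V) : ℝ :=
  C * (1 + ‖z.2‖) ^ γ * (Real.exp (-α * ‖z.2‖ ^ 2)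
    * ((L₁ * K₂ + 2 * K₁ * L₂) * bdryDist Ω z.1 ^ (-(1 / 2) : ℝ) + 2 * K₁ * K₂) + K₂ * ‖g₁ z‖)

lemma bdryDist_rpow_nonneg (Ω : Set V) (x : V) (s : ℝ) : 0 ≤ bdryDist Ω x ^ s :=
  Real.rpow_nonneg Metric.infDist_nonneg _

/-- Products of a profile and a gradient at velocities with at least the energy of `ζ`. -/
lemma norm_smul_grad_le {h : V × V → ℝ} {g : V × V → V} {h' : V × V → ℝ} {g' : V × V → V}
    {K L K' L' : ℝ} (hα : 0 ≤ α) (P : IsProfile Ω α ι h g K L) (P' : IsProfile Ω α ι h' g' K' L')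
    {x a b ζ : V} (hen : ‖ζ‖ ^ 2 ≤ ‖a‖ ^ 2 + ‖b‖ ^ 2) :
    ‖h (x, a) • g' (x, b)‖ ≤ Real.exp (-α * ‖ζ‖ ^ 2)
      * (K * L' * bdryDist Ω x ^ (-(1 / 2) : ℝ)) * (1 + ‖b‖⁻¹) := by
  have hd := bdryDist_rpow_nonneg Ω x (-(1 / 2))
  have hK := P.nonneg
  have hL := P'.nonneg_grad
  rw [norm_smul]
  calc ‖h (x, a)‖ * ‖g' (x, b)‖
      ≤ (K * Real.exp (-α * ‖a‖ ^ 2)) * (L' * bdryDist Ω x ^ (-(1 / 2) : ℝ) * (1 + ‖b‖⁻¹)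
        * Real.exp (-α * ‖b‖ ^ 2)) :=
        mul_le_mul (P.abs_le _) (P'.norm_grad_le _) (norm_nonneg _) (by positivity)
    _ = Real.exp (-α * (‖a‖ ^ 2 + ‖b‖ ^ 2)) * (K * L' * bdryDist Ω x ^ (-(1 / 2) : ℝ))
        * (1 + ‖b‖⁻¹) := by
        rw [mul_add (-α), Real.exp_add]; ring
    _ ≤ _ := by
        gcongr Real.exp ?_ * _ * _
        nlinarith

lemma norm_collisionGrad_le (hα : 0 ≤ α) (hB₀ : 0 < B₀) (hι : ∀ v, ‖(ι v).2‖ ≤ ‖v‖)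
    (P₁ : IsProfile Ω α ι h₁ g₁ K₁ L₁) (P₂ : IsProfile Ω α ι h₂ g₂ K₂ L₂) (z : V × V)
    {p : V × ℝ × ℝ} (hp : p.2.2 ∈ Ioc 0 (Real.pi / 2)) :
    ‖collisionGrad e B₀ γ ι h₁ h₂ g₁ g₂ z p‖ ≤ collisionWeight B₀ γ z.2 p * (1 + ‖z.2 + e.jump p‖⁻¹
        + ‖z.2 + (p.1 - e.jump p)‖⁻¹ + ‖z.2 + p.1‖⁻¹) * (Real.exp (-α * ‖z.2‖ ^ 2)
    * ((L₁ * K₂ + 2 * K₁ * L₂) * bdryDist Ω z.1 ^ (-(1 / 2) : ℝ) + 2 * K₁ * K₂)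
      + K₂ * ‖g₁ z‖) := by
  set A := z.2 + e.jump p with hA
  set B := z.2 + (p.1 - e.jump p) with hB
  set U := z.2 + p.1
  set E := Real.exp (-α * ‖z.2‖ ^ 2)
  set d := bdryDist Ω z.1 ^ (-(1 / 2) : ℝ)
  have hd0 : 0 ≤ d := bdryDist_rpow_nonneg Ω z.1 _
  have hE0 : 0 ≤ E := (Real.exp_pos _).le
  have enAB : ‖z.2‖ ^ 2 ≤ ‖A‖ ^ 2 + ‖B‖ ^ 2 := by
    rw [hA, hB, jump_energy]; exact le_add_of_nonneg_right (by positivity)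
  have enBA : ‖z.2‖ ^ 2 ≤ ‖B‖ ^ 2 + ‖A‖ ^ 2 := by rwa [add_comm]
  have enU : ‖z.2‖ ^ 2 ≤ ‖z.2‖ ^ 2 + ‖U‖ ^ 2 := le_add_of_nonneg_right (by positivity)
  have hK₁ := P₁.nonneg
  have hK₂ := P₂.nonneg
  have hL₁ := P₁.nonneg_grad
  have hL₂ := P₂.nonneg_grad
  have t1 := norm_smul_grad_le hα P₂ P₁ (x := z.1) enBA
  have t2 := norm_smul_grad_le hα P₁ P₂ (x := z.1) enAB
  have t3 := abs_mul_le_of_energy hα hK₁ P₁.abs_le P₂.abs_le hK₂ (x := z.1) enAB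
  have t4 := norm_smul_grad_le hα P₁ P₂ (x := z.1) enU
  have t5 := abs_mul_le_of_energy hα hK₁ P₁.abs_le P₂.abs_le hK₂ (x := z.1) enU
  have t6 : ‖h₂ (z.1, U) • g₁ z‖ ≤ K₂ * ‖g₁ z‖ := by
    rw [norm_smul]
    gcongr
    refine (P₂.abs_le _).trans (mul_le_of_le_one_right P₂.nonneg (Real.exp_le_one_iff.2 ?_))
    nlinarith [sq_nonneg ‖U‖]
  rw [Prod.mk.eta] at t4 t5
  have hcs := crossSection_nonneg (γ := γ) hB₀ (norm_nonneg p.1) hp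
  have hcw := collisionWeight_nonneg (γ := γ) hB₀ z.2 hp
  have hM := Real.sqrt_nonneg (maxwellian U)
  have w1 : √(maxwellian U) ≤ (1 + ‖U‖) * √(maxwellian U) :=
    le_mul_of_one_le_left hM (by linarith [norm_nonneg U])
  set W := (1 + ‖U‖) * √(maxwellian U)
  have hW0 : 0 ≤ W := by positivity
  have w2 : ‖kernelGrad ι U‖ ≤ W := norm_kernelGrad_le hι U
  have s1 : ∀ x : V, ‖√(maxwellian U) • x‖ ≤ W * ‖x‖ := fun x => by
    rw [norm_smul, Real.norm_of_nonneg hM]; gcongr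
  have s2 : ∀ c : ℝ, ‖c • kernelGrad ι U‖ ≤ W * |c| := fun c => by
    rw [norm_smul, Real.norm_eq_abs, mul_comm]; gcongr
  have hA0 : 0 ≤ ‖A‖⁻¹ := by positivity
  have hB0 : 0 ≤ ‖B‖⁻¹ := by positivity
  have hU0 : 0 ≤ ‖U‖⁻¹ := by positivity
  rw [collisionGrad, norm_smul, Real.norm_of_nonneg hcs,
    show collisionWeight B₀ γ z.2 p = crossSection B₀ γ ‖p.1‖ p.2.2 * W from rfl, mul_assoc,
    mul_assoc]
  refine mul_le_mul_of_nonneg_left ?_ hcs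
  set S := 1 + ‖A‖⁻¹ + ‖B‖⁻¹ + ‖U‖⁻¹ with hS
  have S1 : 1 ≤ S := by rw [hS]; linarith
  have bd1 : ‖h₂ (z.1, B) • g₁ (z.1, A)‖ ≤ E * (L₁ * K₂ * d) * S := by
    refine t1.trans ?_
    rw [mul_comm K₂]
    gcongr
    rw [hS]; linarith
  have bd2 : ‖h₁ (z.1, A) • g₂ (z.1, B)‖ ≤ E * (K₁ * L₂ * d) * S := by
    refine t2.trans ?_
    gcongr
    rw [hS]; linarith
  have bd4 : ‖h₁ z • g₂ (z.1, U)‖ ≤ E * (K₁ * L₂ * d) * S := by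
    refine t4.trans ?_
    gcongr
    rw [hS]; linarith
  have bd3 : |h₁ (z.1, A) * h₂ (z.1, B)| ≤ K₁ * K₂ * E * S :=
    t3.trans (le_mul_of_one_le_right (by positivity) S1)
  have bd5 : |h₁ z * h₂ (z.1, U)| ≤ K₁ * K₂ * E * S :=
    t5.trans (le_mul_of_one_le_right (by positivity) S1)
  have bd6 : ‖h₂ (z.1, U) • g₁ z‖ ≤ K₂ * ‖g₁ z‖ * S :=
    t6.trans (le_mul_of_one_le_right (by positivity) S1)
  calc _ ≤ (W * (‖h₂ (z.1, B) • g₁ (z.1, A)‖ + ‖h₁ (z.1, A) • g₂ (z.1, B)‖)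
        + W * |h₁ (z.1, A) * h₂ (z.1, B)|)
        + (W * (‖h₂ (z.1, U) • g₁ z‖ + ‖h₁ z • g₂ (z.1, U)‖) + W * |h₁ z * h₂ (z.1, U)|) := by
        refine (norm_sub_le _ _).trans (add_le_add ?_ ?_)
        · refine (norm_add_le _ _).trans (add_le_add ((s1 _).trans ?_) (s2 _))
          gcongr
          exact norm_add_le _ _
        · refine (norm_add_le _ _).trans (add_le_add ((s1 _).trans ?_) (s2 _))
          gcongr
          exact norm_add_le _ _
    _ ≤ (W * (E * (L₁ * K₂ * d) * S + E * (K₁ * L₂ * d) * S) + W * (K₁ * K₂ * E * S))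
        + (W * (K₂ * ‖g₁ z‖ * S + E * (K₁ * L₂ * d) * S) + W * (K₁ * K₂ * E * S)) := by
        gcongr
    _ = _ := by ring

lemma lintegral_collisionGrad_le (hC : IsCollisionConst B₀ γ C) (hα : 0 ≤ α) (hB₀ : 0 < B₀)
    (hι : ∀ v, ‖(ι v).2‖ ≤ ‖v‖) (P₁ : IsProfile Ω α ι h₁ g₁ K₁ L₁)
    (P₂ : IsProfile Ω α ι h₂ g₂ K₂ L₂) (z : V × V) :
    ∫⁻ p, ‖collisionGrad e B₀ γ ι h₁ h₂ g₁ g₂ z p‖ₑ ∂collisionMeasure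
      ≤ ENNReal.ofReal (gradBound Ω α γ C K₁ K₂ L₁ L₂ g₁ z) := by
  have hd := bdryDist_rpow_nonneg Ω z.1 (-(1 / 2))
  have hK₁ := P₁.nonneg
  have hK₂ := P₂.nonneg
  have hL₁ := P₁.nonneg_grad
  have hL₂ := P₂.nonneg_grad
  exact lintegral_le_of_norm_le hC e (by positivity)
    fun p hp => norm_collisionGrad_le hα hB₀ hι P₁ P₂ z hp

lemma locallyIntegrableOn_gradBound (hΩ : IsAdmissibleDomain Ω)
    (hg : LocallyIntegrableOn g₁ (phase Ω)) :
    LocallyIntegrableOn (gradBound Ω α γ C K₁ K₂ L₁ L₂ g₁) (phase Ω) := by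
  have hO := hΩ.isOpen_phase
  have hms : MeasurableSet (phase Ω) := hO.measurableSet
  have c1 : ContinuousOn (fun z : V × V => C * (1 + ‖z.2‖) ^ γ) (phase Ω) := by
    refine continuousOn_const.mul (ContinuousOn.rpow_const (by fun_prop) fun z _ => Or.inl ?_)
    positivity
  have c2 : ContinuousOn (fun z : V × V => Real.exp (-α * ‖z.2‖ ^ 2)
      * ((L₁ * K₂ + 2 * K₁ * L₂) * bdryDist Ω z.1 ^ (-(1 / 2) : ℝ) + 2 * K₁ * K₂)) (phase Ω) := by
    have : ContinuousOn (fun z : V × V => bdryDist Ω z.1 ^ (-(1 / 2) : ℝ)) (phase Ω) := by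
      refine ContinuousOn.rpow_const ?_ fun z hz => Or.inl (hΩ.bdryDist_pos hz.1).ne'
      exact ((continuous_infDist_pt _).comp continuous_fst).continuousOn
    fun_prop
  have l2 : LocallyIntegrableOn (fun z : V × V => K₂ * ‖g₁ z‖) (phase Ω) :=
    hg.norm.continuousOn_mul continuousOn_const hO.isLocallyClosed
  have l3 := (c2.locallyIntegrableOn (μ := (volume : Measure (V × V))) hms).add l2
  exact l3.continuousOn_mul c1 hO.isLocallyClosed

/-- The collision integral of two profiles has a weak gradient, obtained by differentiation under
the integral sign. -/
lemma exists_grad_nonlinearTerm (hΩ : IsAdmissibleDomain Ω) (hC : IsCollisionConst B₀ γ C)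
    (hα : 0 ≤ α) (hB₀ : 0 < B₀) (hι : ∀ v, ‖(ι v).2‖ ≤ ‖v‖)
    (P₁ : IsProfile Ω α ι h₁ g₁ K₁ L₁) (P₂ : IsProfile Ω α ι h₂ g₂ K₂ L₂) (e : CollisionFrame) :
    ∃ g : V × V → V, LocallyIntegrableOn g (phase Ω) ∧
      (∀ v, HasWeakDeriv volume (phase Ω) (ι v) (nonlinearTerm e B₀ γ h₁ h₂)
        (fun z => inner ℝ (g z) v)) ∧
      ∀ z, ‖g z‖ ≤ gradBound Ω α γ C K₁ K₂ L₁ L₂ g₁ z := by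
  have hO := hΩ.isOpen_phase
  have hmeas := measurable_collisionGrad e B₀ γ ι P₁.measurable P₂.measurable P₁.measurable_grad
    P₂.measurable_grad
  have hlint := lintegral_collisionGrad_le (e := e) hC hα hB₀ hι P₁ P₂
  have hint : ∀ z, Integrable (collisionGrad e B₀ γ ι h₁ h₂ g₁ g₂ z) collisionMeasure := fun z =>
    ⟨hmeas.of_uncurry_left.aestronglyMeasurable, (hlint z).trans_lt ENNReal.ofReal_lt_top⟩
  have hloc := locallyIntegrableOn_gradBound (α := α) (γ := γ) (C := C) (K₁ := K₁) (K₂ := K₂)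
    (L₁ := L₁) (L₂ := L₂) hΩ P₁.locallyIntegrable_grad
  have hbd : ∀ z, ‖∫ p, collisionGrad e B₀ γ ι h₁ h₂ g₁ g₂ z p ∂collisionMeasure‖ₑ
      ≤ ENNReal.ofReal (gradBound Ω α γ C K₁ K₂ L₁ L₂ g₁ z) := fun z =>
    (enorm_integral_le_lintegral_enorm _).trans (hlint z)
  refine ⟨fun z => ∫ p, collisionGrad e B₀ γ ι h₁ h₂ g₁ g₂ z p ∂collisionMeasure, ?_,
    fun v => ?_, fun z => ?_⟩
  · rw [locallyIntegrableOn_iff hO.isLocallyClosed] at hloc ⊢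
    intro K hK hKc
    refine Integrable.mono (hloc K hK hKc)
      hmeas.stronglyMeasurable.integral_prod_right.aestronglyMeasurable
      (Eventually.of_forall fun z => ?_)
    rw [← enorm_le_iff_norm_le]
    exact (hbd z).trans (Real.ofReal_le_enorm _)
  · have hA : LocallyIntegrableOn (fun z : V × V => C * (1 + ‖z.2‖) ^ γ
        * (2 * K₁ * K₂ * Real.exp (-α * ‖z.2‖ ^ 2))) (phase Ω) := by
      refine ContinuousOn.locallyIntegrableOn ?_ hO.measurableSet
      have : ContinuousOn (fun z : V × V => (1 + ‖z.2‖) ^ γ) (phase Ω) :=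
        ContinuousOn.rpow_const (by fun_prop) fun z _ => Or.inl (by positivity)
      fun_prop
    have hB : LocallyIntegrableOn (fun z : V × V => gradBound Ω α γ C K₁ K₂ L₁ L₂ g₁ z * ‖v‖)
        (phase Ω) := hloc.mul_continuousOn continuousOn_const hO.isLocallyClosed
    have key := HasWeakDeriv.integral_param (μ := (volume : Measure (V × V)))
      (ν := collisionMeasure) hO
      (measurable_collisionTerm e B₀ γ P₁.measurable P₂.measurable)
      (g := fun z p => inner ℝ (collisionGrad e B₀ γ ι h₁ h₂ g₁ g₂ z p) v)
      (hmeas.inner_const)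
      (Eventually.of_forall fun p => hasWeakDeriv_collisionTerm hΩ hα P₁ P₂ v p) hA hB
      (fun z _ => lintegral_collisionTerm_le hC hα hB₀ P₁.nonneg P₂.nonneg P₁.abs_le P₂.abs_le z)
      (fun z _ => by
        calc ∫⁻ p, ‖inner ℝ (collisionGrad e B₀ γ ι h₁ h₂ g₁ g₂ z p) v‖ₑ ∂collisionMeasure
            ≤ ∫⁻ p, ‖collisionGrad e B₀ γ ι h₁ h₂ g₁ g₂ z p‖ₑ * ‖v‖ₑ ∂collisionMeasure := by
              refine lintegral_mono fun p => ?_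
              rw [← enorm_norm, ← enorm_norm (collisionGrad _ _ _ _ _ _ _ _ _ _), ← enorm_norm v,
                ← enorm_mul, enorm_le_iff_norm_le, norm_norm, norm_mul, norm_norm, norm_norm]
              exact norm_inner_le_norm _ _
          _ = (∫⁻ p, ‖collisionGrad e B₀ γ ι h₁ h₂ g₁ g₂ z p‖ₑ ∂collisionMeasure) * ‖v‖ₑ :=
              lintegral_mul_const' _ _ enorm_ne_top
          _ ≤ ENNReal.ofReal (gradBound Ω α γ C K₁ K₂ L₁ L₂ g₁ z) * ‖v‖ₑ := by
              gcongr
              exact hlint z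
          _ = _ := by rw [ENNReal.ofReal_mul' (norm_nonneg _), ofReal_norm])
    convert key using 2 with z z
    · exact nonlinearTerm_eq_integral hC hα hB₀ P₁.nonneg P₂.nonneg P₁.measurable P₂.measurable
        P₁.abs_le P₂.abs_le z
    · rw [real_inner_comm, ← integral_inner (hint z)]
      simp_rw [real_inner_comm v]
  · have h0 : 0 ≤ gradBound Ω α γ C K₁ K₂ L₁ L₂ g₁ z := by
      have hd := bdryDist_rpow_nonneg Ω z.1 (-(1 / 2))
      have hK₁ := P₁.nonneg
      have hK₂ := P₂.nonneg
      have hL₁ := P₁.nonneg_grad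
      have hL₂ := P₂.nonneg_grad
      have := hC.1
      unfold gradBound
      positivity
    rw [← ENNReal.ofReal_le_ofReal_iff h0, ofReal_norm]
    exact hbd z

end Gradient

/-! ### Everywhere bounded representatives and the conclusion -/

section Representatives

open Filter Topology Function Metric

lemma HasWeakDeriv.congr_ae {E : Type*} [NormedAddCommGroup E] [NormedSpace ℝ E]
    [MeasurableSpace E] {μ : Measure E} {O : Set E} {w : E} {h g h' g' : E → ℝ}
    (H : HasWeakDeriv μ O w h g) (hh : h =ᵐ[μ.restrict O] h')
    (hg : g =ᵐ[μ.restrict O] g') : HasWeakDeriv μ O w h' g' where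
  locallyIntegrable := H.locallyIntegrable.congr hh
  locallyIntegrable_deriv := H.locallyIntegrable_deriv.congr hg
  integral_eq φ h1 h2 h3 := by
    rw [← integral_congr_ae (hh.fun_mul (ae_eq_refl (fun z => fderiv ℝ φ z w))),
      ← integral_congr_ae (hg.fun_mul (ae_eq_refl φ))]
    exact H.integral_eq φ h1 h2 h3

variable {Ω : Set V} {α B₀ γ C c K N : ℝ} {h h₁ h₂ h₁' h₂' : V × V → ℝ} {g G : V × V → V}

lemma locallyIntegrableOn_inner (hΩ : IsAdmissibleDomain Ω)
    (hg : LocallyIntegrableOn g (phase Ω)) (v : V) :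
    LocallyIntegrableOn (fun z => inner ℝ (g z) v) (phase Ω) := by
  rw [locallyIntegrableOn_iff hΩ.isOpen_phase.isLocallyClosed] at hg ⊢
  exact fun K hK hKc => (hg K hK hKc).inner_const v

lemma IsWeakGradX.hasWeakDeriv (hΩ : IsAdmissibleDomain Ω) (H : IsWeakGradX Ω h g) (v : V) :
    HasWeakDeriv volume (phase Ω) (ContinuousLinearMap.inl ℝ V V v) h
      (fun z => inner ℝ (g z) v) :=
  ⟨H.locallyIntegrable, locallyIntegrableOn_inner hΩ H.locallyIntegrable_grad v,
    fun φ h1 h2 h3 => H.integral_eq φ ⟨h1, h2, h3⟩ v⟩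

lemma IsWeakGradZeta.hasWeakDeriv (hΩ : IsAdmissibleDomain Ω) (H : IsWeakGradZeta Ω h g) (v : V) :
    HasWeakDeriv volume (phase Ω) (ContinuousLinearMap.inr ℝ V V v) h
      (fun z => inner ℝ (g z) v) :=
  ⟨H.locallyIntegrable, locallyIntegrableOn_inner hΩ H.locallyIntegrable_grad v,
    fun φ h1 h2 h3 => H.integral_eq φ ⟨h1, h2, h3⟩ v⟩

lemma isWeakGradX_of_hasWeakDeriv (hg : LocallyIntegrableOn g (phase Ω))
    (H : ∀ v, HasWeakDeriv volume (phase Ω) (ContinuousLinearMap.inl ℝ V V v) h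
      (fun z => inner ℝ (g z) v)) : IsWeakGradX Ω h g :=
  ⟨(H 0).locallyIntegrable, hg, fun φ hφ v =>
    (H v).integral_eq φ hφ.contDiff hφ.hasCompactSupport hφ.tsupport_subset⟩

lemma isWeakGradZeta_of_hasWeakDeriv (hg : LocallyIntegrableOn g (phase Ω))
    (H : ∀ v, HasWeakDeriv volume (phase Ω) (ContinuousLinearMap.inr ℝ V V v) h
      (fun z => inner ℝ (g z) v)) : IsWeakGradZeta Ω h g :=
  ⟨(H 0).locallyIntegrable, hg, fun φ hφ v =>
    (H v).integral_eq φ hφ.contDiff hφ.hasCompactSupport hφ.tsupport_subset⟩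

lemma MemWTilde.isWeakGradX (H : MemWTilde Ω α h) : IsWeakGradX Ω h (weakGradX Ω h) := by
  rw [weakGradX, dif_pos H.exists_gradX]
  exact H.exists_gradX.choose_spec

lemma MemWTilde.isWeakGradZeta (H : MemWTilde Ω α h) :
    IsWeakGradZeta Ω h (weakGradZeta Ω h) := by
  rw [weakGradZeta, dif_pos H.exists_gradZeta]
  exact H.exists_gradZeta.choose_spec

lemma ae_snd_ne_zero : ∀ᵐ z : V × V, z.2 ≠ 0 := by
  have h : {z : V × V | ¬ z.2 ≠ 0} = univ ×ˢ {0} := by ext z; simp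
  rw [ae_iff, h, Measure.volume_eq_prod, Measure.prod_prod, measure_singleton, mul_zero]

lemma le_mul_exp_neg_of_mul_exp_le {a b t : ℝ} (H : a * Real.exp (α * t) ≤ b) :
    a ≤ b * Real.exp (-α * t) := by
  rwa [neg_mul, Real.exp_neg, ← div_eq_mul_inv, le_div_iff₀ (Real.exp_pos _)]

/-- Almost everywhere bounds can be turned into everywhere bounds of measurable representatives,
which vanish where the bounds fail. -/
lemma exists_isProfile (hΩ : IsAdmissibleDomain Ω) {ι : V →L[ℝ] V × V} (hc : 0 ≤ c)
    (hw : ∀ x ∈ Ω, ∀ ζ, ζ ≠ 0 → 0 < weight Ω x ζ ∧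
      (weight Ω x ζ)⁻¹ ≤ c * bdryDist Ω x ^ (-(1 / 2) : ℝ) * (1 + ‖ζ‖⁻¹))
    (hK : 0 ≤ K) (hN : 0 ≤ N) (hm : AEStronglyMeasurable h (phaseMeasure Ω))
    (hh : ∀ᵐ z ∂phaseMeasure Ω, |h z| * Real.exp (α * ‖z.2‖ ^ 2) ≤ K)
    (hg : ∀ᵐ z ∂phaseMeasure Ω,
      ‖g z‖ * weight Ω z.1 z.2 * Real.exp (α * ‖z.2‖ ^ 2) ≤ N)
    (hloc : LocallyIntegrableOn g (phase Ω))
    (H : ∀ v, HasWeakDeriv volume (phase Ω) (ι v) h (fun z => inner ℝ (g z) v)) :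
    ∃ h' g', IsProfile Ω α ι h' g' K (N * c) ∧ h =ᵐ[phaseMeasure Ω] h' ∧
      ∀ᵐ z ∂phaseMeasure Ω, ‖g' z‖ ≤ N * (weight Ω z.1 z.2)⁻¹ * Real.exp (-α * ‖z.2‖ ^ 2) := by
  have hO := hΩ.isOpen_phase
  have hms : MeasurableSet (phase Ω) := hO.measurableSet
  have hmg : AEStronglyMeasurable g (phaseMeasure Ω) := hloc.aestronglyMeasurable
  set h₀ := hm.mk h
  set g₀ := hmg.mk g
  have mh₀ : Measurable h₀ := hm.stronglyMeasurable_mk.measurable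
  have mg₀ : Measurable g₀ := hmg.stronglyMeasurable_mk.measurable
  have md : Measurable (fun z : V × V => bdryDist Ω z.1 ^ (-(1 / 2) : ℝ)) := by
    have : Measurable (fun z : V × V => bdryDist Ω z.1) :=
      ((continuous_infDist_pt (frontier Ω)).comp continuous_fst).measurable
    fun_prop
  set S : Set (V × V) := {z | |h₀ z| ≤ K * Real.exp (-α * ‖z.2‖ ^ 2)}
  set T : Set (V × V) := {z | ‖g₀ z‖ ≤ N * c * bdryDist Ω z.1 ^ (-(1 / 2) : ℝ) * (1 + ‖z.2‖⁻¹)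
    * Real.exp (-α * ‖z.2‖ ^ 2)}
  have hS : MeasurableSet S := measurableSet_le (by fun_prop) (by fun_prop)
  have hT : MeasurableSet T := measurableSet_le (by fun_prop) (by fun_prop)
  have hgw : ∀ᵐ z ∂phaseMeasure Ω, ‖g z‖ ≤ N * (weight Ω z.1 z.2)⁻¹ * Real.exp (-α * ‖z.2‖ ^ 2)
      ∧ (weight Ω z.1 z.2)⁻¹ ≤ c * bdryDist Ω z.1 ^ (-(1 / 2) : ℝ) * (1 + ‖z.2‖⁻¹) := by
    filter_upwards [hg, ae_restrict_mem hms, ae_restrict_of_ae ae_snd_ne_zero] with z h1 h2 h3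
    obtain ⟨p, b⟩ := hw z.1 h2.1 z.2 h3
    refine ⟨?_, b⟩
    have := le_mul_exp_neg_of_mul_exp_le h1
    rwa [← le_div_iff₀ p, mul_div_right_comm, div_eq_mul_inv] at this
  have eh : h =ᵐ[phaseMeasure Ω] S.indicator h₀ := by
    filter_upwards [hm.ae_eq_mk, hh] with z h1 h2
    rw [indicator_of_mem, h1]
    change |hm.mk h z| ≤ _
    rw [← h1]
    exact le_mul_exp_neg_of_mul_exp_le h2
  have eg : g =ᵐ[phaseMeasure Ω] T.indicator g₀ := by
    filter_upwards [hmg.ae_eq_mk, hgw] with z h1 h2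
    rw [indicator_of_mem, h1]
    change ‖hmg.mk g z‖ ≤ _
    rw [← h1]
    refine h2.1.trans ?_
    rw [mul_assoc N c, mul_assoc N (c * _)]
    gcongr
    exact h2.2
  refine ⟨S.indicator h₀, T.indicator g₀, ⟨mh₀.indicator hS, mg₀.indicator hT, hK,
    mul_nonneg hN hc, fun z => ?_, fun z => ?_, hloc.congr eg, fun v => ?_⟩, eh, ?_⟩
  · by_cases hz : z ∈ S
    · rw [indicator_of_mem hz]; exact hz
    · rw [indicator_of_notMem hz, abs_zero]; positivity
  · by_cases hz : z ∈ T
    · rw [indicator_of_mem hz]; exact hz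
    · rw [indicator_of_notMem hz, norm_zero]
      have := bdryDist_rpow_nonneg Ω z.1 (-(1 / 2))
      positivity
  · refine (H v).congr_ae eh ?_
    filter_upwards [eg] with z hz
    rw [hz]
  · filter_upwards [eg, hgw] with z h1 h2
    rw [← h1]
    exact h2.1

/-- Changing the profiles on null sets changes the integrand of the collision operator only on
null sets, for almost every `(x, ζ)`. -/
lemma ae_collisionIntegrand_eq (hΩ : IsAdmissibleDomain Ω) (e : CollisionFrame) (B₀ γ : ℝ)
    (H₁ : h₁ =ᵐ[phaseMeasure Ω] h₁') (H₂ : h₂ =ᵐ[phaseMeasure Ω] h₂') :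
    ∀ᵐ z ∂phaseMeasure Ω, ∀ᵐ p ∂collisionMeasure,
      collisionIntegrand e B₀ γ (sqrtMaxwellianMul h₁ z.1) (sqrtMaxwellianMul h₂ z.1) z.2
        p.1 p.2.1 p.2.2
      = collisionIntegrand e B₀ γ (sqrtMaxwellianMul h₁' z.1) (sqrtMaxwellianMul h₂' z.1) z.2
        p.1 p.2.1 p.2.2 := by
  have hms : MeasurableSet (phase Ω) := hΩ.isOpen_phase.measurableSet
  have H := (ae_restrict_iff' hms).1 (H₁.and H₂)
  rw [ae_iff] at H
  have key := ae_collision_notMem e H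
  filter_upwards [ae_restrict_of_ae key, ae_restrict_mem hms, H₁] with z hz hzΩ hz₁
  have hx : ∀ a : V, (z.1, a) ∈ phase Ω := fun a => ⟨hzΩ.1, mem_univ _⟩
  filter_upwards [hz] with p hp
  simp only [not_not] at hp
  obtain ⟨h1, h2, h3⟩ := hp
  simp only [collisionIntegrand, sqrtMaxwellianMul, (h1 (hx _)).2, (h2 (hx _)).1,
    (h3 (hx _)).2, hz₁, Prod.mk.eta]

lemma collisionQ_congr_ae {e : CollisionFrame} {F G F' G' : V → ℝ} {ζ : V}
    (H : ∀ᵐ p ∂collisionMeasure, collisionIntegrand e B₀ γ F G ζ p.1 p.2.1 p.2.2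
      = collisionIntegrand e B₀ γ F' G' ζ p.1 p.2.1 p.2.2) :
    collisionQ e B₀ γ F G ζ = collisionQ e B₀ γ F' G' ζ := by
  refine integral_congr_ae ?_
  filter_upwards [Measure.ae_ae_of_ae_prod H] with u hu
  rw [intervalIntegral.integral_of_le Real.two_pi_pos.le,
    intervalIntegral.integral_of_le Real.two_pi_pos.le]
  refine integral_congr_ae ?_
  filter_upwards [Measure.ae_ae_of_ae_prod hu] with φ hφ
  rw [intervalIntegral.integral_of_le Real.pi_div_two_pos.le,
    intervalIntegral.integral_of_le Real.pi_div_two_pos.le]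
  exact integral_congr_ae hφ

lemma ae_le_toReal_of_essSup_le {X : Type*} [MeasurableSpace X] {μ : Measure X} {f : X → ℝ}
    {M : ENNReal} (h : essSup (fun z => ENNReal.ofReal (f z)) μ ≤ M) (hM : M ≠ ⊤) :
    ∀ᵐ z ∂μ, f z ≤ M.toReal := by
  filter_upwards [ENNReal.ae_le_essSup (μ := μ) (fun z => ENNReal.ofReal (f z))] with z hz
  exact (ENNReal.ofReal_le_iff_le_toReal hM).1 (hz.trans h)

lemma normLinf_le_normWTilde (Ω : Set V) (α : ℝ) (h : V × V → ℝ) :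
    normLinf Ω α h ≤ normWTilde Ω α h :=
  le_self_add.trans le_self_add

lemma weight_nonneg (Ω : Set V) (x ζ : V) : 0 ≤ weight Ω x ζ := by
  unfold weight normalCos; positivity

/-- The terms of `gradBound` without the factor `d_x^{-1/2}` are absorbed through `hd`, which holds
because `Ω` is bounded. -/
lemma gradBound_le {z : V × V} {C c K₁ K₂ N₁ N₂ w : ℝ} (hC : 0 ≤ C) (hc : 0 ≤ c) (hK₁ : 0 ≤ K₁)
    (hK₂ : 0 ≤ K₂) (h₁ : K₁ ≤ N₁) (h₂ : K₂ ≤ N₂)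
    (hd : 1 ≤ c * bdryDist Ω z.1 ^ (-(1 / 2) : ℝ)) (hw : 0 ≤ w)
    (hg : ‖g z‖ ≤ N₁ * w * Real.exp (-α * ‖z.2‖ ^ 2)) :
    gradBound Ω α γ C K₁ K₂ (N₁ * c) (N₂ * c) g z
      ≤ C * (5 * c + 2) * (bdryDist Ω z.1 ^ (-(1 / 2) : ℝ) + w) * N₁ * N₂
        * Real.exp (-α * ‖z.2‖ ^ 2) * (1 + ‖z.2‖) ^ γ := by
  have hd0 := bdryDist_rpow_nonneg Ω z.1 (-(1 / 2))
  unfold gradBound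
  set d := bdryDist Ω z.1 ^ (-(1 / 2) : ℝ)
  set E := Real.exp (-α * ‖z.2‖ ^ 2)
  have hE : 0 ≤ E := (Real.exp_pos _).le
  have hN₁ := hK₁.trans h₁
  have hN₂ := hK₂.trans h₂
  have hR : 0 ≤ (1 + ‖z.2‖) ^ γ := by positivity
  calc C * (1 + ‖z.2‖) ^ γ * (E * ((N₁ * c * K₂ + 2 * K₁ * (N₂ * c)) * d + 2 * K₁ * K₂)
        + K₂ * ‖g z‖)
      ≤ C * (1 + ‖z.2‖) ^ γ * (E * ((N₁ * c * N₂ + 2 * N₁ * (N₂ * c)) * d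
          + 2 * N₁ * N₂ * (c * d)) + N₂ * (N₁ * w * E)) := by
        have : 2 * K₁ * K₂ ≤ 2 * N₁ * N₂ * (c * d) :=
          (show 2 * K₁ * K₂ ≤ 2 * N₁ * N₂ by gcongr).trans
            (le_mul_of_one_le_right (by positivity) hd)
        gcongr
    _ = C * (5 * c * d + w) * N₁ * N₂ * E * (1 + ‖z.2‖) ^ γ := by ring
    _ ≤ C * ((5 * c + 2) * (d + w)) * N₁ * N₂ * E * (1 + ‖z.2‖) ^ γ := by
        gcongr
        nlinarith [mul_nonneg hc hw]
    _ = _ := by ring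

/-- The part of the theorem that concerns one gradient, with `ι` the inclusion of the directions
in which it is taken. -/
lemma exists_grad_nonlinearTerm_of_ae (hΩ : IsAdmissibleDomain Ω) (hC : IsCollisionConst B₀ γ C)
    (hα : 0 ≤ α) (hB₀ : 0 < B₀) {ι : V →L[ℝ] V × V} (hι : ∀ v, ‖(ι v).2‖ ≤ ‖v‖) (hc : 0 ≤ c)
    (hd : ∀ x ∈ Ω, 1 ≤ c * bdryDist Ω x ^ (-(1 / 2) : ℝ))
    (hw : ∀ x ∈ Ω, ∀ ζ, ζ ≠ 0 → 0 < weight Ω x ζ ∧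
      (weight Ω x ζ)⁻¹ ≤ c * bdryDist Ω x ^ (-(1 / 2) : ℝ) * (1 + ‖ζ‖⁻¹))
    {G₁ G₂ : V × V → V} (H₁ : MemWTilde Ω α h₁) (H₂ : MemWTilde Ω α h₂)
    (hl₁ : LocallyIntegrableOn G₁ (phase Ω)) (hl₂ : LocallyIntegrableOn G₂ (phase Ω))
    (hG₁ : ∀ v, HasWeakDeriv volume (phase Ω) (ι v) h₁ (fun z => inner ℝ (G₁ z) v))
    (hG₂ : ∀ v, HasWeakDeriv volume (phase Ω) (ι v) h₂ (fun z => inner ℝ (G₂ z) v))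
    (hn₁ : essSup (fun z => ENNReal.ofReal
      (‖G₁ z‖ * weight Ω z.1 z.2 * Real.exp (α * ‖z.2‖ ^ 2))) (phaseMeasure Ω) ≤ normWTilde Ω α h₁)
    (hn₂ : essSup (fun z => ENNReal.ofReal
      (‖G₂ z‖ * weight Ω z.1 z.2 * Real.exp (α * ‖z.2‖ ^ 2))) (phaseMeasure Ω) ≤ normWTilde Ω α h₂)
    (e : CollisionFrame) :
    (∀ᵐ z ∂phaseMeasure Ω,
      CollisionConverges e B₀ γ (sqrtMaxwellianMul h₁ z.1) (sqrtMaxwellianMul h₂ z.1) z.2) ∧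
    (∀ᵐ z ∂phaseMeasure Ω, |nonlinearTerm e B₀ γ h₁ h₂ z| ≤ C * (1 + ‖z.2‖) ^ γ
      * (2 * (normLinf Ω α h₁).toReal * (normLinf Ω α h₂).toReal
        * Real.exp (-α * ‖z.2‖ ^ 2))) ∧
    ∃ g : V × V → V, LocallyIntegrableOn g (phase Ω) ∧
      (∀ v, HasWeakDeriv volume (phase Ω) (ι v) (nonlinearTerm e B₀ γ h₁ h₂)
        (fun z => inner ℝ (g z) v)) ∧
      ∀ᵐ z ∂phaseMeasure Ω,
        ‖g z‖ ≤ C * (5 * c + 2) * (bdryDist Ω z.1 ^ (-(1 / 2) : ℝ) + (weight Ω z.1 z.2)⁻¹)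
          * (normWTilde Ω α h₁).toReal * (normWTilde Ω α h₂).toReal
          * Real.exp (-α * ‖z.2‖ ^ 2) * (1 + ‖z.2‖) ^ γ := by
  have hms : MeasurableSet (phase Ω) := hΩ.isOpen_phase.measurableSet
  have t₁ := ((normLinf_le_normWTilde Ω α h₁).trans_lt H₁.norm_lt_top).ne
  have t₂ := ((normLinf_le_normWTilde Ω α h₂).trans_lt H₂.norm_lt_top).ne
  obtain ⟨k₁, g₁, P₁, e₁, b₁⟩ := exists_isProfile hΩ hc hw ENNReal.toReal_nonneg
    ENNReal.toReal_nonneg H₁.aestronglyMeasurable (ae_le_toReal_of_essSup_le le_rfl t₁)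
    (ae_le_toReal_of_essSup_le hn₁ H₁.norm_lt_top.ne) hl₁ hG₁
  obtain ⟨k₂, g₂, P₂, e₂, -⟩ := exists_isProfile hΩ hc hw ENNReal.toReal_nonneg
    ENNReal.toReal_nonneg H₂.aestronglyMeasurable (ae_le_toReal_of_essSup_le le_rfl t₂)
    (ae_le_toReal_of_essSup_le hn₂ H₂.norm_lt_top.ne) hl₂ hG₂
  have hint := ae_collisionIntegrand_eq hΩ e B₀ γ e₁ e₂
  have hΓ : nonlinearTerm e B₀ γ h₁ h₂ =ᵐ[phaseMeasure Ω] nonlinearTerm e B₀ γ k₁ k₂ := by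
    filter_upwards [hint] with z hz
    rw [nonlinearTerm, nonlinearTerm, collisionQ_congr_ae hz]
  refine ⟨?_, ?_, ?_⟩
  · filter_upwards [hint] with z hz
    exact (collisionConverges_of_bounded hC hα hB₀ P₁.nonneg P₂.nonneg P₁.measurable
      P₂.measurable P₁.abs_le P₂.abs_le z).congr (hz.mono fun _ h => h.symm)
  · filter_upwards [hΓ] with z hz
    rw [hz]
    exact abs_nonlinearTerm_le hC hα hB₀ P₁.nonneg P₂.nonneg P₁.measurable
      P₂.measurable P₁.abs_le P₂.abs_le z
  · obtain ⟨g, hg, hwd, hb⟩ := exists_grad_nonlinearTerm hΩ hC hα hB₀ hι P₁ P₂ e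
    refine ⟨g, hg, fun v => (hwd v).congr_ae hΓ.symm (ae_eq_refl _), ?_⟩
    filter_upwards [b₁, ae_restrict_mem hms] with z hz hzΩ
    exact (hb z).trans (gradBound_le hC.1.le hc P₁.nonneg P₂.nonneg
      (ENNReal.toReal_mono H₁.norm_lt_top.ne (normLinf_le_normWTilde _ _ _))
      (ENNReal.toReal_mono H₂.norm_lt_top.ne (normLinf_le_normWTilde _ _ _))
      (hd z.1 hzΩ.1) (inv_nonneg.2 (weight_nonneg _ _ _)) hz)

end Representatives

end Boltzmann

end

open Boltzmann in
theorem lemma1p5 (Ω : Set V) (hΩ : IsAdmissibleDomain Ω) (α : ℝ) (hα₀ : 0 ≤ α) (hα₁ : α < 1 / 2)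
    (B₀ γ : ℝ) (hB₀ : 0 < B₀) (hγ₀ : 0 ≤ γ) (hγ₁ : γ ≤ 1) :
    ∃ C : ℝ, 0 < C ∧ ∀ (e : CollisionFrame) (h₁ h₂ : V × V → ℝ),
      MemWTilde Ω α h₁ → MemWTilde Ω α h₂ →
      (∀ᵐ z ∂phaseMeasure Ω,
        CollisionConverges e B₀ γ (sqrtMaxwellianMul h₁ z.1) (sqrtMaxwellianMul h₂ z.1) z.2) ∧
      (∀ᵐ z ∂phaseMeasure Ω,
        |nonlinearTerm e B₀ γ h₁ h₂ z| ≤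
          C * (normLinf Ω α h₁).toReal * (normLinf Ω α h₂).toReal
            * Real.exp (-α * ‖z.2‖ ^ 2) * (1 + ‖z.2‖) ^ γ) ∧
      (∃ g : V × V → V, IsWeakGradX Ω (nonlinearTerm e B₀ γ h₁ h₂) g ∧
        ∀ᵐ z ∂phaseMeasure Ω,
          ‖g z‖ ≤ C * (bdryDist Ω z.1 ^ (-(1 / 2) : ℝ) + (weight Ω z.1 z.2)⁻¹)
            * (normWTilde Ω α h₁).toReal * (normWTilde Ω α h₂).toReal
            * Real.exp (-α * ‖z.2‖ ^ 2) * (1 + ‖z.2‖) ^ γ) ∧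
      (∃ g : V × V → V, IsWeakGradZeta Ω (nonlinearTerm e B₀ γ h₁ h₂) g ∧
        ∀ᵐ z ∂phaseMeasure Ω,
          ‖g z‖ ≤ C * (bdryDist Ω z.1 ^ (-(1 / 2) : ℝ) + (weight Ω z.1 z.2)⁻¹)
            * (normWTilde Ω α h₁).toReal * (normWTilde Ω α h₂).toReal
            * Real.exp (-α * ‖z.2‖ ^ 2) * (1 + ‖z.2‖) ^ γ) := by
  obtain ⟨C, hC⟩ := exists_isCollisionConst hB₀ hγ₀ hγ₁
  obtain ⟨c, hc, hd, hw⟩ := hΩ.exists_weight_inv_le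
  have hC₀ := hC.1
  refine ⟨C * (5 * c + 2), by positivity, fun e h₁ h₂ H₁ H₂ => ?_⟩
  obtain ⟨conv, bound, g, hg, hgw, hgb⟩ := exists_grad_nonlinearTerm_of_ae hΩ hC hα₀ hB₀
    (ι := ContinuousLinearMap.inl ℝ V V) (fun v => by simp) hc.le hd hw H₁ H₂
    H₁.isWeakGradX.locallyIntegrable_grad H₂.isWeakGradX.locallyIntegrable_grad
    (H₁.isWeakGradX.hasWeakDeriv hΩ) (H₂.isWeakGradX.hasWeakDeriv hΩ)
    (le_add_self.trans le_self_add) (le_add_self.trans le_self_add) e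
  obtain ⟨-, -, g', hg', hgw', hgb'⟩ := exists_grad_nonlinearTerm_of_ae hΩ hC hα₀ hB₀
    (ι := ContinuousLinearMap.inr ℝ V V) (fun v => by simp) hc.le hd hw H₁ H₂
    H₁.isWeakGradZeta.locallyIntegrable_grad H₂.isWeakGradZeta.locallyIntegrable_grad
    (H₁.isWeakGradZeta.hasWeakDeriv hΩ) (H₂.isWeakGradZeta.hasWeakDeriv hΩ)
    le_add_self le_add_self e
  refine ⟨conv, ?_, ⟨g, isWeakGradX_of_hasWeakDeriv hg hgw, hgb⟩,
    ⟨g', isWeakGradZeta_of_hasWeakDeriv hg' hgw', hgb'⟩⟩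
  filter_upwards [bound] with z hz
  calc |nonlinearTerm e B₀ γ h₁ h₂ z|
      ≤ C * (1 + ‖z.2‖) ^ γ * (2 * (normLinf Ω α h₁).toReal * (normLinf Ω α h₂).toReal
        * Real.exp (-α * ‖z.2‖ ^ 2)) := hz
    _ = C * 2 * (normLinf Ω α h₁).toReal * (normLinf Ω α h₂).toReal
        * Real.exp (-α * ‖z.2‖ ^ 2) * (1 + ‖z.2‖) ^ γ := by ring
    _ ≤ _ := by
        gcongr
        linarith
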